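/- Let $n\ge 1$ and $\alpha_1,\dots,\alpha_n\in\mathbb{C}\setminus\mathbb{Z}$. Consider the generalized hypergeometric equation in the maximally unipotent case $\beta_1=\dots=\beta_n=1$, $$\big[z(\theta+\alpha_1)\cdots(\theta+\alpha_n)-\theta^n\big]f=0,\qquad \theta=z\,\frac{d}{dz}.$$ For $z\in\mathbb{C}\setminus\mathbb{R}_{\ge 0}$ take $\arg z\in(0,2\pi)$, and set $\log z=\log|z|+i\arg z$, $z^s=e^{s\log z}$. For $0<r\le 1$ let $D_r=\{z\in\mathbb{C}\setminus\mathbb{R}_{\ge0}: |z|<r\}$. A Frobenius basis on the disc $|z|<r$ is given by functions $h_0,\dots,h_{n-1}$, analytic on $|z|<r$ and vanishing at $0$, such that $f_0=1+h_0$ and $$f_k=\frac{1}{k!}f_0\log^k(z)+\sum_{l=0}^{k-1}\frac{1}{l!}h_{k-l}\log^l(z)\qquad (1\le k\le n-1)$$ are solutions on $D_r$. Let $L$ be a simple, piecewise continuously differentiable path from $i\infty$ to $-i\infty$ that coincides with the imaginary axis outside a bounded set and has all points $-\alpha_k-m$ on its left and all points $m$ on its right ($1\le k\le n$, $m\in\mathbb{Z}_{\ge0}$).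 The (normalized) Mellin–Barnes integrals are, for $k=0,\dots,n-1$ and $z\in\mathbb{C}\setminus\mathbb{R}_{\ge0}$, $$I_k(z)=\frac{(-1)^n}{(2\pi i)^n}\int_L\frac{\Gamma(\alpha_1+s)\cdots\Gamma(\alpha_n+s)}{\Gamma(\alpha_1)\cdots\Gamma(\alpha_n)}\,\Gamma(-s)^n\,e^{(2k-n)\pi i s}z^s\,ds .$$ Then a Frobenius basis exists on $|z|<1$. For every $0<r\le1$, the functions $h_0,\dots,h_{n-1}$ of a Frobenius basis on $|z|<r$ are unique, and $f_{n-1}/(2\pi i)^{n-1},\,f_{n-2}/(2\pi i)^{n-2},\dots,f_0$ is an ordered basis of the space of holomorphic solutions on $D_r$. For every such $L$, the integrals $I_k(z)$ converge absolutely for all $z\in\mathbb{C}\setminus\mathbb{R}_{\ge0}$, the functions $I_0,\dots,I_{n-1}$ form a basis of the same solution space, and a matrix $T=(T_{kl})_{0\le k,l\le n-1}$ satisfies $$I_k=\sum_{l=0}^{n-1}T_{kl}\,\frac{f_{n-1-l}}{(2\pi i)^{n-1-l}}\quad\text{on } D_r\qquad(k=0,\dots,n-1)$$ if and only if $T=Q\Phi$.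 Here $Q_{kl}=\dfrac{(k-\frac n2)^l}{l!}$ for $k,l=0,\dots,n-1$ (with $0^0=1$), and $\Phi$ is the upper triangular Toeplitz matrix with $$\Phi_{kl}=\frac{\phi^{(l-k)}(0)}{(l-k)!\,(2\pi i)^{l-k}}\ \ (k\le l),\qquad \Phi_{kl}=0\ \ (k>l),$$ where $$\phi(s)=\frac{\Gamma(\alpha_1+s)\cdots\Gamma(\alpha_n+s)}{\Gamma(\alpha_1)\cdots\Gamma(\alpha_n)}\,\Gamma(1-s)^n .$$ -/

import Mathlib

namespace HypergeometricFrobenius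

open Complex

noncomputable section

/-- The operator `θ + a`, where `θ = z d/dz`. -/
def eulerShift (a : ℂ) (f : ℂ → ℂ) : ℂ → ℂ := fun z => z * deriv f z + a * f z

/-- The operator `(θ + a₁) ⋯ (θ + aₙ)`. -/
def eulerProd {n : ℕ} (a : Fin n → ℂ) (f : ℂ → ℂ) : ℂ → ℂ :=
  (List.ofFn a).foldr eulerShift f

/-- `f` is a holomorphic solution on `U` (an open set in all uses) of the generalized
hypergeometric equation
`[z (θ + α₁) ⋯ (θ + αₙ) - (θ + β₁ - 1) ⋯ (θ + βₙ - 1)] f = 0`. -/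
def IsSolution {n : ℕ} (α β : Fin n → ℂ) (U : Set ℂ) (f : ℂ → ℂ) : Prop :=
  DifferentiableOn ℂ f U ∧
    ∀ z ∈ U, z * eulerProd α f z - eulerProd (fun k => β k - 1) f z = 0

/-- `F` is an ordered basis of the space of solutions on `U`: its members are solutions, and every
solution is, on `U`, a linear combination of them with unique coefficients. -/
def IsSolutionBasis {n : ℕ} (α β : Fin n → ℂ) (U : Set ℂ) (F : Fin n → ℂ → ℂ) : Prop :=
  (∀ k, IsSolution α β U (F k)) ∧
    ∀ g, IsSolution α β U g → ∃! c : Fin n → ℂ, ∀ z ∈ U, g z = ∑ k, c k * F k z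

/-- The slit plane `ℂ ∖ ℝ_{≥ 0}`. -/
def cutPlane : Set ℂ := {z | ¬ (0 ≤ z.re ∧ z.im = 0)}

/-- The slit disc `{z ∈ ℂ ∖ ℝ_{≥ 0} : |z| < r}`. -/
def cutDisc (r : ℝ) : Set ℂ := Metric.ball 0 r ∩ cutPlane

/-- The branch `log |z| + i arg z` of the logarithm on `ℂ ∖ ℝ_{≥ 0}` with `arg z ∈ (0, 2π)`:
the principal argument of `-z` lies in `(-π, π)`, and `arg z` is that argument plus `π`. -/
def cutLog (z : ℂ) : ℂ := Complex.log (-z) + Real.pi * I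

/-- `p` lies to the left of the curve `γ`: the connected component of `p` in `ℂ ∖ γ` contains all
`s` of negative real part with `|s|` big enough. -/
def IsLeftOf (γ : ℝ → ℂ) (p : ℂ) : Prop :=
  ∃ M : ℝ, ∀ s : ℂ, M < ‖s‖ → s.re < 0 → s ∈ connectedComponentIn (Set.range γ)ᶜ p

/-- `p` lies to the right of the curve `γ`: the connected component of `p` in `ℂ ∖ γ` contains all
`s` of positive real part with `|s|` big enough. -/
def IsRightOf (γ : ℝ → ℂ) (p : ℂ) : Prop :=
  ∃ M : ℝ, ∀ s : ℂ, M < ‖s‖ → 0 < s.re → s ∈ connectedComponentIn (Set.range γ)ᶜ p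

/-- Admissible contours `L` for the Mellin–Barnes integrals: simple, piecewise continuously
differentiable paths from `i∞` to `-i∞`, running along the imaginary axis outside a bounded
parameter interval, with all `-αₖ - m` on the left and all `1 - βₖ + m` on the right
(`m = 0, 1, 2, …`). -/
structure IsContour {n : ℕ} (α β : Fin n → ℂ) (γ : ℝ → ℂ) : Prop where
  continuous : Continuous γ
  injective : Function.Injective γ
  piecewise : ∃ S : Set ℝ, S.Finite ∧ (∀ t ∉ S, ContDiffAt ℝ 1 γ t) ∧
    ∃ C : ℝ, ∀ t ∉ S, ‖deriv γ t‖ ≤ C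
  axis : ∃ R : ℝ, ∀ t : ℝ, R ≤ |t| → γ t = -(t * I)
  left : ∀ (k : Fin n) (m : ℕ), IsLeftOf γ (-α k - m)
  right : ∀ (k : Fin n) (m : ℕ), IsRightOf γ (1 - β k + m)

/-- The integrand `∏ₖ Γ(αₖ + s) Γ(1 - βₖ - s) · e^{(2j - n) π i s} z^s`,
where `z^s = e^{s log z}` with `arg z ∈ (0, 2π)`. -/
def mbIntegrand {n : ℕ} (α β : Fin n → ℂ) (j : Fin n) (z s : ℂ) : ℂ :=
  (∏ k, Gamma (α k + s) * Gamma (1 - β k - s)) *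
    exp ((2 * ((j : ℕ) : ℂ) - (n : ℂ)) * Real.pi * I * s) * exp (s * cutLog z)

/-- The Mellin–Barnes integral `I_j(z)`, taken over the contour `γ`. -/
def mellinBarnes {n : ℕ} (α β : Fin n → ℂ) (γ : ℝ → ℂ) (j : Fin n) (z : ℂ) : ℂ :=
  (-1) ^ n / (2 * Real.pi * I) ^ n * ∫ t : ℝ, mbIntegrand α β j z (γ t) * deriv γ t

/-- The Mellin–Barnes integral divided by `Γ(α₁) ⋯ Γ(αₙ)`. -/
def normMellinBarnes {n : ℕ} (α β : Fin n → ℂ) (γ : ℝ → ℂ) (j : Fin n) (z : ℂ) : ℂ :=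
  mellinBarnes α β γ j z / ∏ k, Gamma (α k)

/-- `f₀ = 1 + h₀` and `f_k = f₀ log^k / k! + ∑_{l < k} h_{k-l} log^l / l!`. -/
def frobeniusFun (h : ℕ → ℂ → ℂ) (k : ℕ) (z : ℂ) : ℂ :=
  (1 + h 0 z) * cutLog z ^ k / (k.factorial : ℂ) +
    ∑ l ∈ Finset.range k, h (k - l) z * cutLog z ^ l / (l.factorial : ℂ)

/-- In the maximally unipotent case `β₁ = … = βₙ = 1`, the functions `h₀, …, h_{n-1}` define a
Frobenius basis on the disc of radius `r` around `0`: they are analytic there, vanish at `0`, and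
the corresponding `f₀, …, f_{n-1}` are solutions. -/
def IsFrobenius {n : ℕ} (α : Fin n → ℂ) (r : ℝ) (h : ℕ → ℂ → ℂ) : Prop :=
  ∀ l < n, AnalyticOnNhd ℂ (h l) (Metric.ball 0 r) ∧ h l 0 = 0 ∧
    IsSolution α (fun _ => 1) (cutDisc r) (frobeniusFun h l)

/-- The ordered family `f_{n-1}/(2πi)^{n-1}, …, f₁/(2πi), f₀`. -/
def frobeniusFamily {n : ℕ} (h : ℕ → ℂ → ℂ) (l : Fin n) (z : ℂ) : ℂ :=
  frobeniusFun h (n - 1 - (l : ℕ)) z / (2 * Real.pi * I) ^ (n - 1 - (l : ℕ))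

/-- `φ(s) = ∏ₖ Γ(αₖ + s)/Γ(αₖ) · Γ(1 - s)ⁿ`. -/
def phi {n : ℕ} (α : Fin n → ℂ) (s : ℂ) : ℂ :=
  (∏ k, Gamma (α k + s)) / (∏ k, Gamma (α k)) * Gamma (1 - s) ^ n

/-- `Q_{kl} = (k - n/2)^l / l!`, for `k, l = 0, …, n-1`. -/
def matrixQ (n : ℕ) : Matrix (Fin n) (Fin n) ℂ :=
  Matrix.of fun k l => (((k : ℕ) : ℂ) - (n : ℂ) / 2) ^ (l : ℕ) / ((l : ℕ).factorial : ℂ)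

/-- The upper triangular Toeplitz matrix with entries `φ^{(l-k)}(0) / ((l-k)! (2πi)^{l-k})`. -/
def matrixPhi {n : ℕ} (α : Fin n → ℂ) : Matrix (Fin n) (Fin n) ℂ :=
  Matrix.of fun k l =>
    if k ≤ l then
      iteratedDeriv ((l : ℕ) - (k : ℕ)) (phi α) 0 /
        (((l : ℕ) - (k : ℕ)).factorial * (2 * Real.pi * I) ^ ((l : ℕ) - (k : ℕ)))
    else 0

end

end HypergeometricFrobenius

namespace HypergeometricFrobenius

open Complex Filter Topology MeasureTheory Set

/-! Write `a_m(s) = ∏_{i<m} ∏_k (α_k + i + s)/(1 + i + s)`. Since `θ` multiplies `z^{m+s}` by `m +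
s`, the hypergeometric operator sends `∑ a_m(s) z^{m+s}` to `-s^n z^s`. Modulo `s^n` the series is
therefore a solution, and its coefficients of `s^k`, `k < n`, are the functions `f_k` of a Frobenius
basis on the unit disc (`isSolution_logSum`, `isFrobenius_frobeniusCoeff`).

A solution is determined by the values of `f, θf, …, θ^{n-1}f` at one point (`IsSolution.eq_zero`,
by Grönwall), so `n` independent solutions form a basis (`isSolutionBasis_of_linearIndependent`).
Independence of the `f_k` and uniqueness of the `h_k` hold because the powers of the logarithm are
independent over functions holomorphic on the disc (`eq_zero_of_sum_mul_cutLog_pow`).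

The Mellin–Barnes integrand `F` satisfies `F(s + m) = F(s) z^m a_m(s)`, and near `0` it is `(-1)^n ∏
Γ(α_k) · φ(s) e^{(2j-n)πis} z^s / s^n`. Moving the contour to `Re s = N + 1/2` crosses the poles `0,
…, N` (`IsContour.integral_add_integral_midLine`), and for `|z| < 1` the integrals over these lines
tend to `0`. Up to normalization the residues add up to the coefficient of `s^{n-1}` in `φ(s)
e^{(2j-n)πis} ∑ a_m(s) z^{m+s}`, which is the sum over `l` of the `l`-th Taylor coefficient of `φ(s)
e^{(2j-n)πis}` times `f_{n-1-l}`. As `(2j-n)πi = (j - n/2)·2πi`, these Taylor coefficients, divided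
by `(2πi)^l`, are row `j` of `QΦ`. `Q` is a Vandermonde matrix times an invertible diagonal one and
`Φ` is unipotent, so the integrals form a basis too.

Two inputs remain. Convergence rests on the decay `e^{-(π/2-δ)|Im s|}` of `Γ` and on `|(2j-n)π + arg
z| < nπ`. The contour shift rests on the index of the path: `1/s` centred at a point on the left or
right integrates to `-πi` or `πi` (`hasPV_inv_of_isLeftOf`, `hasPV_inv_of_isRightOf`), and the
integrand minus its principal parts has a primitive on a strip
(`tendsto_integral_add_integral_line`). -/

/-! ### Euler's integral with complex rate and the decay of `Γ` in vertical strips. -/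

lemma integrableOn_rpow_mul_exp_neg_mul {σ ε : ℝ} (hσ : 0 < σ) (hε : 0 < ε) :
    IntegrableOn (fun x : ℝ => x ^ (σ - 1) * Real.exp (-(ε * x))) (Ioi 0) := by
  have h := integrableOn_rpow_mul_exp_neg_mul_rpow (p := 1) (s := σ - 1) (b := ε)
    (by linarith) one_pos hε
  simpa using h

lemma norm_cpow_mul_exp_neg_mul {a r : ℂ} {x : ℝ} (hx : 0 < x) :
    ‖(x : ℂ) ^ (a - 1) * exp (-(r * x))‖ = x ^ (a.re - 1) * Real.exp (-(r.re * x)) := by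
  rw [norm_mul, norm_cpow_eq_rpow_re_of_pos hx, norm_exp]
  simp

lemma continuousOn_cpow_mul_exp_neg_mul (a r : ℂ) :
    ContinuousOn (fun x : ℝ => (x : ℂ) ^ (a - 1) * exp (-(r * x))) (Ioi 0) := by
  intro x hx
  refine ContinuousAt.continuousWithinAt (ContinuousAt.mul ?_ (by fun_prop))
  exact (continuousAt_cpow_const (Or.inl (by simpa using hx))).comp
    (f := fun x : ℝ => (x : ℂ)) continuous_ofReal.continuousAt

lemma integrableOn_cpow_mul_exp_neg_mul {a r : ℂ} (ha : 0 < a.re) (hr : 0 < r.re) :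
    IntegrableOn (fun x : ℝ => (x : ℂ) ^ (a - 1) * exp (-(r * x))) (Ioi 0) := by
  refine (integrableOn_rpow_mul_exp_neg_mul ha hr).mono'
    ((continuousOn_cpow_mul_exp_neg_mul a r).aestronglyMeasurable measurableSet_Ioi) ?_
  filter_upwards [ae_restrict_mem measurableSet_Ioi] with x hx
  exact (norm_cpow_mul_exp_neg_mul hx).le

lemma differentiableAt_integral_cpow_mul_exp {a r : ℂ} (ha : 0 < a.re) (hr : 0 < r.re) :
    DifferentiableAt ℂ
      (fun r : ℂ => ∫ x : ℝ in Ioi 0, (x : ℂ) ^ (a - 1) * exp (-(r * x))) r := by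
  have hs : {w : ℂ | r.re / 2 < w.re} ∈ 𝓝 r :=
    (isOpen_lt continuous_const continuous_re).mem_nhds (by simpa using hr)
  have hcont : ∀ w : ℂ, ContinuousOn
      (fun x : ℝ => (x : ℂ) ^ (a - 1) * (exp (-(w * x)) * -(x : ℂ))) (Ioi 0) := by
    intro w
    have := (continuousOn_cpow_mul_exp_neg_mul a w).mul
      (f := fun x : ℝ => (x : ℂ) ^ (a - 1) * exp (-(w * x))) (g := fun x : ℝ => -(x : ℂ))
      (by fun_prop)
    exact this.congr fun x _ => by simp only [Pi.mul_apply, mul_assoc]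
  refine (hasDerivAt_integral_of_dominated_loc_of_deriv_le (μ := volume.restrict (Ioi (0 : ℝ)))
    (bound := fun x : ℝ => x ^ (a.re + 1 - 1) * Real.exp (-(r.re / 2 * x)))
    (F' := fun w x => (x : ℂ) ^ (a - 1) * (exp (-(w * x)) * -(x : ℂ)))
    hs (Eventually.of_forall fun w =>
      (continuousOn_cpow_mul_exp_neg_mul a w).aestronglyMeasurable measurableSet_Ioi)
    (integrableOn_cpow_mul_exp_neg_mul ha hr)
    ((hcont r).aestronglyMeasurable measurableSet_Ioi) ?_
    (integrableOn_rpow_mul_exp_neg_mul (by linarith) (by linarith)) ?_).2.differentiableAt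
  · filter_upwards [ae_restrict_mem measurableSet_Ioi] with x hx w hw
    have hx' : (0 : ℝ) < x := hx
    rw [← mul_assoc, norm_mul, norm_cpow_mul_exp_neg_mul hx', norm_neg, norm_real,
      Real.norm_of_nonneg hx'.le, mul_right_comm, ← Real.rpow_add_one hx'.ne',
      sub_add_cancel, add_sub_cancel_right]
    have : r.re / 2 < w.re := hw
    gcongr
  · refine Eventually.of_forall fun x w _ => ?_
    have h1 : HasDerivAt (fun w : ℂ => -(w * x)) (-(x : ℂ)) w := by
      simpa using ((hasDerivAt_id w).mul_const (x : ℂ)).fun_neg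
    exact h1.cexp.const_mul _

/-- Euler's integral with a complex rate `r` of positive real part. -/
theorem integral_cpow_mul_exp_neg_mul_Ioi_of_re_pos {a r : ℂ} (ha : 0 < a.re) (hr : 0 < r.re) :
    ∫ x : ℝ in Ioi 0, (x : ℂ) ^ (a - 1) * exp (-(r * x)) = r ^ (-a) * Gamma a := by
  have hopen : IsOpen {w : ℂ | 0 < w.re} := isOpen_lt continuous_const continuous_re
  have hpre : IsPreconnected {w : ℂ | 0 < w.re} := (convex_halfSpace_re_gt 0).isPreconnected
  have h1 : AnalyticOnNhd ℂ
      (fun r : ℂ => ∫ x : ℝ in Ioi 0, (x : ℂ) ^ (a - 1) * exp (-(r * x))) {w : ℂ | 0 < w.re} :=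
    DifferentiableOn.analyticOnNhd (fun w hw =>
      (differentiableAt_integral_cpow_mul_exp ha hw).differentiableWithinAt) hopen
  have h2 : AnalyticOnNhd ℂ (fun r : ℂ => r ^ (-a) * Gamma a) {w : ℂ | 0 < w.re} := by
    refine DifferentiableOn.analyticOnNhd (fun w hw => ?_) hopen
    refine DifferentiableAt.differentiableWithinAt (DifferentiableAt.mul_const ?_ _)
    exact differentiableAt_id.cpow_const (Or.inl hw)
  -- Both sides are analytic in `r` on the right half-plane. By the identity theorem it suffices to
  -- compare them at the real points `1 + 1/(n+1)`, which accumulate at `1`.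
  refine h1.eqOn_of_preconnected_of_frequently_eq h2 hpre (z₀ := 1) (by simp) ?_ hr
  have hlim : Tendsto (fun n : ℕ => ((1 + 1 / ((n : ℝ) + 1) : ℝ) : ℂ)) atTop (𝓝[≠] 1) := by
    refine tendsto_nhdsWithin_iff.2 ⟨?_, Eventually.of_forall fun n => ?_⟩
    · have := (tendsto_one_div_add_atTop_nhds_zero_nat (𝕜 := ℝ)).const_add 1
      rw [add_zero] at this
      exact_mod_cast (continuous_ofReal.tendsto 1).comp this
    · have : (0 : ℝ) < 1 / ((n : ℝ) + 1) := by positivity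
      simp only [mem_compl_iff, mem_singleton_iff]
      intro h
      have h' : (1 + 1 / ((n : ℝ) + 1) : ℝ) = 1 := by exact_mod_cast h
      linarith
  refine hlim.frequently (Frequently.of_forall fun n => ?_)
  have hpos : (0 : ℝ) < 1 + 1 / ((n : ℝ) + 1) := by positivity
  have := integral_cpow_mul_exp_neg_mul_Ioi ha hpos
  rw [this, one_div, inv_cpow _ _ (by rw [arg_ofReal_of_nonneg hpos.le]; exact Real.pi_pos.ne),
    cpow_neg]

/-- Euler's integral along the ray of angle `θ`, i.e. with rate `e^{iθ}`: the factor `(e^{iθ})^{-s}`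
has norm `e^{θ Im s}`, while the integral is bounded through `Re e^{iθ} = cos θ`. Angles close to
`±π/2` give almost the full decay of `Γ`. -/
lemma norm_Gamma_le {s : ℂ} (hs : 0 < s.re) {θ : ℝ} (hθ : |θ| < Real.pi / 2) :
    ‖Gamma s‖ ≤ (1 / Real.cos θ) ^ s.re * Real.Gamma s.re * Real.exp (-(θ * s.im)) := by
  obtain ⟨hθ1, hθ2⟩ := abs_lt.1 hθ
  have hcos : 0 < Real.cos θ := Real.cos_pos_of_mem_Ioo ⟨hθ1, hθ2⟩
  have hre : (exp (θ * I)).re = Real.cos θ := exp_ofReal_mul_I_re θ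
  have key := integral_cpow_mul_exp_neg_mul_Ioi_of_re_pos (r := exp (θ * I)) hs (by rwa [hre])
  have hlog : log (exp (θ * I)) = θ * I := by
    apply log_exp <;> simp <;> linarith [Real.pi_pos]
  have hnorm : ‖exp (θ * I) ^ (-s)‖ = Real.exp (θ * s.im) := by
    rw [cpow_def_of_ne_zero (exp_ne_zero _), hlog, norm_exp]
    simp
  have hle : ‖∫ x : ℝ in Ioi 0, (x : ℂ) ^ (s - 1) * exp (-(exp (θ * I) * x))‖ ≤
      (1 / Real.cos θ) ^ s.re * Real.Gamma s.re := by
    rw [← Real.integral_rpow_mul_exp_neg_mul_Ioi hs hcos]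
    refine (norm_integral_le_integral_norm _).trans (le_of_eq ?_)
    refine setIntegral_congr_fun measurableSet_Ioi fun x hx => ?_
    rw [norm_cpow_mul_exp_neg_mul hx, hre]
  rw [key, norm_mul, hnorm] at hle
  calc ‖Gamma s‖ = Real.exp (θ * s.im) * ‖Gamma s‖ * Real.exp (-(θ * s.im)) := by
        rw [mul_right_comm, ← Real.exp_add]; simp
    _ ≤ _ := by gcongr

/-- Each shift by one multiplies by a factor of modulus at least `|Im s| ≥ 1`. -/
lemma norm_Gamma_le_norm_Gamma_add_nat {s : ℂ} (hs : 1 ≤ |s.im|) (K : ℕ) :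
    ‖Gamma s‖ ≤ ‖Gamma (s + K)‖ := by
  induction K with
  | zero => simp
  | succ K ih =>
    have h1 : 1 ≤ ‖s + K‖ := by
      refine hs.trans ?_
      simpa using abs_im_le_norm (s + K)
    have h0 : s + K ≠ 0 := by
      intro h; rw [h, norm_zero] at h1; linarith
    rw [Nat.cast_succ, ← add_assoc, Gamma_add_one _ h0, norm_mul]
    nlinarith [norm_nonneg (Gamma (s + K))]

/-- Exponential decay of the Gamma function in vertical strips. -/
theorem exists_norm_Gamma_le (A B : ℝ) {δ : ℝ} (hδ : 0 < δ) :
    ∃ C : ℝ, 0 < C ∧ ∀ s : ℂ, A ≤ s.re → s.re ≤ B → 1 ≤ |s.im| →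
      ‖Gamma s‖ ≤ C * Real.exp (-((Real.pi / 2 - δ) * |s.im|)) := by
  -- The cap `π/4` keeps the angle `θ = π/2 - η` positive when `δ` is large.
  set η := min δ (Real.pi / 4) with hη
  have hη0 : 0 < η := lt_min hδ (by positivity)
  have hη1 : η ≤ Real.pi / 4 := min_le_right _ _
  set θ := Real.pi / 2 - η
  have hpi := Real.pi_pos
  have hθ0 : 0 < θ := by simp only [θ]; linarith
  have hθ1 : |θ| < Real.pi / 2 := by rw [abs_of_pos hθ0]; simp only [θ]; linarith
  have hcos : 0 < Real.cos θ := Real.cos_pos_of_mem_Ioo (by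
    constructor <;> simp only [θ] <;> linarith)
  -- Shifting by `K` moves the strip into `Re s ≥ 1`, where the bound from Euler's integral applies
  -- and `Γ` is continuous on the compact range of real parts.
  obtain ⟨K, hK⟩ := exists_nat_ge (1 - A)
  obtain ⟨C, hC⟩ := (isCompact_Icc (a := A + K) (b := B + K)).exists_bound_of_continuousOn
    (f := fun σ : ℝ => (1 / Real.cos θ) ^ σ * Real.Gamma σ) (by
      intro σ hσ
      refine ContinuousAt.continuousWithinAt (ContinuousAt.mul ?_ ?_)
      · exact (Real.continuous_const_rpow (by positivity)).continuousAt
      · refine (Real.differentiableAt_Gamma fun m => ?_).continuousAt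
        have : (0 : ℝ) ≤ m := m.cast_nonneg
        have := hσ.1
        intro h
        linarith)
  refine ⟨max C 1, by positivity, fun s hA hB him => ?_⟩
  refine (norm_Gamma_le_norm_Gamma_add_nat him K).trans ?_
  have hre : (s + K).re = s.re + K := by simp
  have him' : (s + K).im = s.im := by simp
  have hpos : 0 < (s + K).re := by rw [hre]; linarith
  have hmem : (s + K).re ∈ Icc (A + K) (B + K) := by rw [hre]; constructor <;> linarith
  have hbd := (le_abs_self _).trans (hC _ hmem)
  have hexp : ‖Gamma (s + K)‖ ≤ (1 / Real.cos θ) ^ (s + K).re * Real.Gamma (s + K).re *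
      Real.exp (-(θ * |s.im|)) := by
    rcases le_total 0 s.im with h | h
    · have := norm_Gamma_le hpos hθ1
      rwa [him', ← abs_of_nonneg h] at this
    · have := norm_Gamma_le hpos (θ := -θ) (by rwa [abs_neg])
      rw [him', Real.cos_neg] at this
      rwa [abs_of_nonpos h, mul_neg, ← neg_mul]
  refine hexp.trans ?_
  have h1 : -(θ * |s.im|) ≤ -((Real.pi / 2 - δ) * |s.im|) := by
    have : η ≤ δ := min_le_left _ _
    have : (Real.pi / 2 - δ) * |s.im| ≤ θ * |s.im| := by
      apply mul_le_mul_of_nonneg_right _ (abs_nonneg _)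
      simp only [θ]; linarith
    linarith
  have h2 : (1 / Real.cos θ) ^ (s + K).re * Real.Gamma (s + K).re ≤ max C 1 :=
    hbd.trans (le_max_left _ _)
  gcongr

/-! ### Tame paths and their index, as a principal value. -/

/-- Continuous paths that are continuously differentiable off a finite set, with bounded
derivative. -/
structure IsTame (γ : ℝ → ℂ) : Prop where
  continuous : Continuous γ
  piecewise : ∃ S : Set ℝ, S.Finite ∧ (∀ t ∉ S, ContDiffAt ℝ 1 γ t) ∧
    ∃ C : ℝ, ∀ t ∉ S, ‖deriv γ t‖ ≤ C

lemma IsContour.isTame {n : ℕ} {α β : Fin n → ℂ} {γ : ℝ → ℂ} (h : IsContour α β γ) : IsTame γ :=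
  ⟨h.continuous, h.piecewise⟩

lemma hasDerivAt_line (c t : ℝ) : HasDerivAt (fun t : ℝ => (c : ℂ) + t * I) I t := by
  simpa using ((hasDerivAt_id t).ofReal_comp.mul_const I).const_add (c : ℂ)

lemma isTame_line (c : ℝ) : IsTame (fun t : ℝ => (c : ℂ) + t * I) := by
  refine ⟨by fun_prop, ∅, finite_empty, fun t _ => ?_, 1, fun t _ => ?_⟩
  · exact (contDiffAt_const.add ((ofRealCLM.contDiff.contDiffAt).mul contDiffAt_const))
  · rw [(hasDerivAt_line c t).deriv]; simp

namespace IsTame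

variable {γ : ℝ → ℂ}

lemma ae_norm_deriv_le (h : IsTame γ) : ∃ C : ℝ, ∀ᵐ t, ‖deriv γ t‖ ≤ C := by
  obtain ⟨S, hS, -, C, hC⟩ := h.piecewise
  refine ⟨C, ?_⟩
  filter_upwards [hS.countable.ae_notMem volume] with t ht using hC t ht

lemma intervalIntegrable_deriv (h : IsTame γ) (a b : ℝ) :
    IntervalIntegrable (deriv γ) volume a b := by
  obtain ⟨C, hC⟩ := h.ae_norm_deriv_le
  refine (intervalIntegrable_const (c := C)).mono_fun
    (measurable_deriv γ).aestronglyMeasurable ?_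
  filter_upwards [ae_restrict_of_ae hC] with t ht
  exact ht.trans (le_abs_self C)

lemma intervalIntegrable_mul_deriv (h : IsTame γ) {g : ℝ → ℂ} (hg : Continuous g) (a b : ℝ) :
    IntervalIntegrable (fun t => g t * deriv γ t) volume a b :=
  (h.intervalIntegrable_deriv a b).continuousOn_mul hg.continuousOn

lemma integral_eq_sub (h : IsTame γ) {f F : ℂ → ℂ} (hF : ∀ t, HasDerivAt F (f (γ t)) (γ t))
    (hf : Continuous fun t => f (γ t)) (a b : ℝ) :
    ∫ t in a..b, f (γ t) * deriv γ t = F (γ b) - F (γ a) := by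
  obtain ⟨S, hS, hd, -⟩ := h.piecewise
  refine integral_eq_of_hasDerivAt_off_countable (fun t => F (γ t)) _ hS.countable
    (fun t _ => ?_) (fun t ht => ?_) (h.intervalIntegrable_mul_deriv hf a b)
  · exact ((hF t).continuousAt.comp h.continuous.continuousAt).continuousWithinAt
  · have h1 : HasDerivAt γ (deriv γ t) t :=
      ((hd t ht.2).differentiableAt one_ne_zero).hasDerivAt
    have := (hF t).scomp t h1
    rwa [smul_eq_mul, mul_comm] at this

end IsTame

/-- The symmetric integrals of `f` along `γ` converge to `w`. -/
def HasPV (γ : ℝ → ℂ) (f : ℂ → ℂ) (w : ℂ) : Prop :=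
  Tendsto (fun R : ℝ => ∫ t in (-R)..R, f (γ t) * deriv γ t) atTop (𝓝 w)

/-- Dividing both arguments by `R > 0` leaves `log I - log (-I)` in the limit. This is the half turn
behind every index computed below. -/
lemma tendsto_log_sub_log (w : ℂ) :
    Tendsto (fun R : ℝ => log (w + R * I) - log (w - R * I)) atTop (𝓝 (Real.pi * I)) := by
  have hinv : Tendsto (fun R : ℝ => w * ((R⁻¹ : ℝ) : ℂ)) atTop (𝓝 0) := by
    have : Tendsto (fun R : ℝ => ((R⁻¹ : ℝ) : ℂ)) atTop (𝓝 0) := by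
      simpa [Function.comp_def] using (continuous_ofReal.tendsto 0).comp tendsto_inv_atTop_zero
    simpa using this.const_mul w
  have h1 : Tendsto (fun R : ℝ => log (I + w * ((R⁻¹ : ℝ) : ℂ))) atTop (𝓝 (log I)) := by
    have h : ContinuousAt log I := continuousAt_clog (by simp [mem_slitPlane_iff])
    exact h.tendsto.comp (by simpa using hinv.const_add I)
  have h2 : Tendsto (fun R : ℝ => log (-I + w * ((R⁻¹ : ℝ) : ℂ))) atTop (𝓝 (log (-I))) := by
    have h : ContinuousAt log (-I) := continuousAt_clog (by simp [mem_slitPlane_iff])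
    exact h.tendsto.comp (by simpa using hinv.const_add (-I))
  have h3 := h1.sub h2
  rw [log_I, log_neg_I] at h3
  have he : (Real.pi / 2 * I - -(Real.pi / 2) * I : ℂ) = Real.pi * I := by ring
  rw [he] at h3
  refine h3.congr' ?_
  have hne : ∀ᶠ x : ℂ in 𝓝 (0 : ℂ), I + x ≠ 0 ∧ -I + x ≠ 0 := by
    refine ContinuousAt.eventually_ne (by fun_prop) (by simp) |>.and
      (ContinuousAt.eventually_ne (by fun_prop) (by simp))
  filter_upwards [eventually_gt_atTop 0, hinv.eventually hne] with R hR hx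
  have hR' : (R : ℂ) ≠ 0 := by exact_mod_cast hR.ne'
  have e1 : w + R * I = R * (I + w * ((R⁻¹ : ℝ) : ℂ)) := by
    push_cast; field_simp; ring
  have e2 : w - R * I = R * (-I + w * ((R⁻¹ : ℝ) : ℂ)) := by
    push_cast; field_simp; ring
  rw [e1, e2, log_ofReal_mul hR hx.1, log_ofReal_mul hR hx.2]
  ring

lemma tendsto_norm_add_mul_I (w : ℂ) :
    Tendsto (fun R : ℝ => ‖w + R * I‖) atTop atTop := by
  refine tendsto_atTop_mono (fun R => ?_) (tendsto_atTop_add_const_left atTop w.im tendsto_id)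
  have := (le_abs_self _).trans (abs_im_le_norm (w + R * I))
  simpa using this

lemma tendsto_norm_sub_mul_I (w : ℂ) :
    Tendsto (fun R : ℝ => ‖w - R * I‖) atTop atTop := by
  refine (tendsto_norm_add_mul_I (-w)).congr fun R => ?_
  rw [← norm_neg]; congr 1; ring

section Index

variable {γ : ℝ → ℂ}

/-- A path that runs down the imaginary axis outside a bounded parameter interval. -/
def IsAxial (γ : ℝ → ℂ) : Prop := ∃ R : ℝ, ∀ t : ℝ, R ≤ |t| → γ t = -(t * I)

lemma IsAxial.eventually (h : IsAxial γ) :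
    ∀ᶠ R : ℝ in atTop, γ R = -(R * I) ∧ γ (-R) = R * I := by
  obtain ⟨R₀, hR⟩ := h
  filter_upwards [eventually_ge_atTop R₀, eventually_ge_atTop 0] with R h1 h2
  refine ⟨hR R (by rwa [abs_of_nonneg h2]), ?_⟩
  rw [hR (-R) (by rwa [abs_neg, abs_of_nonneg h2])]
  push_cast; ring

lemma IsAxial.isClosed_range (h : IsAxial γ) (hc : Continuous γ) : IsClosed (range γ) := by
  obtain ⟨R₀, hR⟩ := h
  -- Far out `‖γ t‖ = |t|`, so the path is proper and its range closed. Components of the complement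
  -- are then open.
  have hp : IsProperMap γ := by
    refine isProperMap_iff_tendsto_cocompact.2 ⟨hc, ?_⟩
    rw [← Metric.cobounded_eq_cocompact (α := ℂ), ← Metric.cobounded_eq_cocompact (α := ℝ),
      ← tendsto_norm_atTop_iff_cobounded]
    refine tendsto_norm_cobounded_atTop.congr' ?_
    filter_upwards [tendsto_norm_cobounded_atTop.eventually (eventually_ge_atTop R₀)] with t ht
    rw [hR t ht]; simp
  exact hp.isClosed_range

lemma IsAxial.exists_abs_re_le (h : IsAxial γ) (hc : Continuous γ) :
    ∃ M : ℝ, 0 < M ∧ ∀ t, |(γ t).re| ≤ M := by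
  obtain ⟨R₀, hR⟩ := h
  obtain ⟨C, hC⟩ := (isCompact_Icc (a := -R₀) (b := R₀)).exists_bound_of_continuousOn hc.continuousOn
  refine ⟨max C 1, by positivity, fun t => ?_⟩
  rcases le_total R₀ |t| with ht | ht
  · rw [hR t ht]; simp
  · exact (abs_re_le_norm _).trans ((hC t (abs_le.1 ht)).trans (le_max_left _ _))

/-- The quotient `(s - p)/(s - q) = 1 + (q - p)/(s - q)` stays in the disc of radius `1` about `1`
along the path, so its principal logarithm is a primitive. It tends to `log 1 = 0` at both ends. -/
lemma hasPV_sub_of_near (ht : IsTame γ) (ha : IsAxial γ) {p q : ℂ}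
    (hpq : ∀ t, ‖p - q‖ < ‖γ t - q‖) :
    HasPV γ (fun s => (s - p)⁻¹ - (s - q)⁻¹) 0 := by
  have hq : ∀ t, γ t - q ≠ 0 := fun t h => by
    have := hpq t; rw [h, norm_zero] at this; linarith [norm_nonneg (p - q)]
  have hp : ∀ t, γ t - p ≠ 0 := fun t h => by
    have := hpq t
    rw [← sub_eq_zero.1 h] at this
    exact lt_irrefl _ this
  have hslit : ∀ t, (γ t - p) / (γ t - q) ∈ slitPlane := fun t => by
    have h := mem_slitPlane_of_norm_lt_one (z := (q - p) / (γ t - q))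
      (by rw [norm_div, div_lt_one (norm_pos_iff.2 (hq t)), norm_sub_rev]; exact hpq t)
    convert h using 1
    have := hq t
    field_simp
    ring
  have hF : ∀ t, HasDerivAt (fun s => log ((s - p) / (s - q)))
      ((γ t - p)⁻¹ - (γ t - q)⁻¹) (γ t) := fun t => by
    have h1 : HasDerivAt (fun s => (s - p) / (s - q)) _ (γ t) :=
      ((hasDerivAt_id (γ t)).sub_const p).fun_div ((hasDerivAt_id (γ t)).sub_const q) (hq t)
    convert h1.clog (hslit t) using 1
    have := hp t
    have := hq t
    simp only [id]
    field_simp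
  have hcont : Continuous fun t => (γ t - p)⁻¹ - (γ t - q)⁻¹ :=
    ((ht.continuous.sub continuous_const).inv₀ hp).sub
      ((ht.continuous.sub continuous_const).inv₀ hq)
  have hlim : ∀ {u : ℝ → ℂ}, Tendsto (fun R => ‖u R - q‖) atTop atTop →
      Tendsto (fun R => log ((u R - p) / (u R - q))) atTop (𝓝 0) := fun {u} hu => by
    have h1 : Tendsto (fun R => 1 + (q - p) * (u R - q)⁻¹) atTop (𝓝 1) := by
      have : Tendsto (fun R => (u R - q)⁻¹) atTop (𝓝 0) :=
        tendsto_inv₀_cobounded.comp (tendsto_norm_atTop_iff_cobounded.1 hu)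
      simpa using (this.const_mul (q - p)).const_add 1
    have h2 : Tendsto (fun R => (u R - p) / (u R - q)) atTop (𝓝 1) := by
      refine h1.congr' ?_
      filter_upwards [hu.eventually (eventually_gt_atTop 0)] with R hR
      have : u R - q ≠ 0 := norm_pos_iff.1 hR
      field_simp; ring
    simpa [Function.comp_def] using ((continuousAt_clog one_mem_slitPlane).tendsto.comp h2)
  have e1 := hlim (u := fun R => -(R * I)) (by
    refine (tendsto_norm_sub_mul_I (-q)).congr fun R => ?_
    congr 1; ring)
  have e2 := hlim (u := fun R => R * I) (by
    refine (tendsto_norm_add_mul_I (-q)).congr fun R => ?_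
    congr 1; ring)
  have e3 := e1.sub e2
  rw [sub_zero] at e3
  refine e3.congr' ?_
  filter_upwards [ha.eventually] with R hR
  rw [ht.integral_eq_sub (f := fun s => (s - p)⁻¹ - (s - q)⁻¹) hF hcont, hR.1, hR.2]

lemma continuous_inv_sub (ht : IsTame γ) {p : ℂ} (hp : p ∉ range γ) :
    Continuous fun t => (γ t - p)⁻¹ :=
  (ht.continuous.sub continuous_const).inv₀ fun t h => hp ⟨t, sub_eq_zero.1 h⟩

lemma hasPV_inv_iff (ht : IsTame γ) {p q : ℂ} (hp : p ∉ range γ) (hq : q ∉ range γ)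
    (h : HasPV γ (fun s => (s - p)⁻¹ - (s - q)⁻¹) 0) {w : ℂ}
    (hw : HasPV γ (fun s => (s - q)⁻¹) w) : HasPV γ (fun s => (s - p)⁻¹) w := by
  have := h.add hw
  rw [zero_add] at this
  refine this.congr fun R => ?_
  rw [← intervalIntegral.integral_add]
  · congr 1; ext t; ring
  · exact ht.intervalIntegrable_mul_deriv
      ((continuous_inv_sub ht hp).sub (continuous_inv_sub ht hq)) _ _
  · exact ht.intervalIntegrable_mul_deriv (continuous_inv_sub ht hq) _ _

/-- The index is constant on connected components of the complement of the path. -/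
lemma hasPV_inv_of_mem_component (ht : IsTame γ) (ha : IsAxial γ) {p q w : ℂ}
    (hq : q ∈ connectedComponentIn (range γ)ᶜ p) (hw : HasPV γ (fun s => (s - q)⁻¹) w) :
    HasPV γ (fun s => (s - p)⁻¹) w := by
  have hsub := connectedComponentIn_subset (range γ)ᶜ p
  have hp : p ∈ (range γ)ᶜ := by
    by_contra hp
    rw [connectedComponentIn_eq_empty hp] at hq
    exact hq
  have hpm : p ∈ connectedComponentIn (range γ)ᶜ p := mem_connectedComponentIn hp
  have hopen : IsOpen (range γ)ᶜ := (ha.isClosed_range ht.continuous).isOpen_compl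
  -- Having index `w` passes both ways between nearby points, hence throughout a connected
  -- component.
  have key := isPreconnected_connectedComponentIn.induction₂' (s := connectedComponentIn (range γ)ᶜ p)
    (P := fun x y => HasPV γ (fun s => (s - y)⁻¹) w → HasPV γ (fun s => (s - x)⁻¹) w)
    ?_ (fun x y z _ _ _ h1 h2 h3 => h1 (h2 h3)) hpm hq
  · exact key hw
  · intro x hx
    obtain ⟨ε, hε, hball⟩ := Metric.isOpen_iff.1 hopen x (hsub hx)
    have hd : ∀ t, ε ≤ ‖γ t - x‖ := fun t => by
      by_contra hlt
      exact hball (mem_ball_iff_norm.2 (not_le.1 hlt)) (mem_range_self t)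
    filter_upwards [self_mem_nhdsWithin,
      mem_nhdsWithin_of_mem_nhds (Metric.ball_mem_nhds x (half_pos hε))] with y hy hyb
    have hyb' : ‖y - x‖ < ε / 2 := mem_ball_iff_norm.1 hyb
    have h1 : ∀ t, ‖y - x‖ < ‖γ t - x‖ := fun t => by linarith [hd t]
    have h2 : ∀ t, ‖x - y‖ < ‖γ t - y‖ := fun t => by
      have := norm_sub_norm_le (γ t - x) (y - x)
      rw [sub_sub_sub_cancel_right] at this
      rw [norm_sub_rev]
      linarith [hd t]
    exact ⟨hasPV_inv_iff ht (hsub hx) (hsub hy) (hasPV_sub_of_near ht ha h2),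
      hasPV_inv_iff ht (hsub hy) (hsub hx) (hasPV_sub_of_near ht ha h1)⟩

/-- The index is constant on the component of `p`, so `p` may be replaced by a point `-x` to the
left of the whole path. There `log (s + x)` is a primitive along the path, and the downward
direction gives the minus sign. -/
lemma hasPV_inv_of_isLeftOf (ht : IsTame γ) (ha : IsAxial γ) {p : ℂ} (hp : IsLeftOf γ p) :
    HasPV γ (fun s => (s - p)⁻¹) (-(Real.pi * I)) := by
  obtain ⟨M, hM⟩ := hp
  obtain ⟨M', hM', hre⟩ := ha.exists_abs_re_le ht.continuous
  -- `|M|` puts `-x` in the component of `p`, and `M'` puts it to the left of the path.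
  set x : ℝ := |M| + M' + 1
  have hx0 : 0 < x := by positivity
  have hq := hM (-(x : ℂ)) (by
    rw [norm_neg, norm_real, Real.norm_of_nonneg hx0.le]
    have := le_abs_self M
    simp only [x]; linarith) (by simpa using hx0)
  refine hasPV_inv_of_mem_component ht ha hq ?_
  have hslit : ∀ t, γ t - -(x : ℂ) ∈ slitPlane := fun t => by
    refine Or.inl ?_
    have := (abs_le.1 (hre t)).1
    have := abs_nonneg M
    simp only [sub_neg_eq_add, add_re, ofReal_re, x]; linarith
  refine (tendsto_log_sub_log (x : ℂ)).neg.congr' ?_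
  filter_upwards [ha.eventually] with R hR
  rw [ht.integral_eq_sub (f := fun s => (s - -(x : ℂ))⁻¹) (F := fun s => log (s - -(x : ℂ)))
    (fun t => by
      simpa using ((hasDerivAt_id (γ t)).sub_const (-(x : ℂ))).clog (hslit t))
    (continuous_inv_sub ht (by rintro ⟨t, h⟩; exact slitPlane_ne_zero (hslit t) (by simp [h]))),
    hR.1, hR.2]
  ring_nf

lemma hasPV_inv_of_isRightOf (ht : IsTame γ) (ha : IsAxial γ) {p : ℂ} (hp : IsRightOf γ p) :
    HasPV γ (fun s => (s - p)⁻¹) (Real.pi * I) := by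
  obtain ⟨M, hM⟩ := hp
  obtain ⟨M', hM', hre⟩ := ha.exists_abs_re_le ht.continuous
  set x : ℝ := |M| + M' + 1
  have hx0 : 0 < x := by positivity
  have hq := hM (x : ℂ) (by
    rw [norm_real, Real.norm_of_nonneg hx0.le]
    have := le_abs_self M
    simp only [x]; linarith) (by simpa using hx0)
  refine hasPV_inv_of_mem_component ht ha hq ?_
  have hslit : ∀ t, (x : ℂ) - γ t ∈ slitPlane := fun t => by
    refine Or.inl ?_
    have := (abs_le.1 (hre t)).2
    have := abs_nonneg M
    simp only [sub_re, ofReal_re, x]; linarith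
  refine (tendsto_log_sub_log (x : ℂ)).congr' ?_
  filter_upwards [ha.eventually] with R hR
  -- To the left of `x` the logarithm of `x - s`, not of `s - x`, avoids the cut.
  rw [ht.integral_eq_sub (f := fun s => (s - (x : ℂ))⁻¹) (F := fun s => log ((x : ℂ) - s))
    (fun t => by
      have := ((hasDerivAt_id (γ t)).const_sub (x : ℂ)).clog (hslit t)
      refine this.congr_deriv ?_
      rw [neg_div, one_div, ← inv_neg, neg_sub, id])
    (continuous_inv_sub ht (by rintro ⟨t, h⟩; exact slitPlane_ne_zero (hslit t) (by simp [h]))),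
    hR.1, hR.2]
  ring_nf

lemma IsLeftOf.notMem_range {p : ℂ} (hp : IsLeftOf γ p) : p ∉ range γ := by
  intro h
  obtain ⟨M, hM⟩ := hp
  have := hM (-((|M| + 1 : ℝ) : ℂ)) (by
    rw [norm_neg, norm_real, Real.norm_of_nonneg (by positivity)]
    linarith [le_abs_self M]) (by
      rw [neg_re, ofReal_re]; linarith [abs_nonneg M])
  rw [connectedComponentIn_eq_empty (by simpa using h)] at this
  exact this

lemma IsRightOf.notMem_range {p : ℂ} (hp : IsRightOf γ p) : p ∉ range γ := by
  intro h
  obtain ⟨M, hM⟩ := hp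
  have := hM (((|M| + 1 : ℝ) : ℂ)) (by
    rw [norm_real, Real.norm_of_nonneg (by positivity)]
    linarith [le_abs_self M]) (by
      rw [ofReal_re]; linarith [abs_nonneg M])
  rw [connectedComponentIn_eq_empty (by simpa using h)] at this
  exact this

lemma hasPV_inv_line {c : ℝ} {p : ℂ} (hp : p.re < c) :
    HasPV (fun t : ℝ => (c : ℂ) + t * I) (fun s => (s - p)⁻¹) (Real.pi * I) := by
  have hslit : ∀ t : ℝ, (c : ℂ) + t * I - p ∈ slitPlane := fun t => by
    refine Or.inl ?_
    simpa using hp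
  refine (tendsto_log_sub_log (c - p : ℂ)).congr fun R => ?_
  rw [(isTame_line c).integral_eq_sub (f := fun s => (s - p)⁻¹) (F := fun s => log (s - p))
    (fun t => by
      simpa using ((hasDerivAt_id ((c : ℂ) + t * I)).sub_const p).clog (hslit t))
    (continuous_inv_sub (isTame_line c)
      (by rintro ⟨t, h⟩; exact slitPlane_ne_zero (hslit t) (by rw [← h]; simp)))]
  push_cast
  ring_nf

/-- Higher negative powers have vanishing integral along paths both of whose ends go to
infinity. -/
lemma hasPV_inv_pow (ht : IsTame γ) {p : ℂ} (hp : p ∉ range γ)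
    (h1 : Tendsto (fun R => ‖γ R - p‖) atTop atTop)
    (h2 : Tendsto (fun R => ‖γ (-R) - p‖) atTop atTop) (j : ℕ) :
    HasPV γ (fun s => ((s - p) ^ (j + 2))⁻¹) 0 := by
  have hne : ∀ t, γ t - p ≠ 0 := fun t h => hp ⟨t, sub_eq_zero.1 h⟩
  have hlim : ∀ {u : ℝ → ℂ}, Tendsto (fun R => ‖u R‖) atTop atTop →
      Tendsto (fun R => -((j : ℂ) + 1)⁻¹ * ((u R)⁻¹) ^ (j + 1)) atTop (𝓝 0) := fun {u} hu => by
    have : Tendsto (fun R => (u R)⁻¹) atTop (𝓝 0) :=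
      tendsto_inv₀_cobounded.comp (tendsto_norm_atTop_iff_cobounded.1 hu)
    simpa using (this.pow (j + 1)).const_mul (-((j : ℂ) + 1)⁻¹)
  have := (hlim h1).sub (hlim h2)
  rw [sub_zero] at this
  refine this.congr fun R => ?_
  have hj : (j : ℂ) + 1 ≠ 0 := by exact_mod_cast j.succ_ne_zero
  refine (ht.integral_eq_sub (f := fun s => ((s - p) ^ (j + 2))⁻¹)
    (F := fun s => -((j : ℂ) + 1)⁻¹ * ((s - p)⁻¹) ^ (j + 1)) (fun t => ?_) ?_ _ _).symm
  · have h3 := ((((hasDerivAt_id (γ t)).sub_const p).fun_inv (hne t)).fun_pow (j + 1)).const_mul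
      (-((j : ℂ) + 1)⁻¹)
    refine h3.congr_deriv ?_
    have := hne t
    simp only [id, Nat.add_sub_cancel, inv_pow]
    push_cast
    field_simp
    ring
  · exact ((ht.continuous.sub continuous_const).pow (j + 2)).inv₀ fun t => pow_ne_zero _ (hne t)

end Index

/-! ### Taylor coefficients, principal parts and their integrals. -/

/-- The `i`-th Taylor coefficient of `g` at `p`. -/
noncomputable def taylorCoeff (g : ℂ → ℂ) (p : ℂ) (i : ℕ) : ℂ :=
  iteratedDeriv i g p / i.factorial

/-- Taylor's formula with an analytic remainder. -/
lemma exists_taylor_remainder {g : ℂ → ℂ} {p : ℂ} (hg : AnalyticAt ℂ g p) (n : ℕ) :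
    ∃ u : ℂ → ℂ, AnalyticAt ℂ u p ∧
      ∀ s, g s = ∑ i ∈ Finset.range n, taylorCoeff g p i * (s - p) ^ i + (s - p) ^ n * u s := by
  have hP := hg.hasFPowerSeriesAt
  refine ⟨(Function.swap dslope p)^[n] g,
    (hP.has_fpower_series_iterate_dslope_fslope n).analyticAt, fun s => ?_⟩
  induction n with
  | zero => simp
  | succ n ih =>
    have hval : (Function.swap dslope p)^[n] g p = taylorCoeff g p n := by
      have h := (hP.has_fpower_series_iterate_dslope_fslope n).coeff_zero 1
      rw [← h]
      change FormalMultilinearSeries.coeff _ 0 = _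
      rw [FormalMultilinearSeries.coeff_iterate_fslope, zero_add,
        FormalMultilinearSeries.coeff_ofScalars]
      rfl
    rw [ih, Finset.sum_range_succ, Function.iterate_succ_apply', pow_succ, mul_assoc (_ ^ n)]
    have h2 := sub_smul_dslope ((Function.swap dslope p)^[n] g) p s
    rw [smul_eq_mul, hval] at h2
    change _ = _ + (s - p) ^ n * ((s - p) * dslope ((Function.swap dslope p)^[n] g) p s)
    rw [h2]
    ring

/-- The principal part at `p` of `g s / (s - p) ^ n`. -/
noncomputable def principalPart (g : ℂ → ℂ) (n : ℕ) (p s : ℂ) : ℂ :=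
  ∑ i ∈ Finset.range n, taylorCoeff g p i * ((s - p) ^ (n - i))⁻¹

lemma differentiableAt_principalPart (g : ℂ → ℂ) (n : ℕ) {p s : ℂ} (h : s ≠ p) :
    DifferentiableAt ℂ (principalPart g n p) s := by
  unfold principalPart
  refine DifferentiableAt.fun_sum fun i _ => DifferentiableAt.const_mul ?_ _
  exact DifferentiableAt.fun_inv (by fun_prop) (pow_ne_zero _ (sub_ne_zero.2 h))

/-- A function with finitely many poles in an open set differs from the sum of its principal
parts by a holomorphic function. -/
lemma exists_differentiable_sub_principalPart {V : Set ℂ} {f : ℂ → ℂ}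
    {S : Finset ℂ} {n : ℕ} {g : ℂ → ℂ → ℂ} (hf : ∀ s ∈ V, s ∉ S → DifferentiableAt ℂ f s)
    (hg : ∀ p ∈ S, AnalyticAt ℂ (g p) p ∧ ∀ᶠ s in 𝓝[≠] p, f s = g p s / (s - p) ^ n) :
    ∃ F : ℂ → ℂ, DifferentiableOn ℂ F V ∧
      ∀ s ∉ S, F s = f s - ∑ p ∈ S, principalPart (g p) n p s := by
  classical
  -- At `p` the principal part cancels the Taylor polynomial of `g p`, leaving its analytic
  -- remainder. The principal parts at the other poles are analytic there.
  have hloc : ∀ p ∈ S, ∃ v : ℂ → ℂ, AnalyticAt ℂ v p ∧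
      ∀ᶠ s in 𝓝[≠] p, f s - ∑ q ∈ S, principalPart (g q) n q s = v s := fun p hp => by
    obtain ⟨ha, he⟩ := hg p hp
    obtain ⟨u, hu, hgu⟩ := exists_taylor_remainder ha n
    refine ⟨fun s => u s - ∑ q ∈ S.erase p, principalPart (g q) n q s, hu.fun_sub ?_, ?_⟩
    · refine Finset.analyticAt_fun_sum _ fun q hq => ?_
      refine analyticAt_iff_eventually_differentiableAt.2 ?_
      filter_upwards [isOpen_ne.mem_nhds (Finset.ne_of_mem_erase hq).symm] with s hs
      exact differentiableAt_principalPart _ _ hs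
    · filter_upwards [he, self_mem_nhdsWithin] with s hs hne
      have hne' : s - p ≠ 0 := sub_ne_zero.2 hne
      rw [← Finset.add_sum_erase S _ hp, hs, hgu s, add_div,
        mul_div_cancel_left₀ _ (pow_ne_zero n hne'), Finset.sum_div]
      have : ∑ i ∈ Finset.range n, taylorCoeff (g p) p i * (s - p) ^ i / (s - p) ^ n =
          principalPart (g p) n p s := by
        refine Finset.sum_congr rfl fun i hi => ?_
        have hi' : i ≤ n := (Finset.mem_range.1 hi).le
        rw [mul_div_assoc]
        congr 1
        rw [div_eq_iff (pow_ne_zero _ hne'), inv_mul_eq_div, eq_div_iff (pow_ne_zero _ hne'),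
          ← pow_add, Nat.add_sub_cancel' hi']
      rw [this]
      ring
  choose! v hv hvs using hloc
  refine ⟨fun s => if s ∈ S then v s s else f s - ∑ p ∈ S, principalPart (g p) n p s,
    fun s hs => DifferentiableAt.differentiableWithinAt ?_, fun s hs => if_neg hs⟩
  by_cases hS : s ∈ S
  · refine (hv s hS).differentiableAt.congr_of_eventuallyEq ?_
    have h1 : ∀ᶠ w in 𝓝 s, w ∉ S.erase s :=
      (Finset.isClosed _).isOpen_compl.mem_nhds (by simp)
    have h2 := eventually_nhdsWithin_iff.1 (hvs s hS)
    filter_upwards [h1, h2] with w hw1 hw2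
    by_cases hws : w = s
    · subst hws; rw [if_pos hS]
    · rw [if_neg fun h => hw1 (Finset.mem_erase.2 ⟨hws, h⟩), hw2 hws]
  · have h1 : ∀ᶠ w in 𝓝 s, w ∉ S := (Finset.isClosed S).isOpen_compl.mem_nhds hS
    refine DifferentiableAt.congr_of_eventuallyEq
      (f := fun s => f s - ∑ p ∈ S, principalPart (g p) n p s) ?_ ?_
    · refine (hf s hs hS).fun_sub (DifferentiableAt.fun_sum fun p hp => ?_)
      exact differentiableAt_principalPart _ _ fun h => hS (h ▸ hp)
    · filter_upwards [h1] with w hw using if_neg hw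

/-- Only the simple pole, from `i = n - 1`, contributes: higher negative powers have primitives that
vanish at infinity. -/
lemma hasPV_principalPart {γ : ℝ → ℂ} (ht : IsTame γ) {p w : ℂ} (hp : p ∉ range γ)
    (h1 : Tendsto (fun R => ‖γ R - p‖) atTop atTop)
    (h2 : Tendsto (fun R => ‖γ (-R) - p‖) atTop atTop)
    (hw : HasPV γ (fun s => (s - p)⁻¹) w) (g : ℂ → ℂ) {n : ℕ} (hn : 0 < n) :
    HasPV γ (principalPart g n p) (taylorCoeff g p (n - 1) * w) := by
  have hne : ∀ t, γ t - p ≠ 0 := fun t h => hp ⟨t, sub_eq_zero.1 h⟩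
  have hterm : ∀ i ∈ Finset.range n,
      Tendsto (fun R : ℝ => ∫ t in (-R)..R,
        taylorCoeff g p i * ((γ t - p) ^ (n - i))⁻¹ * deriv γ t) atTop
        (𝓝 (if i = n - 1 then taylorCoeff g p i * w else 0)) := fun i hi => by
    have hi' := Finset.mem_range.1 hi
    simp only [mul_assoc, intervalIntegral.integral_const_mul]
    split_ifs with h
    · have : n - i = 1 := by omega
      simp only [this, pow_one]
      exact hw.const_mul _
    · obtain ⟨j, hj⟩ : ∃ j, n - i = j + 2 := ⟨n - i - 2, by omega⟩
      rw [hj]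
      simpa using (hasPV_inv_pow ht hp h1 h2 j).const_mul (taylorCoeff g p i)
  have hsum := tendsto_finsetSum (Finset.range n) hterm
  rw [Finset.sum_ite_eq' (Finset.range n) (n - 1),
    if_pos (Finset.mem_range.2 (by omega))] at hsum
  refine hsum.congr fun R => ?_
  rw [← intervalIntegral.integral_finsetSum]
  · congr 1; ext t
    simp only [principalPart, Finset.sum_mul]
  · intro i _
    exact ht.intervalIntegrable_mul_deriv (continuous_const.mul
      (((ht.continuous.sub continuous_const).pow (n - i)).inv₀ fun t => pow_ne_zero _ (hne t))) _ _

lemma continuous_principalPart_comp {γ : ℝ → ℂ} (hc : Continuous γ) {p : ℂ} (hp : p ∉ range γ)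
    (g : ℂ → ℂ) (n : ℕ) : Continuous fun t => principalPart g n p (γ t) :=
  continuous_iff_continuousAt.2 fun t =>
    ContinuousAt.comp (g := principalPart g n p) (f := γ)
      (differentiableAt_principalPart g n (p := p) (s := γ t)
        fun h => hp ⟨t, h⟩).continuousAt hc.continuousAt

/-! ### Shifting a contour to a vertical line. -/

/-- Points of the strip `0 ≤ re s ≤ c` going to infinity. -/
noncomputable def stripEnds (c : ℝ) : Filter ℂ :=
  comap (fun s : ℂ => |s.im|) atTop ⊓ 𝓟 {s : ℂ | 0 ≤ s.re ∧ s.re ≤ c}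

lemma tendsto_principalPart_stripEnds (c : ℝ) (g : ℂ → ℂ) (n : ℕ) (p : ℂ) :
    Tendsto (principalPart g n p) (stripEnds c) (𝓝 0) := by
  have h0 : Tendsto (fun s : ℂ => (s - p)⁻¹) (stripEnds c) (𝓝 0) := by
    refine tendsto_inv₀_cobounded.comp (tendsto_norm_atTop_iff_cobounded.1 ?_)
    refine tendsto_atTop_mono' _ (f₁ := fun s : ℂ => |s.im| - |p.im|) (Eventually.of_forall fun s => ?_) ?_
    · have h1 := abs_im_le_norm (s - p)
      have h2 := abs_sub_abs_le_abs_sub s.im p.im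
      rw [sub_im] at h1
      linarith
    · exact tendsto_atTop_add_const_right _ _ (tendsto_comap.mono_left inf_le_left)
  have : Tendsto (fun s => ∑ i ∈ Finset.range n, taylorCoeff g p i * ((s - p)⁻¹) ^ (n - i))
      (stripEnds c) (𝓝 (∑ i ∈ Finset.range n, taylorCoeff g p i * 0 ^ (n - i))) :=
    tendsto_finsetSum _ fun i _ => (h0.pow (n - i)).const_mul _
  rw [Finset.sum_eq_zero fun i hi => by
    rw [zero_pow (by have := Finset.mem_range.1 hi; omega), mul_zero]] at this
  refine this.congr fun s => ?_
  simp only [principalPart, inv_pow]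

/-- Shifting a contour to a vertical line across finitely many poles. -/
theorem tendsto_integral_add_integral_line {γ : ℝ → ℂ} (ht : IsTame γ) (ha : IsAxial γ)
    {A B c : ℝ} (hγ : ∀ t, A < (γ t).re ∧ (γ t).re < B) (hc0 : 0 < c) (hcB : c < B)
    {f : ℂ → ℂ} {S : Finset ℂ} {n : ℕ} (hn : 0 < n) {g : ℂ → ℂ → ℂ} {w : ℂ → ℂ}
    (hf : ∀ s, A < s.re → s.re < B → s ∉ S → DifferentiableAt ℂ f s)
    (hg : ∀ p ∈ S, AnalyticAt ℂ (g p) p ∧ ∀ᶠ s in 𝓝[≠] p, f s = g p s / (s - p) ^ n)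
    (hS : ∀ p ∈ S, p ∉ range γ ∧ p.re < c ∧ HasPV γ (fun s => (s - p)⁻¹) (w p))
    (hdecay : Tendsto f (stripEnds c) (𝓝 0)) :
    Tendsto (fun R : ℝ => (∫ t in (-R)..R, f (γ t) * deriv γ t) +
      ∫ t in (-R)..R, f (c + t * I) * I) atTop
      (𝓝 (∑ p ∈ S, taylorCoeff (g p) p (n - 1) * (w p + Real.pi * I))) := by
  set V : Set ℂ := {s | A < s.re ∧ s.re < B} with hVdef
  have hVo : IsOpen V :=
    (isOpen_lt continuous_const continuous_re).inter (isOpen_lt continuous_re continuous_const)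
  have hVc : Convex ℝ V := (convex_halfSpace_re_gt A).inter (convex_halfSpace_re_lt B)
  -- `F` is the integrand without its principal parts. Being holomorphic on the convex strip it has
  -- a primitive `G`, so only the ends of the two paths and the principal parts matter.
  obtain ⟨F, hF, hFs⟩ := exists_differentiable_sub_principalPart (V := V) (S := S) (n := n) (g := g)
    (fun s hs => hf s hs.1 hs.2) hg
  obtain ⟨G, hG⟩ := hVc.exists_forall_hasDerivWithinAt hF
  have hG' : ∀ s ∈ V, HasDerivAt G (F s) s := fun s hs => (hG s hs).hasDerivAt (hVo.mem_nhds hs)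
  have hA0 : A < 0 := by
    obtain ⟨R, hR⟩ := ha.eventually.exists
    simpa [hR.1] using (hγ R).1
  have hline : ∀ t : ℝ, (c : ℂ) + t * I ∈ V := fun t => by
    simpa [hVdef] using ⟨hA0.trans hc0, hcB⟩
  have hFc : ContinuousOn F V := hF.continuousOn
  have piece : ∀ {η : ℝ → ℂ} (_ : IsTame η) (_ : ∀ t, η t ∈ V) (_ : ∀ p ∈ S, p ∉ range η) (R : ℝ),
      ∫ t in (-R)..R, f (η t) * deriv η t = (G (η R) - G (η (-R))) +
        ∑ p ∈ S, ∫ t in (-R)..R, principalPart (g p) n p (η t) * deriv η t := by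
    intro η hη hηV hηS R
    have hc1 : Continuous fun t => F (η t) := hFc.comp_continuous hη.continuous hηV
    rw [← hη.integral_eq_sub (f := F) (fun t => hG' _ (hηV t)) hc1,
      ← intervalIntegral.integral_finsetSum, ← intervalIntegral.integral_add]
    · congr 1; ext t
      rw [hFs (η t) fun h => hηS _ h (mem_range_self t), ← Finset.sum_mul]
      ring
    · exact hη.intervalIntegrable_mul_deriv hc1 _ _
    · rw [show (fun t => ∑ p ∈ S, principalPart (g p) n p (η t) * deriv η t) =
        fun t => (∑ p ∈ S, principalPart (g p) n p (η t)) * deriv η t from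
          funext fun t => (Finset.sum_mul _ _ _).symm]
      exact hη.intervalIntegrable_mul_deriv (continuous_finsetSum _ fun p hp =>
        continuous_principalPart_comp hη.continuous (hηS p hp) _ _) _ _
    · intro p hp
      exact hη.intervalIntegrable_mul_deriv
        (continuous_principalPart_comp hη.continuous (hηS p hp) _ _) _ _
  have hlS : ∀ p ∈ S, p ∉ range (fun t : ℝ => (c : ℂ) + t * I) := by
    rintro p hp ⟨t, rfl⟩
    have := (hS _ hp).2.1
    simp at this
  -- the principal parts
  have hends : ∀ p : ℂ, Tendsto (fun R => ‖γ R - p‖) atTop atTop ∧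
      Tendsto (fun R => ‖γ (-R) - p‖) atTop atTop := fun p => by
    constructor
    · refine (tendsto_norm_sub_mul_I (-p)).congr' ?_
      filter_upwards [ha.eventually] with R hR
      rw [hR.1]; congr 1; ring
    · refine (tendsto_norm_add_mul_I (-p)).congr' ?_
      filter_upwards [ha.eventually] with R hR
      rw [hR.2]; congr 1; ring
  have hendsl : ∀ p : ℂ, Tendsto (fun R : ℝ => ‖(c : ℂ) + R * I - p‖) atTop atTop ∧
      Tendsto (fun R : ℝ => ‖(c : ℂ) + (-R : ℝ) * I - p‖) atTop atTop := fun p => by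
    constructor
    · refine (tendsto_norm_add_mul_I (c - p)).congr fun R => ?_
      congr 1; ring
    · refine (tendsto_norm_sub_mul_I (c - p)).congr fun R => ?_
      congr 1; push_cast; ring
  have hpp : Tendsto (fun R : ℝ =>
      (∑ p ∈ S, ∫ t in (-R)..R, principalPart (g p) n p (γ t) * deriv γ t) +
      ∑ p ∈ S, ∫ t in (-R)..R, principalPart (g p) n p (c + t * I) *
        deriv (fun t : ℝ => (c : ℂ) + t * I) t) atTop
      (𝓝 (∑ p ∈ S, taylorCoeff (g p) p (n - 1) * (w p + Real.pi * I))) := by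
    simp only [mul_add, Finset.sum_add_distrib]
    refine (tendsto_finsetSum S fun p hp => ?_).add (tendsto_finsetSum S fun p hp => ?_)
    · exact hasPV_principalPart ht (hS p hp).1 (hends p).1 (hends p).2 (hS p hp).2.2 _ hn
    · exact hasPV_principalPart (isTame_line c) (hlS p hp) (hendsl p).1 (hendsl p).2
        (hasPV_inv_line (hS p hp).2.1) _ hn
  -- the ends
  have hFdecay : Tendsto F (stripEnds c) (𝓝 0) := by
    have h1 : Tendsto (fun s => f s - ∑ p ∈ S, principalPart (g p) n p s) (stripEnds c)
        (𝓝 (0 - ∑ p ∈ S, 0)) :=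
      hdecay.sub (tendsto_finsetSum S fun p _ => tendsto_principalPart_stripEnds c _ n p)
    rw [Finset.sum_const_zero, sub_zero] at h1
    refine h1.congr' ?_
    have h2 : ∀ᶠ s in stripEnds c, ∀ p ∈ S, |p.im| < |s.im| :=
      (Finset.eventually_all S).2 fun p _ =>
        (tendsto_comap.mono_left inf_le_left).eventually (eventually_gt_atTop _)
    filter_upwards [h2] with s hs
    exact (hFs s fun h => lt_irrefl _ (hs s h)).symm
  -- Far out `γ R = -iR` and `γ (-R) = iR`. The end terms regroup into increments of `G` over
  -- horizontal segments of length `c` at heights `±R`, where `F` is below `ε/(4c)`.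
  have hGends : Tendsto (fun R : ℝ => (G (γ R) - G (γ (-R))) +
      (G (c + R * I) - G (c + (-R : ℝ) * I))) atTop (𝓝 0) := by
    rw [Metric.tendsto_nhds]
    intro ε hε
    have hε' : 0 < ε / (4 * c) := by positivity
    have h1 := (Metric.tendsto_nhds.1 hFdecay) _ hε'
    rw [stripEnds, eventually_inf_principal, eventually_comap] at h1
    have hstep : ∀ y : ℝ, (∀ s : ℂ, |s.im| = |y| → 0 ≤ s.re ∧ s.re ≤ c → dist (F s) 0 < ε / (4 * c)) →
        ‖G (c + y * I) - G (y * I)‖ ≤ ε / 4 := fun y hy => by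
      have hconv : Convex ℝ {s : ℂ | (0 ≤ s.re ∧ s.re ≤ c) ∧ s.im = y} :=
        ((convex_halfSpace_re_ge 0).inter (convex_halfSpace_re_le c)).inter
          (convex_hyperplane (f := im) ⟨add_im, fun c x => by simp⟩ y)
      have := hconv.norm_image_sub_le_of_norm_hasDerivWithin_le (f := G) (f' := F)
        (C := ε / (4 * c)) (x := y * I) (y := c + y * I)
        (fun s hs => (hG' s ⟨hA0.trans_le hs.1.1, hs.1.2.trans_lt hcB⟩).hasDerivWithinAt)
        (fun s hs => by
          have := hy s (by rw [hs.2]) hs.1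
          rw [dist_zero_right] at this
          exact this.le)
        (by simp [hc0.le]) (by simp [hc0.le])
      refine this.trans (le_of_eq ?_)
      rw [add_sub_cancel_right, norm_real, Real.norm_of_nonneg hc0.le]
      field_simp
    filter_upwards [ha.eventually, h1, eventually_ge_atTop 0] with R hR hR1 hR0
    have e1 := hstep R fun s hs => hR1 s (by rw [hs, abs_of_nonneg hR0])
    have e2 := hstep (-R) fun s hs => hR1 s (by rw [hs, abs_neg, abs_of_nonneg hR0])
    rw [hR.1, hR.2, dist_zero_right]
    have hcast : (((-R : ℝ) : ℂ)) * I = -(R * I) := by push_cast; ring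
    rw [hcast] at e2 ⊢
    have : G (-(R * I)) - G (R * I) + (G (c + R * I) - G (c + -(R * I))) =
        (G (c + R * I) - G (R * I)) - (G (c + -(R * I)) - G (-(R * I))) := by ring
    rw [this]
    refine (norm_sub_le _ _).trans_lt ?_
    linarith
  have := hGends.add hpp
  rw [zero_add] at this
  refine this.congr fun R => ?_
  have p1 := piece ht hγ (fun p hp => (hS p hp).1) R
  have p2 := piece (isTame_line c) hline hlS R
  have p3 : ∫ t in (-R)..R, f (c + t * I) * I =
      ∫ t in (-R)..R, f (c + t * I) * deriv (fun t : ℝ => (c : ℂ) + t * I) t := by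
    congr 1; ext t; rw [(hasDerivAt_line c t).deriv]
  rw [p3, p1, p2]
  ring

/-! ### The slit plane and its branch of the logarithm. -/

section Geometry

lemma cutPlane_eq : cutPlane = {z : ℂ | -z ∈ slitPlane} := by
  ext z
  simp only [cutPlane, mem_ofPred_eq, mem_slitPlane_iff, neg_re, neg_im, neg_pos, neg_ne_zero,
    not_and_or, not_le, ne_eq]

lemma neg_mem_slitPlane {z : ℂ} (hz : z ∈ cutPlane) : -z ∈ slitPlane := by
  rwa [cutPlane_eq] at hz

lemma isOpen_cutPlane : IsOpen cutPlane := by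
  rw [cutPlane_eq]
  exact isOpen_slitPlane.preimage continuous_neg

lemma isOpen_cutDisc (r : ℝ) : IsOpen (cutDisc r) := Metric.isOpen_ball.inter isOpen_cutPlane

lemma norm_lt_of_mem_cutDisc {r : ℝ} {z : ℂ} (hz : z ∈ cutDisc r) : ‖z‖ < r := by
  simpa using hz.1

lemma cutDisc_mono {r r' : ℝ} (h : r ≤ r') : cutDisc r ⊆ cutDisc r' :=
  inter_subset_inter_left _ (Metric.ball_subset_ball h)

lemma ne_zero_of_mem_cutPlane {z : ℂ} (hz : z ∈ cutPlane) : z ≠ 0 := by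
  rintro rfl
  exact hz ⟨le_rfl, rfl⟩

lemma hasDerivAt_cutLog {z : ℂ} (hz : z ∈ cutPlane) : HasDerivAt cutLog z⁻¹ z := by
  have h := ((hasDerivAt_id z).fun_neg.clog (neg_mem_slitPlane hz)).add_const (Real.pi * I : ℂ)
  refine h.congr_deriv ?_
  simp only [id]
  rw [neg_div_neg_eq, one_div]

lemma exp_cutLog {z : ℂ} (hz : z ∈ cutPlane) : exp (cutLog z) = z := by
  rw [cutLog, exp_add, exp_log (neg_ne_zero.2 (ne_zero_of_mem_cutPlane hz)), exp_pi_mul_I]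
  ring

lemma cutLog_im_mem {z : ℂ} (hz : z ∈ cutPlane) : cutLog z |>.im |> (· ∈ Ioo 0 (2 * Real.pi)) := by
  have h1 := neg_pi_lt_arg (-z)
  have h2 := (mem_slitPlane_iff_arg.1 (neg_mem_slitPlane hz)).1
  have h3 := lt_of_le_of_ne (arg_le_pi (-z)) h2
  simp only [cutLog, add_im, log_im, mem_Ioo, mul_im, ofReal_re, I_im, ofReal_im, I_re]
  constructor <;> linarith

end Geometry

/-! ### Euler operators depend only on the function on an open set. -/

section EulerOperators

lemma eulerShift_congr {U : Set ℂ} (hU : IsOpen U) {f g : ℂ → ℂ} (h : EqOn f g U) (c : ℂ) :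
    EqOn (eulerShift c f) (eulerShift c g) U := fun z hz => by
  have : f =ᶠ[𝓝 z] g := h.eventuallyEq_of_mem (hU.mem_nhds hz)
  rw [eulerShift, eulerShift, this.deriv_eq, h hz]

lemma foldr_eulerShift_congr {U : Set ℂ} (hU : IsOpen U) {f g : ℂ → ℂ} (h : EqOn f g U)
    (l : List ℂ) : EqOn (l.foldr eulerShift f) (l.foldr eulerShift g) U := by
  induction l with
  | nil => exact h
  | cons c l ih => exact eulerShift_congr hU ih c

lemma IsSolution.congr {n : ℕ} {α β : Fin n → ℂ} {U : Set ℂ} (hU : IsOpen U) {f g : ℂ → ℂ}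
    (h : EqOn f g U) (hf : IsSolution α β U f) : IsSolution α β U g := by
  refine ⟨hf.1.congr fun z hz => (h hz).symm, fun z hz => ?_⟩
  have h1 := foldr_eulerShift_congr hU h (List.ofFn α) hz
  have h2 := foldr_eulerShift_congr hU h (List.ofFn fun k => β k - 1) hz
  have h3 := hf.2 z hz
  rw [eulerProd, eulerProd] at h3 ⊢
  rwa [← h1, ← h2]

lemma IsSolution.mono {n : ℕ} {α β : Fin n → ℂ} {U V : Set ℂ} (h : V ⊆ U) {f : ℂ → ℂ}
    (hf : IsSolution α β U f) : IsSolution α β V f :=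
  ⟨hf.1.mono h, fun z hz => hf.2 z (h hz)⟩

end EulerOperators

/-! ### Series `∑ a_m(s) z^{m+s}` expanded in powers of `s`. -/

section LogSeries

open PowerSeries (coeff)

/-- Sequences of power series whose coefficients define convergent series on the unit disc. -/
def IsAdmissible (a : ℕ → PowerSeries ℂ) : Prop :=
  ∀ (j : ℕ) (x : ℝ), 0 ≤ x → x < 1 → Summable fun m => ‖coeff j (a m)‖ * x ^ m

/-- The sum `∑ₘ aₘⱼ zᵐ`. -/
noncomputable def colSum (a : ℕ → PowerSeries ℂ) (j : ℕ) (z : ℂ) : ℂ :=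
  ∑' m, coeff j (a m) * z ^ m

/-- The coefficient of `sᵏ` in `∑ₘ aₘ(s) z^(m + s)`. -/
noncomputable def logSum (a : ℕ → PowerSeries ℂ) (k : ℕ) (z : ℂ) : ℂ :=
  ∑ l ∈ Finset.range (k + 1), colSum a (k - l) z * (cutLog z ^ l / (l.factorial : ℂ))

lemma IsAdmissible.summable {a : ℕ → PowerSeries ℂ} (ha : IsAdmissible a) (j : ℕ) {z : ℂ}
    (hz : ‖z‖ < 1) : Summable fun m => coeff j (a m) * z ^ m := by
  refine Summable.of_norm ?_
  simpa only [norm_mul, norm_pow] using ha j ‖z‖ (norm_nonneg z) hz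

lemma IsAdmissible.natCast_mul {a : ℕ → PowerSeries ℂ} (ha : IsAdmissible a) :
    IsAdmissible fun m => PowerSeries.C (m : ℂ) * a m := by
  intro j x hx0 hx1
  -- The factor `m` is absorbed by the geometric gain `(x/y)^m`.
  obtain ⟨y, hxy, hy1⟩ := exists_between hx1
  have hy0 : 0 < y := hx0.trans_lt hxy
  have hr0 : 0 ≤ x / y := by positivity
  have hr1 : x / y < 1 := (div_lt_one hy0).2 hxy
  obtain ⟨C, hC⟩ := (tendsto_self_mul_const_pow_of_lt_one hr0 hr1).bddAbove_range
  refine Summable.of_nonneg_of_le (fun m => by positivity) (fun m => ?_)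
    ((ha j y hy0.le hy1).mul_right C)
  have h1 : (m : ℝ) * (x / y) ^ m ≤ C := hC ⟨m, rfl⟩
  rw [PowerSeries.coeff_C_mul, norm_mul, Complex.norm_natCast]
  have h2 : x ^ m = (x / y) ^ m * y ^ m := by rw [← mul_pow, div_mul_cancel₀ _ hy0.ne']
  calc (m : ℝ) * ‖coeff j (a m)‖ * x ^ m
      = ‖coeff j (a m)‖ * y ^ m * (m * (x / y) ^ m) := by rw [h2]; ring
    _ ≤ _ := by gcongr

lemma IsAdmissible.const_mul {a : ℕ → PowerSeries ℂ} (ha : IsAdmissible a) (c : ℂ) :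
    IsAdmissible fun m => PowerSeries.C c * a m := by
  intro j x hx0 hx1
  simpa only [PowerSeries.coeff_C_mul, norm_mul, mul_assoc] using (ha j x hx0 hx1).mul_left ‖c‖

lemma IsAdmissible.X_mul {a : ℕ → PowerSeries ℂ} (ha : IsAdmissible a) :
    IsAdmissible fun m => PowerSeries.X * a m := by
  intro j x hx0 hx1
  cases j with
  | zero => simp
  | succ j => simpa only [PowerSeries.coeff_succ_X_mul] using ha j x hx0 hx1

lemma IsAdmissible.add {a b : ℕ → PowerSeries ℂ} (ha : IsAdmissible a) (hb : IsAdmissible b) :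
    IsAdmissible fun m => a m + b m := by
  intro j x hx0 hx1
  refine Summable.of_nonneg_of_le (fun m => by positivity) (fun m => ?_)
    ((ha j x hx0 hx1).add (hb j x hx0 hx1))
  rw [map_add, ← add_mul]
  gcongr
  exact norm_add_le _ _

lemma IsAdmissible.shift {a : ℕ → PowerSeries ℂ} (ha : IsAdmissible a) (c : ℂ) :
    IsAdmissible fun m => (PowerSeries.C ((m : ℂ) + c) + PowerSeries.X) * a m := by
  have := (ha.natCast_mul.add (ha.const_mul c)).add ha.X_mul
  refine (congrArg IsAdmissible (funext fun m => ?_)).mp this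
  rw [map_add]; ring

/-- Termwise differentiation on a ball of radius `y < 1`. The majorant is the admissibility of the
sequence multiplied by `m`. -/
lemma hasDerivAt_colSum {a : ℕ → PowerSeries ℂ} (ha : IsAdmissible a) (j : ℕ) {z : ℂ}
    (hz : ‖z‖ < 1) :
    HasDerivAt (colSum a j) (∑' m, coeff j (a m) * (m * z ^ (m - 1))) z := by
  obtain ⟨y, hzy, hy1⟩ := exists_between hz
  have hy0 : 0 < y := (norm_nonneg z).trans_lt hzy
  have hu : Summable fun m : ℕ => ‖coeff j (PowerSeries.C (m : ℂ) * a m)‖ * y ^ m * y⁻¹ :=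
    (ha.natCast_mul j y hy0.le hy1).mul_right _
  have hbd : ∀ (m : ℕ) (w : ℂ), w ∈ Metric.ball (0 : ℂ) y → ‖coeff j (a m) * (m * w ^ (m - 1))‖ ≤
      ‖coeff j (PowerSeries.C (m : ℂ) * a m)‖ * y ^ m * y⁻¹ := fun m w hw => by
    have hw' : ‖w‖ ≤ y := (by simpa using hw : ‖w‖ < y).le
    rw [PowerSeries.coeff_C_mul, norm_mul, norm_mul, norm_mul, norm_pow, Complex.norm_natCast]
    cases m with
    | zero => simp
    | succ m =>
      rw [Nat.add_sub_cancel, pow_succ, mul_assoc _ (y ^ m * y), mul_assoc (y ^ m),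
        mul_inv_cancel₀ hy0.ne', mul_one, ← mul_assoc, mul_comm ‖_‖ ((_ : ℕ) : ℝ)]
      gcongr
  have hder : ∀ (m : ℕ) (w : ℂ), w ∈ Metric.ball (0 : ℂ) y →
      HasDerivAt (fun w : ℂ => coeff j (a m) * w ^ m) (coeff j (a m) * (m * w ^ (m - 1))) w :=
    fun m w _ => (hasDerivAt_pow m w).const_mul _
  have hz' : z ∈ Metric.ball (0 : ℂ) y := by simpa using hzy
  exact hasDerivAt_tsum_of_isPreconnected hu Metric.isOpen_ball (convex_ball 0 y).isPreconnected
    hder hbd hz' (ha.summable j hz) hz'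

lemma mul_tsum_deriv (a : ℕ → PowerSeries ℂ) (j : ℕ) (z : ℂ) :
    z * ∑' m, coeff j (a m) * (m * z ^ (m - 1)) =
      colSum (fun m => PowerSeries.C (m : ℂ) * a m) j z := by
  rw [colSum, ← tsum_mul_left]
  refine tsum_congr fun m => ?_
  rw [PowerSeries.coeff_C_mul]
  cases m with
  | zero => simp
  | succ m => rw [Nat.add_sub_cancel, pow_succ]; ring

lemma differentiableOn_colSum {a : ℕ → PowerSeries ℂ} (ha : IsAdmissible a) (j : ℕ) :
    DifferentiableOn ℂ (colSum a j) (Metric.ball 0 1) := fun _ hz =>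
  (hasDerivAt_colSum ha j (by simpa using hz)).differentiableAt.differentiableWithinAt

lemma differentiableOn_logSum {a : ℕ → PowerSeries ℂ} (ha : IsAdmissible a) (k : ℕ) :
    DifferentiableOn ℂ (logSum a k) (cutDisc 1) := by
  intro z hz
  refine DifferentiableWithinAt.fun_sum fun l _ => DifferentiableWithinAt.fun_mul ?_ ?_
  · exact (hasDerivAt_colSum ha _
      (norm_lt_of_mem_cutDisc hz)).differentiableAt.differentiableWithinAt
  · exact (((hasDerivAt_cutLog hz.2).differentiableAt.fun_pow l).div_const
      _).differentiableWithinAt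

lemma colSum_shift {a : ℕ → PowerSeries ℂ} (ha : IsAdmissible a) (c : ℂ) (j : ℕ) {z : ℂ}
    (hz : ‖z‖ < 1) :
    colSum (fun m => (PowerSeries.C ((m : ℂ) + c) + PowerSeries.X) * a m) j z =
      colSum (fun m => PowerSeries.C (m : ℂ) * a m) j z + c * colSum a j z +
        if j = 0 then 0 else colSum a (j - 1) z := by
  have hX : colSum (fun m => PowerSeries.X * a m) j z =
      if j = 0 then 0 else colSum a (j - 1) z := by
    cases j with
    | zero => simp [colSum]
    | succ j => simp [colSum, PowerSeries.coeff_succ_X_mul]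
  rw [← hX, colSum, colSum, colSum, colSum, ← tsum_mul_left,
    ← (ha.natCast_mul.summable j hz).tsum_add ((ha.summable j hz).mul_left c),
    ← ((ha.natCast_mul.summable j hz).add ((ha.summable j hz).mul_left c)).tsum_add
      (ha.X_mul.summable j hz)]
  refine tsum_congr fun m => ?_
  simp only [map_add, add_mul, PowerSeries.coeff_C_mul]
  ring

/-- The coefficientwise form of `(θ + c) z^{m+s} = (m + c + s) z^{m+s}`; the variable `X` plays the
role of `s`. -/
lemma eulerShift_logSum {a : ℕ → PowerSeries ℂ} (ha : IsAdmissible a) (c : ℂ) (k : ℕ) :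
    EqOn (eulerShift c (logSum a k))
      (logSum (fun m => (PowerSeries.C ((m : ℂ) + c) + PowerSeries.X) * a m) k)
      (cutDisc 1) := by
  intro z hz
  have hz1 := norm_lt_of_mem_cutDisc hz
  have hz0 := ne_zero_of_mem_cutPlane hz.2
  have hd : HasDerivAt (logSum a k) (∑ l ∈ Finset.range (k + 1),
      ((∑' m, coeff (k - l) (a m) * (m * z ^ (m - 1))) * (cutLog z ^ l / (l.factorial : ℂ)) +
        colSum a (k - l) z * (l * cutLog z ^ (l - 1) * z⁻¹ / (l.factorial : ℂ)))) z :=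
    HasDerivAt.fun_sum fun l _ => (hasDerivAt_colSum ha (k - l) hz1).fun_mul
      (((hasDerivAt_cutLog hz.2).fun_pow l).div_const _)
  -- Applying `θ` to `log^l / l!` gives `log^{l-1} / (l-1)!`. After reindexing this is
  -- multiplication by `X` on the coefficient series.
  have hshift : ∑ l ∈ Finset.range (k + 1),
      colSum a (k - l) z * (l * cutLog z ^ (l - 1) / (l.factorial : ℂ)) =
      ∑ l ∈ Finset.range (k + 1), (if k - l = 0 then 0 else colSum a (k - l - 1) z) *
        (cutLog z ^ l / (l.factorial : ℂ)) := by
    rw [Finset.sum_range_succ', Finset.sum_range_succ]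
    simp only [Nat.cast_zero, zero_mul, zero_div, mul_zero, add_zero, Nat.sub_self, if_true]
    refine Finset.sum_congr rfl fun l hl => ?_
    have hl' := Finset.mem_range.1 hl
    rw [if_neg (by omega), Nat.sub_sub, Nat.add_sub_cancel, Nat.factorial_succ]
    have : ((l.factorial : ℕ) : ℂ) ≠ 0 := by exact_mod_cast l.factorial_ne_zero
    have : ((l : ℂ) + 1) ≠ 0 := by exact_mod_cast l.succ_ne_zero
    congr 1
    push_cast
    field_simp
  rw [eulerShift, hd.deriv, Finset.sum_add_distrib, mul_add, Finset.mul_sum, Finset.mul_sum]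
  have e1 : ∀ l ∈ Finset.range (k + 1),
      z * (colSum a (k - l) z * (l * cutLog z ^ (l - 1) * z⁻¹ / (l.factorial : ℂ))) =
      colSum a (k - l) z * (l * cutLog z ^ (l - 1) / (l.factorial : ℂ)) := fun l _ => by
    field_simp
  rw [Finset.sum_congr rfl e1, hshift, logSum, logSum, Finset.mul_sum, ← Finset.sum_add_distrib,
    ← Finset.sum_add_distrib]
  refine Finset.sum_congr rfl fun l _ => ?_
  rw [colSum_shift ha c _ hz1, ← mul_tsum_deriv]
  ring

lemma foldr_eulerShift_logSum {a : ℕ → PowerSeries ℂ} (ha : IsAdmissible a) (k : ℕ)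
    (l : List ℂ) :
    IsAdmissible (fun m => (l.map fun c => PowerSeries.C ((m : ℂ) + c) + PowerSeries.X).prod * a m) ∧
    EqOn (l.foldr eulerShift (logSum a k))
      (logSum (fun m => (l.map fun c => PowerSeries.C ((m : ℂ) + c) + PowerSeries.X).prod * a m) k)
      (cutDisc 1) := by
  induction l with
  | nil => simpa using ⟨ha, fun _ _ => rfl⟩
  | cons c l ih =>
    simp only [List.map_cons, List.prod_cons, mul_assoc, List.foldr_cons]
    exact ⟨ih.1.shift c, (eulerShift_congr (isOpen_cutDisc 1) ih.2 c).trans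
      (eulerShift_logSum ih.1 c k)⟩

/-- The index `k` sees the series only modulo `s^{k+1}`; this is what permits computing modulo
`s^n`. -/
lemma logSum_congr {a b : ℕ → PowerSeries ℂ} {k : ℕ}
    (h : ∀ m, ∀ j ≤ k, coeff j (a m) = coeff j (b m)) (z : ℂ) : logSum a k z = logSum b k z := by
  refine Finset.sum_congr rfl fun l _ => ?_
  congr 1
  exact tsum_congr fun m => by rw [h m _ (Nat.sub_le k l)]

lemma mul_logSum {a b : ℕ → PowerSeries ℂ} (hb : IsAdmissible b) (h0 : b 0 = 0)
    (h : ∀ m, b (m + 1) = a m) (k : ℕ) {z : ℂ} (hz : ‖z‖ < 1) :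
    z * logSum a k z = logSum b k z := by
  rw [logSum, logSum, Finset.mul_sum]
  refine Finset.sum_congr rfl fun l _ => ?_
  rw [← mul_assoc]
  congr 1
  rw [colSum, colSum, (hb.summable _ hz).tsum_eq_zero_add, h0, map_zero, zero_mul, zero_add,
    ← tsum_mul_left]
  refine tsum_congr fun m => ?_
  rw [h, pow_succ]; ring

end LogSeries

/-! ### From the coefficient recursion to solutions. -/

section Recursion

open PowerSeries (coeff)

/-- A sequence of power series satisfying the recursion of the hypergeometric equation up to
order `n` gives solutions. -/
lemma isSolution_logSum {n : ℕ} {α : Fin n → ℂ} {a : ℕ → PowerSeries ℂ} (ha : IsAdmissible a)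
    (h0 : a 0 = 1) (hrec : ∀ m : ℕ, (PowerSeries.C ((m : ℂ) + 1) + PowerSeries.X) ^ n * a (m + 1) =
      (∏ k, (PowerSeries.C ((m : ℂ) + α k) + PowerSeries.X)) * a m) {k : ℕ} (hk : k < n) :
    IsSolution α (fun _ => 1) (cutDisc 1) (logSum a k) := by
  refine ⟨differentiableOn_logSum ha k, fun z hz => ?_⟩
  have hz1 := norm_lt_of_mem_cutDisc hz
  obtain ⟨-, e1⟩ := foldr_eulerShift_logSum ha k (List.ofFn α)
  obtain ⟨ha2, e2⟩ := foldr_eulerShift_logSum ha k (List.ofFn fun _ : Fin n => (1 : ℂ) - 1)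
  have hp : ∀ m : ℕ, ((List.ofFn fun _ : Fin n => (1 : ℂ) - 1).map
      fun c => PowerSeries.C ((m : ℂ) + c) + PowerSeries.X).prod =
        (PowerSeries.C (m : ℂ) + PowerSeries.X) ^ n := fun m => by
    simp
  simp only [hp] at ha2 e2
  -- `b` is the coefficient sequence after `θ^n`, with its term `m = 0` dropped. That term is `X^n`,
  -- invisible to the coefficients of index at most `k < n`, and the others match the shifted
  -- sequence of the left side by the recursion.
  set b : ℕ → PowerSeries ℂ := fun m =>
    if m = 0 then 0 else (PowerSeries.C (m : ℂ) + PowerSeries.X) ^ n * a m with hb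
  have hbadm : IsAdmissible b := fun j x hx0 hx1 => by
    refine Summable.of_nonneg_of_le (fun m => by positivity) (fun m => ?_) (ha2 j x hx0 hx1)
    rw [hb]
    dsimp only
    split_ifs
    · rw [map_zero, norm_zero, zero_mul]; positivity
    · exact le_rfl
  rw [eulerProd, eulerProd, e1 hz, e2 hz]
  rw [mul_logSum (b := b) hbadm (by simp [hb]) (fun m => ?_) k hz1, sub_eq_zero]
  · refine logSum_congr (fun m j hj => ?_) z
    rw [hb]
    dsimp only
    split_ifs with hm
    · rw [hm, h0, Nat.cast_zero, map_zero, map_zero, zero_add, mul_one, PowerSeries.coeff_X_pow,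
        if_neg (by omega)]
    · rfl
  · rw [hb]
    simp only [Nat.succ_ne_zero, if_false]
    push_cast
    rw [hrec m, List.map_ofFn, List.prod_ofFn]
    rfl

end Recursion

/-! ### Taylor series as a multiplicative map to power series. -/

section TaylorSeries

/-- The Taylor series at the origin. -/
noncomputable def taylorSeries (g : ℂ → ℂ) : PowerSeries ℂ := PowerSeries.mk (taylorCoeff g 0)

lemma coeff_taylorSeries (g : ℂ → ℂ) (i : ℕ) :
    PowerSeries.coeff i (taylorSeries g) = taylorCoeff g 0 i := PowerSeries.coeff_mk _ _

lemma taylorSeries_congr {f g : ℂ → ℂ} (h : f =ᶠ[𝓝 0] g) : taylorSeries f = taylorSeries g := by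
  ext i
  rw [coeff_taylorSeries, coeff_taylorSeries, taylorCoeff, taylorCoeff, h.iteratedDeriv_eq i]

lemma taylorSeries_mul {f g : ℂ → ℂ} (hf : AnalyticAt ℂ f 0) (hg : AnalyticAt ℂ g 0) :
    taylorSeries (fun s => f s * g s) = taylorSeries f * taylorSeries g := by
  ext i
  rw [PowerSeries.coeff_mul, Finset.Nat.sum_antidiagonal_eq_sum_range_succ_mk]
  simp only [coeff_taylorSeries, taylorCoeff]
  rw [iteratedDeriv_fun_mul hf.contDiffAt hg.contDiffAt, Finset.sum_div]
  refine Finset.sum_congr rfl fun j hj => ?_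
  have hji : j ≤ i := Nat.lt_succ_iff.1 (Finset.mem_range.1 hj)
  have h1 : ((i.choose j : ℕ) : ℂ) * j.factorial * (i - j).factorial = i.factorial := by
    exact_mod_cast Nat.choose_mul_factorial_mul_factorial hji
  have h2 : ((j.factorial : ℕ) : ℂ) ≠ 0 := by exact_mod_cast j.factorial_ne_zero
  have h3 : (((i - j).factorial : ℕ) : ℂ) ≠ 0 := by exact_mod_cast (i - j).factorial_ne_zero
  have h4 : ((i.factorial : ℕ) : ℂ) ≠ 0 := by exact_mod_cast i.factorial_ne_zero
  field_simp
  rw [← h1]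
  ring

lemma taylorSeries_const (c : ℂ) : taylorSeries (fun _ => c) = PowerSeries.C c := by
  ext i
  rw [coeff_taylorSeries, taylorCoeff, iteratedDeriv_const, PowerSeries.coeff_C]
  split_ifs with h <;> simp [h]

lemma taylorSeries_const_add (c : ℂ) :
    taylorSeries (fun s => c + s) = PowerSeries.C c + PowerSeries.X := by
  ext i
  rw [coeff_taylorSeries, taylorCoeff, map_add, PowerSeries.coeff_C, PowerSeries.coeff_X]
  rcases Nat.eq_zero_or_pos i with rfl | hi
  · simp
  · rw [iteratedDeriv_const_add hi, iteratedDeriv_fun_id_zero, if_neg hi.ne', zero_add]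
    split_ifs with h <;> simp [h]

lemma taylorSeries_prod {ι : Type*} (S : Finset ι) {f : ι → ℂ → ℂ}
    (hf : ∀ i ∈ S, AnalyticAt ℂ (f i) 0) :
    taylorSeries (fun s => ∏ i ∈ S, f i s) = ∏ i ∈ S, taylorSeries (f i) := by
  classical
  induction S using Finset.induction_on with
  | empty => simpa using taylorSeries_const 1
  | insert i S hi ih =>
    have h1 := hf i (Finset.mem_insert_self i S)
    have h2 : ∀ j ∈ S, AnalyticAt ℂ (f j) 0 := fun j hj => hf j (Finset.mem_insert_of_mem hj)
    simp only [Finset.prod_insert hi]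
    rw [taylorSeries_mul h1 (Finset.analyticAt_fun_prod S h2), ih h2]

lemma taylorSeries_pow {f : ℂ → ℂ} (hf : AnalyticAt ℂ f 0) (n : ℕ) :
    taylorSeries (fun s => f s ^ n) = taylorSeries f ^ n := by
  have := taylorSeries_prod (Finset.range n) (f := fun _ => f) fun _ _ => hf
  simpa using this

lemma taylorCoeff_exp_mul (L : ℂ) (i : ℕ) :
    taylorCoeff (fun s => exp (s * L)) 0 i = L ^ i / i.factorial := by
  have : (fun s => exp (s * L)) = fun s => exp (L * s) := by ext s; rw [mul_comm]
  rw [taylorCoeff, this, iteratedDeriv_cexp_const_mul]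
  simp

end TaylorSeries

/-! ### The coefficients `a_m(s)`: recursion, growth and the resulting Frobenius basis. -/

section Coefficients

variable {n : ℕ}

/-- The coefficients `∏_{i < m} ∏ₖ (αₖ + i + s) / (1 + i + s)` of the Frobenius series. -/
noncomputable def hyperCoeff (α : Fin n → ℂ) (m : ℕ) (s : ℂ) : ℂ :=
  ∏ i ∈ Finset.range m, ∏ k, (i + α k + s) / (i + 1 + s)

lemma hyperCoeff_succ (α : Fin n → ℂ) (m : ℕ) (s : ℂ) :
    hyperCoeff α (m + 1) s = hyperCoeff α m s * ∏ k, (m + α k + s) / (m + 1 + s) :=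
  Finset.prod_range_succ _ _

lemma nat_add_one_add_ne_zero {s : ℂ} (hs : ‖s‖ < 1) (i : ℕ) : (i : ℂ) + 1 + s ≠ 0 := by
  intro h
  have h1 := (abs_le.1 ((abs_re_le_norm s).trans hs.le)).1
  have h2 := congrArg re h
  have h3 : |s.re| < 1 := (abs_re_le_norm s).trans_lt hs
  have h4 := (abs_lt.1 h3).1
  simp at h2
  have : (0 : ℝ) ≤ i := i.cast_nonneg
  linarith

lemma differentiableAt_hyperCoeff (α : Fin n → ℂ) (m : ℕ) {s : ℂ} (hs : ‖s‖ < 1) :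
    DifferentiableAt ℂ (hyperCoeff α m) s := by
  unfold hyperCoeff
  refine DifferentiableAt.fun_finsetProd fun i _ => DifferentiableAt.fun_finsetProd fun k _ => ?_
  exact DifferentiableAt.fun_div (by fun_prop) (by fun_prop) (nat_add_one_add_ne_zero hs i)

lemma analyticAt_hyperCoeff (α : Fin n → ℂ) (m : ℕ) : AnalyticAt ℂ (hyperCoeff α m) 0 := by
  refine analyticAt_iff_eventually_differentiableAt.2 ?_
  filter_upwards [Metric.ball_mem_nhds (0 : ℂ) one_pos] with s hs
  exact differentiableAt_hyperCoeff α m (by simpa using hs)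

/-- The Taylor series of the coefficients of the Frobenius series. -/
noncomputable def hyperSeries (α : Fin n → ℂ) (m : ℕ) : PowerSeries ℂ :=
  taylorSeries (hyperCoeff α m)

lemma hyperSeries_zero (α : Fin n → ℂ) : hyperSeries α 0 = 1 := by
  have : hyperCoeff α 0 = fun _ => 1 := by ext s; simp [hyperCoeff]
  rw [hyperSeries, this, taylorSeries_const, map_one]

lemma hyperSeries_succ (α : Fin n → ℂ) (m : ℕ) :
    (PowerSeries.C ((m : ℂ) + 1) + PowerSeries.X) ^ n * hyperSeries α (m + 1) =
      (∏ k, (PowerSeries.C ((m : ℂ) + α k) + PowerSeries.X)) * hyperSeries α m := by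
  have h1 : (fun s => ((m : ℂ) + 1 + s) ^ n * hyperCoeff α (m + 1) s) =ᶠ[𝓝 0]
      fun s => (∏ k, ((m : ℂ) + α k + s)) * hyperCoeff α m s := by
    filter_upwards [Metric.ball_mem_nhds (0 : ℂ) one_pos] with s hs
    have hne := nat_add_one_add_ne_zero (s := s) (by simpa using hs) m
    rw [hyperCoeff_succ, Finset.prod_div_distrib, Finset.prod_const, Finset.card_univ,
      Fintype.card_fin]
    field_simp
  have h2 := taylorSeries_congr h1
  rw [taylorSeries_mul (by fun_prop) (analyticAt_hyperCoeff α _),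
    taylorSeries_mul (Finset.analyticAt_fun_prod _ fun k _ => by fun_prop)
      (analyticAt_hyperCoeff α _), taylorSeries_pow (by fun_prop),
    taylorSeries_prod _ fun k _ => by fun_prop] at h2
  simpa only [taylorSeries_const_add, hyperSeries] using h2

/-- From `(α_k + s)/(1 + s) = 1 + (α_k - 1)/(1 + s)`. The bound tends to `1` as `x` grows; it
controls both the coefficients of the Frobenius series and the integrals over vertical lines. -/
lemma exists_norm_prod_div_le (α : Fin n → ℂ) :
    ∃ K : ℝ, 0 ≤ K ∧ ∀ (s : ℂ) (x : ℝ), 0 < x → x ≤ (1 + s).re →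
      ‖∏ k, (α k + s) / (1 + s)‖ ≤ (1 + K / x) ^ n := by
  refine ⟨∑ k, ‖α k - 1‖, by positivity, fun s x hx hs => ?_⟩
  have hs1 : x ≤ ‖1 + s‖ := hs.trans ((le_abs_self _).trans (abs_re_le_norm _))
  have hs0 : 1 + s ≠ 0 := norm_pos_iff.1 (hx.trans_le hs1)
  rw [norm_prod]
  refine (Finset.prod_le_prod (fun _ _ => norm_nonneg _) fun k _ => ?_).trans_eq
    (by rw [Finset.prod_const, Finset.card_univ, Fintype.card_fin] :
      ∏ _k : Fin n, (1 + (∑ k, ‖α k - 1‖) / x) = _)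
  have e : (α k + s) / (1 + s) = 1 + (α k - 1) / (1 + s) := by field_simp; ring
  rw [e]
  refine (norm_add_le _ _).trans ?_
  rw [norm_one, norm_div]
  gcongr
  exact Finset.single_le_sum (f := fun k => ‖α k - 1‖) (fun _ _ => norm_nonneg _) (Finset.mem_univ k)

lemma tendsto_one_add_div_pow (K x : ℝ) (n : ℕ) (y : ℝ) :
    Tendsto (fun m : ℕ => (1 + K / (m + x)) ^ n * y) atTop (𝓝 y) := by
  have h1 : Tendsto (fun m : ℕ => K / ((m : ℝ) + x)) atTop (𝓝 0) :=
    tendsto_const_nhds.div_atTop (tendsto_atTop_add_const_right _ _ tendsto_natCast_atTop_atTop)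
  simpa using ((h1.const_add 1).pow n).mul_const y

/-- On `|s| ≤ 1/2` the coefficients are bounded by `M m`, whose successive ratios tend to `1`.
Cauchy's estimate on the circle of radius `1/2` passes this to the `j`-th Taylor coefficient at the
cost of `2^j`. -/
lemma isAdmissible_hyperSeries (α : Fin n → ℂ) : IsAdmissible (hyperSeries α) := by
  obtain ⟨K, hK0, hK⟩ := exists_norm_prod_div_le α
  set M : ℕ → ℝ := fun m => ∏ i ∈ Finset.range m, (1 + K / ((i : ℝ) + 1 / 2)) ^ n
  have hM0 : ∀ m, 0 ≤ M m := fun m => Finset.prod_nonneg fun i _ => by positivity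
  have hbd : ∀ m, ∀ s : ℂ, ‖s‖ ≤ 1 / 2 → ‖hyperCoeff α m s‖ ≤ M m := fun m s hs => by
    rw [hyperCoeff, norm_prod]
    refine Finset.prod_le_prod (fun _ _ => norm_nonneg _) fun i _ => ?_
    have h1 := (abs_le.1 ((abs_re_le_norm s).trans hs)).1
    refine le_trans (le_of_eq ?_) (hK (i + s) ((i : ℝ) + 1 / 2) (by positivity) ?_)
    · congr 1
      refine Finset.prod_congr rfl fun k _ => ?_
      ring_nf
    · simp only [add_re, one_re, natCast_re]
      linarith
  intro j x hx0 hx1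
  have hsum : Summable fun m => M m * x ^ m := by
    obtain ⟨r, hxr, hr1⟩ := exists_between hx1
    refine summable_of_ratio_norm_eventually_le hr1 ?_
    filter_upwards [(tendsto_one_add_div_pow K (1 / 2) n x).eventually (eventually_le_nhds hxr)]
      with m hm
    rw [Real.norm_of_nonneg (mul_nonneg (hM0 _) (by positivity)),
      Real.norm_of_nonneg (mul_nonneg (hM0 _) (by positivity))]
    have : M (m + 1) = M m * (1 + K / ((m : ℝ) + 1 / 2)) ^ n := Finset.prod_range_succ _ _
    rw [this, pow_succ]
    have h2 : 0 ≤ M m * x ^ m := mul_nonneg (hM0 _) (by positivity)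
    nlinarith [mul_le_mul_of_nonneg_left hm h2]
  refine Summable.of_nonneg_of_le (fun m => by positivity) (fun m => ?_) (hsum.mul_left (2 ^ j))
  have hdiff : DiffContOnCl ℂ (hyperCoeff α m) (Metric.ball 0 (1 / 2)) :=
    DifferentiableOn.diffContOnCl_ball (U := Metric.ball 0 1)
      (fun s hs => (differentiableAt_hyperCoeff α m (by simpa using hs)).differentiableWithinAt)
      (Metric.closedBall_subset_ball (by norm_num))
  have hc := norm_iteratedDeriv_le_of_forall_mem_sphere_norm_le j (by norm_num) hdiff
    (C := M m) fun s hs => hbd m s (by simpa using (mem_sphere_zero_iff_norm.1 hs).le)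
  have hj : (0 : ℝ) < j.factorial := by exact_mod_cast j.factorial_pos
  have : ‖PowerSeries.coeff j (hyperSeries α m)‖ ≤ 2 ^ j * M m := by
    rw [hyperSeries, coeff_taylorSeries, taylorCoeff, norm_div, Complex.norm_natCast,
      div_le_iff₀ hj]
    refine hc.trans (le_of_eq ?_)
    rw [one_div, inv_pow]
    field_simp
  rw [← mul_assoc]
  gcongr

/-- The components of the Frobenius basis on the unit disc. -/
noncomputable def frobeniusCoeff (α : Fin n → ℂ) (k : ℕ) (z : ℂ) : ℂ :=
  colSum (hyperSeries α) k z - if k = 0 then 1 else 0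

lemma frobeniusFun_frobeniusCoeff (α : Fin n → ℂ) (k : ℕ) :
    frobeniusFun (frobeniusCoeff α) k = logSum (hyperSeries α) k := by
  ext z
  rw [frobeniusFun, logSum, Finset.sum_range_succ, add_comm, Nat.sub_self]
  congr 1
  · refine Finset.sum_congr rfl fun l hl => ?_
    have := Finset.mem_range.1 hl
    rw [frobeniusCoeff, if_neg (by omega), sub_zero, mul_div_assoc]
  · rw [frobeniusCoeff, if_pos rfl, add_sub_cancel, mul_div_assoc]

/-- Existence of a Frobenius basis on the unit disc. -/
theorem isFrobenius_frobeniusCoeff (α : Fin n → ℂ) : IsFrobenius α 1 (frobeniusCoeff α) := by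
  intro l hl
  have ha := isAdmissible_hyperSeries α
  refine ⟨((differentiableOn_colSum ha l).sub_const _).analyticOnNhd Metric.isOpen_ball, ?_, ?_⟩
  · rw [frobeniusCoeff, colSum, tsum_eq_single 0 fun m hm => by rw [zero_pow hm, mul_zero],
      hyperSeries_zero, PowerSeries.coeff_one]
    split_ifs <;> simp
  · rw [frobeniusFun_frobeniusCoeff]
    exact isSolution_logSum ha (hyperSeries_zero α) (hyperSeries_succ α) hl

end Coefficients

/-! ### Linearity of the equation and expansion in powers of `θ`. -/

section Linearity

variable {U : Set ℂ}

lemma differentiableOn_eulerShift (hU : IsOpen U) {f : ℂ → ℂ} (hf : DifferentiableOn ℂ f U)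
    (c : ℂ) : DifferentiableOn ℂ (eulerShift c f) U :=
  (differentiableOn_id.mul (hf.deriv hU)).add (hf.const_mul c)

lemma differentiableOn_foldr_eulerShift (hU : IsOpen U) {f : ℂ → ℂ} (hf : DifferentiableOn ℂ f U)
    (l : List ℂ) : DifferentiableOn ℂ (l.foldr eulerShift f) U := by
  induction l with
  | nil => exact hf
  | cons c l ih => exact differentiableOn_eulerShift hU ih c

lemma eulerShift_sum (hU : IsOpen U) {ι : Type*} (S : Finset ι) {F : ι → ℂ → ℂ}
    (hF : ∀ k ∈ S, DifferentiableOn ℂ (F k) U) (b : ι → ℂ) (c : ℂ) :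
    EqOn (eulerShift c fun z => ∑ k ∈ S, b k * F k z)
      (fun z => ∑ k ∈ S, b k * eulerShift c (F k) z) U := fun z hz => by
  have hd : HasDerivAt (fun z => ∑ k ∈ S, b k * F k z) (∑ k ∈ S, b k * deriv (F k) z) z :=
    HasDerivAt.fun_sum fun k hk =>
      (((hF k hk).differentiableAt (hU.mem_nhds hz)).hasDerivAt.const_mul (b k))
  simp only [eulerShift]
  rw [hd.deriv, Finset.mul_sum, Finset.mul_sum, ← Finset.sum_add_distrib]
  exact Finset.sum_congr rfl fun k _ => by ring

lemma foldr_eulerShift_sum (hU : IsOpen U) {ι : Type*} (S : Finset ι) {F : ι → ℂ → ℂ}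
    (hF : ∀ k ∈ S, DifferentiableOn ℂ (F k) U) (b : ι → ℂ) (l : List ℂ) :
    EqOn (l.foldr eulerShift fun z => ∑ k ∈ S, b k * F k z)
      (fun z => ∑ k ∈ S, b k * l.foldr eulerShift (F k) z) U := by
  induction l with
  | nil => exact fun _ _ => rfl
  | cons c l ih =>
    exact (eulerShift_congr hU ih c).trans
      (eulerShift_sum hU S (fun k hk => differentiableOn_foldr_eulerShift hU (hF k hk) l) b c)

lemma IsSolution.sum {n : ℕ} {α β : Fin n → ℂ} (hU : IsOpen U) {ι : Type*} (S : Finset ι)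
    {F : ι → ℂ → ℂ} (hF : ∀ k ∈ S, IsSolution α β U (F k)) (b : ι → ℂ) :
    IsSolution α β U fun z => ∑ k ∈ S, b k * F k z := by
  refine ⟨DifferentiableOn.fun_sum fun k hk => (hF k hk).1.const_mul _, fun z hz => ?_⟩
  rw [eulerProd, eulerProd, foldr_eulerShift_sum hU S (fun k hk => (hF k hk).1) b _ hz,
    foldr_eulerShift_sum hU S (fun k hk => (hF k hk).1) b _ hz, Finset.mul_sum,
    ← Finset.sum_sub_distrib]
  refine Finset.sum_eq_zero fun k hk => ?_
  have := (hF k hk).2 z hz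
  rw [eulerProd, eulerProd] at this
  linear_combination b k * this

lemma IsSolution.sub {n : ℕ} {α β : Fin n → ℂ} (hU : IsOpen U) {f g : ℂ → ℂ}
    (hf : IsSolution α β U f) (hg : IsSolution α β U g) : IsSolution α β U fun z => f z - g z := by
  have := IsSolution.sum hU (Finset.univ : Finset (Fin 2)) (F := ![f, g])
    (by simpa using ⟨hf, hg⟩) ![1, -1]
  simpa [sub_eq_add_neg] using this

/-- The iterated operator `θ ^ j`. -/
noncomputable def thetaPow (j : ℕ) (f : ℂ → ℂ) : ℂ → ℂ := (List.replicate j 0).foldr eulerShift f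

lemma thetaPow_succ (j : ℕ) (f : ℂ → ℂ) (z : ℂ) :
    thetaPow (j + 1) f z = z * deriv (thetaPow j f) z := by
  rw [thetaPow, List.replicate_succ, List.foldr_cons, eulerShift, zero_mul, add_zero]
  rfl

/-- A product of factors `θ + a` is a monic polynomial in `θ`; its coefficients `d` are the same for
all `f`. -/
lemma foldr_eulerShift_eq (hU : IsOpen U) (l : List ℂ) :
    ∃ d : ℕ → ℂ, d l.length = 1 ∧ (∀ j, l.length < j → d j = 0) ∧
      ∀ f, DifferentiableOn ℂ f U → EqOn (l.foldr eulerShift f)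
        (fun z => ∑ j ∈ Finset.range (l.length + 1), d j * thetaPow j f z) U := by
  induction l with
  | nil =>
    refine ⟨fun j => if j = 0 then 1 else 0, by simp, fun j hj => if_neg hj.ne', fun f _ z _ => ?_⟩
    simp [thetaPow]
  | cons a l ih =>
    obtain ⟨d, h1, h2, h3⟩ := ih
    refine ⟨fun j => (if j = 0 then 0 else d (j - 1)) + a * d j, ?_, fun j hj => ?_,
      fun f hf z hz => ?_⟩
    · simp [h1, h2 (l.length + 1) (Nat.lt_succ_self _)]
    · rw [List.length_cons] at hj
      dsimp only
      rw [if_neg (by omega), h2 _ (by omega), h2 _ (by omega)]; simp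
    · rw [List.foldr_cons, eulerShift_congr hU (h3 f hf) a hz,
        eulerShift_sum hU _ (F := fun j => thetaPow j f)
          (fun j _ => differentiableOn_foldr_eulerShift hU hf _) d a hz,
        List.length_cons]
      simp only [add_mul, Finset.sum_add_distrib]
      rw [Finset.sum_range_succ' (n := l.length + 1), Finset.sum_range_succ (n := l.length + 1)
        (f := fun x => a * d x * thetaPow x f z), h2 _ (Nat.lt_succ_self _)]
      simp only [Nat.succ_ne_zero, if_false, Nat.add_sub_cancel, if_true, zero_mul, add_zero,
        mul_zero]
      rw [← Finset.sum_add_distrib]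
      refine Finset.sum_congr rfl fun j _ => ?_
      rw [thetaPow_succ, eulerShift]
      ring

lemma eulerProd_one_sub_one {n : ℕ} (f : ℂ → ℂ) :
    eulerProd (fun _ : Fin n => (1 : ℂ) - 1) f = thetaPow n f := by
  rw [eulerProd, thetaPow, List.ofFn_const, sub_self]

end Linearity

/-! ### Initial values determine solutions; independent solutions form a basis. -/

section Uniqueness

variable {n : ℕ} {α : Fin n → ℂ}

lemma ne_one_of_mem_cutDisc {r : ℝ} (hr : r ≤ 1) {z : ℂ} (hz : z ∈ cutDisc r) : 1 - z ≠ 0 := by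
  intro h
  have := norm_lt_of_mem_cutDisc hz
  rw [← sub_eq_zero.1 h, norm_one] at this
  linarith

lemma neg_half_mem_cutDisc {r : ℝ} (hr : 0 < r) : (-(r / 2 : ℝ) : ℂ) ∈ cutDisc r := by
  constructor
  · rw [mem_ball_zero_iff, norm_neg, norm_real, Real.norm_of_nonneg (by positivity)]
    linarith
  · rintro ⟨h, -⟩
    rw [neg_re, ofReal_re] at h
    linarith

/-- The slit disc is star-shaped with respect to negative points. -/
lemma segment_mem_cutDisc {r : ℝ} (hr : 0 < r) {z : ℂ} (hz : z ∈ cutDisc r) {t : ℝ}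
    (ht : t ∈ Icc (0 : ℝ) 1) :
    (-(r / 2 : ℝ) : ℂ) + t * (z - (-(r / 2 : ℝ) : ℂ)) ∈ cutDisc r := by
  have h0 := neg_half_mem_cutDisc hr
  refine ⟨?_, ?_⟩
  · have := (convex_ball (0 : ℂ) r).add_smul_sub_mem h0.1 hz.1 ht
    rwa [real_smul] at this
  · rintro ⟨h1, h2⟩
    simp at h1 h2
    have hz2 := hz.2
    rcases h2 with h2 | h2
    · rw [h2] at h1; linarith
    · have hzre : z.re < 0 := by
        by_contra hcon
        exact hz2 ⟨not_lt.1 hcon, h2⟩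
      rcases ht.1.eq_or_lt with h | h
      · rw [← h] at h1; linarith
      · nlinarith [mul_neg_of_pos_of_neg h hzre, ht.2]

/-- The equation solved for its top term: the leading coefficient is `z - 1`, nonzero on the slit
disc because `r ≤ 1`. -/
lemma IsSolution.thetaPow_eq {r : ℝ} (hr : r ≤ 1) :
    ∃ d : ℕ → ℂ, ∀ f, IsSolution α (fun _ => 1) (cutDisc r) f → ∀ z ∈ cutDisc r,
      thetaPow n f z = z / (1 - z) * ∑ j ∈ Finset.range n, d j * thetaPow j f z := by
  obtain ⟨d, h1, -, h3⟩ := foldr_eulerShift_eq (isOpen_cutDisc r) (List.ofFn α)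
  rw [List.length_ofFn] at h1 h3
  refine ⟨d, fun f hf z hz => ?_⟩
  have h4 := hf.2 z hz
  rw [eulerProd_one_sub_one, eulerProd, h3 f hf.1 hz] at h4
  dsimp only at h4
  rw [Finset.sum_range_succ, h1, one_mul] at h4
  have := ne_one_of_mem_cutDisc hr hz
  field_simp
  linear_combination -h4

/-- A solution whose first `n` iterated `θ`-derivatives vanish at a point is zero. -/
theorem IsSolution.eq_zero {r : ℝ} (hr0 : 0 < r) (hr : r ≤ 1) {f : ℂ → ℂ}
    (hf : IsSolution α (fun _ => 1) (cutDisc r) f) (hn : 0 < n)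
    (h0 : ∀ j < n, thetaPow j f (-(r / 2 : ℝ) : ℂ) = 0) : ∀ z ∈ cutDisc r, f z = 0 := by
  intro z hz
  obtain ⟨d, hd⟩ := IsSolution.thetaPow_eq (α := α) hr
  set z₀ : ℂ := (-(r / 2 : ℝ) : ℂ)
  set ζ : ℝ → ℂ := fun t => z₀ + t * (z - z₀) with hζ
  have hζc : Continuous ζ := by fun_prop
  have hζm : ∀ t ∈ Icc (0 : ℝ) 1, ζ t ∈ cutDisc r := fun t ht => segment_mem_cutDisc hr0 hz ht
  have hζ0 : ∀ t ∈ Icc (0 : ℝ) 1, ζ t ≠ 0 := fun t ht => ne_zero_of_mem_cutPlane (hζm t ht).2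
  have hζ1 : ∀ t ∈ Icc (0 : ℝ) 1, 1 - ζ t ≠ 0 := fun t ht => ne_one_of_mem_cutDisc hr (hζm t ht)
  have hζd : ∀ t, HasDerivAt ζ (z - z₀) t := fun t => by
    simpa [hζ] using ((hasDerivAt_id t).ofReal_comp.mul_const (z - z₀)).const_add z₀
  obtain ⟨A, hA⟩ := (isCompact_Icc (a := (0 : ℝ)) (b := 1)).exists_bound_of_continuousOn
    (f := fun t => (ζ t)⁻¹) (hζc.continuousOn.inv₀ hζ0)
  obtain ⟨B, hB⟩ := (isCompact_Icc (a := (0 : ℝ)) (b := 1)).exists_bound_of_continuousOn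
    (f := fun t => ζ t / (1 - ζ t))
    (hζc.continuousOn.div (continuous_const.sub hζc).continuousOn hζ1)
  have hA0 : 0 ≤ A := (norm_nonneg _).trans (hA 0 (by simp))
  have hB0 : 0 ≤ B := (norm_nonneg _).trans (hB 0 (by simp))
  set D := ∑ j ∈ Finset.range n, ‖d j‖
  -- The vector of `θ^j f`, `j < n`, along the segment from `z₀` to `z` satisfies a first-order
  -- linear system with bounded coefficients: the segment stays away from `0` and `1`.
  set Y : ℝ → Fin n → ℂ := fun t j => thetaPow j f (ζ t) with hY
  have hYd : ∀ t ∈ Icc (0 : ℝ) 1, HasDerivAt Y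
      (fun j => (ζ t)⁻¹ * thetaPow (j + 1) f (ζ t) * (z - z₀)) t := fun t ht => by
    refine hasDerivAt_pi.2 fun j => ?_
    have h1 : DifferentiableAt ℂ (thetaPow j f) (ζ t) :=
      (differentiableOn_foldr_eulerShift (isOpen_cutDisc r) hf.1 _).differentiableAt
        ((isOpen_cutDisc r).mem_nhds (hζm t ht))
    have h2 := h1.hasDerivAt.scomp t (hζd t)
    rw [thetaPow_succ, inv_mul_cancel_left₀ (hζ0 t ht), mul_comm]
    exact h2
  have hbound : ∀ t ∈ Icc (0 : ℝ) 1,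
      ‖(fun j : Fin n => (ζ t)⁻¹ * thetaPow (j + 1) f (ζ t) * (z - z₀))‖ ≤
        A * (1 + B * D) * ‖z - z₀‖ * ‖Y t‖ := fun t ht => by
    have hYj : ∀ j < n, ‖thetaPow j f (ζ t)‖ ≤ ‖Y t‖ := fun j hj => norm_le_pi_norm (Y t) ⟨j, hj⟩
    refine (pi_norm_le_iff_of_nonneg (by positivity)).2 fun j => ?_
    have key : ‖thetaPow (j + 1) f (ζ t)‖ ≤ (1 + B * D) * ‖Y t‖ := by
      by_cases hj : (j : ℕ) + 1 < n
      · refine (hYj _ hj).trans ?_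
        nlinarith [norm_nonneg (Y t), mul_nonneg (mul_nonneg hB0 (by positivity : 0 ≤ D))
          (norm_nonneg (Y t))]
      · have hj' : (j : ℕ) + 1 = n := by have := j.2; omega
        rw [hj', hd f hf _ (hζm t ht), norm_mul]
        have hsum : ‖∑ j ∈ Finset.range n, d j * thetaPow j f (ζ t)‖ ≤ D * ‖Y t‖ := by
          refine (norm_sum_le _ _).trans ?_
          rw [Finset.sum_mul]
          refine Finset.sum_le_sum fun i hi => ?_
          rw [norm_mul]
          gcongr
          exact hYj i (Finset.mem_range.1 hi)
        calc _ ≤ B * (D * ‖Y t‖) := mul_le_mul (hB t ht) hsum (norm_nonneg _) hB0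
          _ ≤ _ := by nlinarith [norm_nonneg (Y t)]
    rw [norm_mul, norm_mul]
    calc _ ≤ A * ((1 + B * D) * ‖Y t‖) * ‖z - z₀‖ := by
          gcongr
          exact hA t ht
      _ = _ := by ring
  -- Grönwall: `‖Y'‖ ≤ const · ‖Y‖` and `Y 0 = 0` force `Y = 0`.
  have hfin := eq_zero_of_abs_deriv_le_mul_abs_self_of_eq_zero_right (f := Y) (a := 0) (b := 1)
    (fun t ht => (hYd t ht).continuousAt.continuousWithinAt)
    (fun t ht => (hYd t (Ico_subset_Icc_self ht)).hasDerivWithinAt)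
    (by ext j; simpa [hY, hζ] using h0 j j.2)
    (fun t ht => hbound t (Ico_subset_Icc_self ht)) 1 (by simp)
  have := congrFun hfin ⟨0, hn⟩
  simpa [hY, hζ, thetaPow] using this

/-- Linearly independent solutions form a basis. -/
theorem isSolutionBasis_of_linearIndependent {r : ℝ} (hr0 : 0 < r) (hr : r ≤ 1) (hn : 0 < n)
    {F : Fin n → ℂ → ℂ} (hF : ∀ k, IsSolution α (fun _ => 1) (cutDisc r) (F k))
    (hind : ∀ c : Fin n → ℂ, (∀ z ∈ cutDisc r, ∑ k, c k * F k z = 0) → c = 0) :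
    IsSolutionBasis α (fun _ => 1) (cutDisc r) F := by
  refine ⟨hF, fun g hg => ?_⟩
  set z₀ : ℂ := (-(r / 2 : ℝ) : ℂ)
  have hz₀ : z₀ ∈ cutDisc r := neg_half_mem_cutDisc hr0
  have hU := isOpen_cutDisc r
  -- `M` sends coefficients to the initial values at `z₀` of the combination. It is injective by
  -- independence and the vanishing theorem, hence surjective by dimension, so every solution shares
  -- its initial values with a combination.
  let M : (Fin n → ℂ) →ₗ[ℂ] (Fin n → ℂ) :=
    { toFun := fun c j => ∑ k, c k * thetaPow j (F k) z₀
      map_add' := fun c d => by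
        ext j; simp only [Pi.add_apply, add_mul, Finset.sum_add_distrib]
      map_smul' := fun c d => by
        ext j
        simp only [Pi.smul_apply, smul_eq_mul, RingHom.id_apply, Finset.mul_sum, mul_assoc] }
  have hM : ∀ c : Fin n → ℂ, ∀ j : Fin n,
      thetaPow j (fun z => ∑ k, c k * F k z) z₀ = M c j := fun c j =>
    foldr_eulerShift_sum hU Finset.univ (fun k _ => (hF k).1) c _ hz₀
  have hinj : Function.Injective M := by
    refine (injective_iff_map_eq_zero M).2 fun c hc => hind c ?_
    refine (IsSolution.sum hU Finset.univ (fun k _ => hF k) c).eq_zero hr0 hr hn fun j hj => ?_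
    rw [hM c ⟨j, hj⟩, hc]; rfl
  obtain ⟨c, hc⟩ := (LinearMap.injective_iff_surjective.1 hinj) fun j => thetaPow j g z₀
  have hsum := IsSolution.sum hU Finset.univ (fun k _ => hF k) c
  have hgF : ∀ z ∈ cutDisc r, g z = ∑ k, c k * F k z := fun z hz => by
    refine sub_eq_zero.1 ((hg.sub hU hsum).eq_zero hr0 hr hn (fun j hj => ?_) z hz)
    have h2 := foldr_eulerShift_sum hU (Finset.univ : Finset (Fin 2))
      (F := ![g, fun z => ∑ k, c k * F k z]) (by simpa using ⟨hg.1, hsum.1⟩) ![1, -1]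
      (List.replicate j 0) hz₀
    simp only [Fin.sum_univ_two, Matrix.cons_val_zero, Matrix.cons_val_one, one_mul, neg_mul,
      ← sub_eq_add_neg] at h2
    have h3 := hM c ⟨j, hj⟩
    rw [hc] at h3
    exact h2.trans (sub_eq_zero.2 h3.symm)
  refine ⟨c, hgF, fun c' hc' => sub_eq_zero.1 (hind _ fun z hz => ?_)⟩
  simp only [Pi.sub_apply, sub_mul, Finset.sum_sub_distrib]
  rw [← hgF z hz, ← hc' z hz, sub_self]

end Uniqueness

/-! ### Independence of powers of the logarithm. -/

section LogIndependence

lemma exp_mem_cutPlane {w : ℂ} (h0 : 0 < w.im) (h1 : w.im < 2 * Real.pi) :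
    exp w ∈ cutPlane ∧ cutLog (exp w) = w := by
  have hneg : -exp w = exp (w - Real.pi * I) := by
    rw [exp_sub, exp_pi_mul_I, div_neg, div_one]
  have him : (w - Real.pi * I).im = w.im - Real.pi := by simp
  have hlog : log (-exp w) = w - Real.pi * I := by
    rw [hneg]
    exact log_exp (by rw [him]; linarith) (by rw [him]; linarith)
  refine ⟨?_, by rw [cutLog, hlog, sub_add_cancel]⟩
  rw [cutPlane_eq, mem_ofPred_eq, mem_slitPlane_iff_arg]
  refine ⟨?_, neg_ne_zero.2 (exp_ne_zero w)⟩
  rw [← log_im, hlog, him]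
  intro h
  linarith

/-- Powers of the logarithm are linearly independent over functions holomorphic on the disc. -/
theorem eq_zero_of_sum_mul_cutLog_pow {r : ℝ} (hr : 0 < r) {n : ℕ} {P : ℕ → ℂ → ℂ}
    (hP : ∀ l < n, DifferentiableOn ℂ (P l) (Metric.ball 0 r))
    (h : ∀ z ∈ cutDisc r, ∑ l ∈ Finset.range n, P l z * cutLog z ^ l = 0) :
    ∀ l < n, ∀ z ∈ Metric.ball (0 : ℂ) r, P l z = 0 := by
  set H : Set ℂ := {w | w.re < Real.log r}
  have hHo : IsOpen H := isOpen_lt continuous_re continuous_const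
  have hHexp : ∀ w ∈ H, exp w ∈ Metric.ball (0 : ℂ) r := fun w hw => by
    rw [mem_ball_zero_iff, norm_exp, ← Real.exp_log hr]
    exact Real.exp_lt_exp.2 hw
  set E : ℂ → ℂ := fun w => ∑ l ∈ Finset.range n, P l (exp w) * w ^ l
  have hE : DifferentiableOn ℂ E H := fun w hw => by
    refine DifferentiableWithinAt.fun_sum fun l hl => DifferentiableWithinAt.fun_mul ?_ (by fun_prop)
    exact DifferentiableAt.differentiableWithinAt (DifferentiableAt.comp w
      ((hP l (Finset.mem_range.1 hl)).differentiableAt (Metric.isOpen_ball.mem_nhds (hHexp w hw)))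
      differentiable_exp.differentiableAt)
  have hw₀ : ((Real.log r - 1 : ℝ) : ℂ) + Real.pi * I ∈ H := by
    simp [H]
  -- With `z = e^w`, the relation on the slit disc is one on the strip `0 < Im w < 2π`. The identity
  -- theorem extends it to the whole half-plane, that is, to all branches of the logarithm.
  have hE0 : EqOn E 0 H := by
    refine (hE.analyticOnNhd hHo).eqOn_zero_of_preconnected_of_eventuallyEq_zero
      (convex_halfSpace_re_lt _).isPreconnected hw₀ ?_
    have hstrip : {w : ℂ | 0 < w.im ∧ w.im < 2 * Real.pi} ∈
        𝓝 (((Real.log r - 1 : ℝ) : ℂ) + Real.pi * I) :=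
      ((isOpen_lt continuous_const continuous_im).inter
        (isOpen_lt continuous_im continuous_const)).mem_nhds (by
          simp [Real.pi_pos])
    filter_upwards [hstrip, hHo.mem_nhds hw₀] with w hw hwH
    obtain ⟨h1, h2⟩ := exp_mem_cutPlane hw.1 hw.2
    have := h (exp w) ⟨hHexp w hwH, h1⟩
    rwa [h2] at this
  have hne : ∀ z ∈ Metric.ball (0 : ℂ) r, z ≠ 0 → ∀ l < n, P l z = 0 := fun z hz hz0 l hl => by
    -- For fixed `z` all the values `log z + 2πik` are roots of this polynomial, so it vanishes.
    set p : Polynomial ℂ := ∑ l ∈ Finset.range n, Polynomial.C (P l z) * Polynomial.X ^ l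
    have hroot : ∀ k : ℕ, p.IsRoot (log z + k * (2 * Real.pi * I)) := fun k => by
      have hmem : log z + k * (2 * Real.pi * I) ∈ H := by
        have h1 : ‖z‖ < r := by simpa using hz
        have : (log z + k * (2 * Real.pi * I)).re = Real.log ‖z‖ := by simp [log_re]
        change (log z + k * (2 * Real.pi * I)).re < Real.log r
        rw [this]
        exact Real.log_lt_log (norm_pos_iff.2 hz0) h1
      have h2 := hE0 hmem
      have h3 : exp (log z + k * (2 * Real.pi * I)) = z := by
        rw [exp_add, exp_log hz0, exp_nat_mul_two_pi_mul_I, mul_one]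
      simp only [E, h3, Pi.zero_apply] at h2
      rw [Polynomial.IsRoot, Polynomial.eval_finsetSum]
      simpa using h2
    have hp0 : p = 0 := by
      refine Polynomial.eq_zero_of_infinite_isRoot p
        ((infinite_range_of_injective (f := fun k : ℕ => log z + k * (2 * Real.pi * I)) ?_).mono ?_)
      · intro a b hab
        simpa [Real.pi_ne_zero] using hab
      · rintro _ ⟨k, rfl⟩
        exact hroot k
    have := congrArg (fun q => Polynomial.coeff q l) hp0
    simpa [p, Polynomial.finsetSum_coeff, Polynomial.coeff_C_mul, Polynomial.coeff_X_pow,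
      Finset.sum_ite_eq, hl] using this
  intro l hl z hz
  by_cases hz0 : z = 0
  · subst hz0
    have hc : Tendsto (P l) (𝓝[≠] 0) (𝓝 (P l 0)) :=
      ((hP l hl).differentiableAt (Metric.isOpen_ball.mem_nhds hz)).continuousAt.tendsto.mono_left
        nhdsWithin_le_nhds
    refine tendsto_nhds_unique hc (tendsto_const_nhds.congr' ?_)
    filter_upwards [self_mem_nhdsWithin,
      mem_nhdsWithin_of_mem_nhds (Metric.isOpen_ball.mem_nhds hz)] with w hw0 hw
    exact (hne w hw hw0 l hl).symm
  · exact hne z hz hz0 l hl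

end LogIndependence

/-! ### Frobenius families: independence, basis property and uniqueness. -/

section FrobeniusUnique

variable {n : ℕ} {α : Fin n → ℂ} {r : ℝ}

/-- The coefficient of `logˡ` in `∑ cₖ fₖ`. -/
noncomputable def logCoeff (n : ℕ) (h : ℕ → ℂ → ℂ) (c : ℕ → ℂ) (l : ℕ) (z : ℂ) : ℂ :=
  ∑ k ∈ Finset.range n, if l ≤ k then
    c k * ((h (k - l) z + if l = k then 1 else 0) / (l.factorial : ℂ)) else 0

lemma sum_mul_frobeniusFun (h : ℕ → ℂ → ℂ) (c : ℕ → ℂ) (z : ℂ) :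
    ∑ k ∈ Finset.range n, c k * frobeniusFun h k z =
      ∑ l ∈ Finset.range n, logCoeff n h c l z * cutLog z ^ l := by
  simp only [logCoeff, Finset.sum_mul]
  rw [Finset.sum_comm]
  refine Finset.sum_congr rfl fun k hk => ?_
  have hkn := Finset.mem_range.1 hk
  rw [← Finset.sum_subset (Finset.range_subset_range.2 (Nat.succ_le_of_lt hkn)) fun l _ hl => by
    rw [if_neg (by simpa using hl), zero_mul]]
  rw [Finset.sum_range_succ, frobeniusFun, add_comm, mul_add, Finset.mul_sum]
  congr 1
  · refine Finset.sum_congr rfl fun l hl => ?_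
    have := Finset.mem_range.1 hl
    rw [if_pos this.le, if_neg this.ne]
    ring
  · rw [if_pos le_rfl, if_pos rfl, Nat.sub_self]
    ring

lemma differentiableOn_logCoeff {h : ℕ → ℂ → ℂ}
    (hh : ∀ l < n, AnalyticOnNhd ℂ (h l) (Metric.ball 0 r)) (c : ℕ → ℂ) (l : ℕ) :
    DifferentiableOn ℂ (logCoeff n h c l) (Metric.ball 0 r) := by
  refine DifferentiableOn.fun_sum fun k hk => ?_
  split_ifs with hlk
  all_goals first
    | exact differentiableOn_const _
    | exact (((hh _ ((Nat.sub_le k l).trans_lt (Finset.mem_range.1 hk))).differentiableOn.add_const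
        _).div_const _).const_mul _

lemma logCoeff_zero {h : ℕ → ℂ → ℂ} (hh : ∀ l < n, h l 0 = 0) (c : ℕ → ℂ) {l : ℕ} (hl : l < n) :
    logCoeff n h c l 0 = c l / (l.factorial : ℂ) := by
  rw [logCoeff, Finset.sum_eq_single l]
  · simp [hh 0 (by omega), div_eq_mul_inv]
  · intro k hk hkl
    have := Finset.mem_range.1 hk
    rw [hh _ (by omega), if_neg (Ne.symm hkl)]
    simp
  · intro h; exact absurd (Finset.mem_range.2 hl) h

lemma IsFrobenius.mono {r' : ℝ} {h : ℕ → ℂ → ℂ} (hr : r ≤ r') (hh : IsFrobenius α r' h) :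
    IsFrobenius α r h := fun l hl =>
  ⟨(hh l hl).1.mono (Metric.ball_subset_ball hr), (hh l hl).2.1,
    (hh l hl).2.2.mono (cutDisc_mono hr)⟩

/-- Each coefficient of `log^k` vanishes on the disc, and at `z = 0`, where every `h` is zero, it
equals `c k / k!`. -/
lemma IsFrobenius.eq_zero {h : ℕ → ℂ → ℂ} (hr : 0 < r) (hh : IsFrobenius α r h) {c : ℕ → ℂ}
    (hc : ∀ z ∈ cutDisc r, ∑ k ∈ Finset.range n, c k * frobeniusFun h k z = 0) :
    ∀ k < n, c k = 0 := fun k hk => by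
  have := eq_zero_of_sum_mul_cutLog_pow hr
    (fun l _ => differentiableOn_logCoeff (fun l hl => (hh l hl).1) c l)
    (fun z hz => by rw [← sum_mul_frobeniusFun]; exact hc z hz) k hk 0 (Metric.mem_ball_self hr)
  rw [logCoeff_zero (fun l hl => (hh l hl).2.1) c hk] at this
  have hk0 : ((k.factorial : ℕ) : ℂ) ≠ 0 := by exact_mod_cast k.factorial_ne_zero
  exact (div_eq_zero_iff.1 this).resolve_right hk0

lemma two_pi_I_pow_ne_zero (k : ℕ) : (2 * Real.pi * I : ℂ) ^ k ≠ 0 :=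
  pow_ne_zero _ two_pi_I_ne_zero

lemma sum_frobeniusFamily (h : ℕ → ℂ → ℂ) (c : Fin n → ℂ) (z : ℂ) :
    ∑ l, c l * frobeniusFamily h l z = ∑ k ∈ Finset.range n,
      (if hk : k < n then c (Fin.rev ⟨k, hk⟩) / (2 * Real.pi * I) ^ k else 0) *
        frobeniusFun h k z := by
  rw [← Fin.sum_univ_eq_sum_range (fun k =>
    (if hk : k < n then c (Fin.rev ⟨k, hk⟩) / (2 * Real.pi * I) ^ k else 0) * frobeniusFun h k z) n,
    ← Equiv.sum_comp Fin.revPerm]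
  refine Finset.sum_congr rfl fun k _ => ?_
  have hk : n - 1 - (Fin.rev k : ℕ) = k := by rw [Fin.val_rev]; omega
  rw [dif_pos k.2, Fin.revPerm_apply, frobeniusFamily, hk]
  ring

lemma IsFrobenius.linearIndependent {h : ℕ → ℂ → ℂ} (hr : 0 < r) (hh : IsFrobenius α r h)
    (c : Fin n → ℂ) (hc : ∀ z ∈ cutDisc r, ∑ k, c k * frobeniusFamily h k z = 0) : c = 0 := by
  simp only [sum_frobeniusFamily] at hc
  ext l
  have := hh.eq_zero hr hc (Fin.rev l) (Fin.rev l).2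
  rw [dif_pos (Fin.rev l).2, Fin.eta, Fin.rev_rev] at this
  exact (div_eq_zero_iff.1 this).resolve_right (two_pi_I_pow_ne_zero _)

/-- The Frobenius family is a basis of the solution space. -/
theorem IsFrobenius.isSolutionBasis {h : ℕ → ℂ → ℂ} (hr0 : 0 < r) (hr : r ≤ 1) (hn : 0 < n)
    (hh : IsFrobenius α r h) : IsSolutionBasis α (fun _ => 1) (cutDisc r) (frobeniusFamily h) := by
  refine isSolutionBasis_of_linearIndependent hr0 hr hn (fun k => ?_) (hh.linearIndependent hr0)
  have := IsSolution.sum (isOpen_cutDisc r) {n - 1 - (k : ℕ)} (F := fun k => frobeniusFun h k)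
    (fun j hj => (hh j (by rw [Finset.mem_singleton.1 hj]; omega)).2.2)
    fun j => ((2 * Real.pi * I) ^ j)⁻¹
  refine this.congr (isOpen_cutDisc r) fun z _ => ?_
  rw [Finset.sum_singleton, frobeniusFamily, inv_mul_eq_div]

/-- The functions of a Frobenius basis are unique. -/
theorem IsFrobenius.eqOn {h h' : ℕ → ℂ → ℂ} (hr0 : 0 < r) (hr : r ≤ 1)
    (hh : IsFrobenius α r h) (hh' : IsFrobenius α r h') {j : ℕ} (hj : j < n) :
    EqOn (h' j) (h j) (Metric.ball 0 r) := by
  have hn : 0 < n := by omega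
  obtain ⟨c, hc, -⟩ := (hh.isSolutionBasis hr0 hr hn).2 _ (hh' j hj).2.2
  simp only [sum_frobeniusFamily] at hc
  set b : ℕ → ℂ := fun k =>
    if hk : k < n then c (Fin.rev ⟨k, hk⟩) / (2 * Real.pi * I) ^ k else 0
  set d : ℕ → ℂ := fun k => if k = j then 1 else 0
  have hA : ∀ l < n, AnalyticOnNhd ℂ (h l) (Metric.ball 0 r) := fun l hl => (hh l hl).1
  have hA' : ∀ l < n, AnalyticOnNhd ℂ (h' l) (Metric.ball 0 r) := fun l hl => (hh' l hl).1
  -- The `j`-th function of `h'` is expanded in the family of `h`, and coefficients of powers of the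
  -- logarithm are compared. At `z = 0` this forces `b = d`; the coefficient of `log^0` then says
  -- that `h' j` and `h j` agree.
  have key := eq_zero_of_sum_mul_cutLog_pow (n := n) hr0
    (P := fun l z => logCoeff n h' d l z - logCoeff n h b l z)
    (fun l _ => (differentiableOn_logCoeff hA' d l).sub (differentiableOn_logCoeff hA b l))
    (fun z hz => by
      simp only [sub_mul, Finset.sum_sub_distrib]
      rw [← sum_mul_frobeniusFun, ← sum_mul_frobeniusFun, ← hc z hz, sub_eq_zero]
      simp [d, Finset.sum_ite_eq', hj])
  have hbd : ∀ l < n, b l = d l := fun l hl => by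
    have h0 := key l hl 0 (Metric.mem_ball_self hr0)
    rw [logCoeff_zero (fun l hl => (hh' l hl).2.1) d hl,
      logCoeff_zero (fun l hl => (hh l hl).2.1) b hl] at h0
    have hl0 : ((l.factorial : ℕ) : ℂ) ≠ 0 := by exact_mod_cast l.factorial_ne_zero
    field_simp at h0
    rw [mul_zero] at h0
    exact (sub_eq_zero.1 h0).symm
  have hval : ∀ (g : ℕ → ℂ → ℂ) (z : ℂ), logCoeff n g d 0 z = g j z + if 0 = j then 1 else 0 :=
    fun g z => by
      rw [logCoeff, Finset.sum_eq_single j (fun k _ hk => by simp [d, hk])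
        (fun h => absurd (Finset.mem_range.2 hj) h)]
      simp [d]
  intro z hz
  have h1 := key 0 hn z hz
  have h2 : logCoeff n h b 0 z = logCoeff n h d 0 z :=
    Finset.sum_congr rfl fun k hk => by rw [hbd k (Finset.mem_range.1 hk)]
  rw [h2, hval, hval] at h1
  linear_combination h1

end FrobeniusUnique

/-! ### Exponential decay of the Mellin–Barnes integrand. -/

section Decay

lemma integrable_of_exp_decay {g : ℝ → ℂ} (hg : Continuous g) {C c R : ℝ} (hc : 0 < c)
    (h : ∀ t, R ≤ |t| → ‖g t‖ ≤ C * Real.exp (-(c * |t|))) : Integrable g := by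
  refine hg.locallyIntegrable.integrable_of_isBigO_atBot_atTop
    (g := fun t => Real.exp (c * t)) (g' := fun t => Real.exp (-c * t)) ?_
    ⟨Iic 0, Iic_mem_atBot 0, integrableOn_exp_mul_Iic hc 0⟩ ?_
    ⟨Ioi 0, Ioi_mem_atTop 0, exp_neg_integrableOn_Ioi 0 hc⟩
  · refine Asymptotics.IsBigO.of_bound C ?_
    filter_upwards [eventually_le_atBot (-R), eventually_le_atBot 0] with t h1 h2
    rw [Real.norm_of_nonneg (Real.exp_pos _).le]
    refine (h t (by rw [abs_of_nonpos h2]; linarith)).trans_eq ?_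
    rw [abs_of_nonpos h2]; ring_nf
  · refine Asymptotics.IsBigO.of_bound C ?_
    filter_upwards [eventually_ge_atTop R, eventually_ge_atTop 0] with t h1 h2
    rw [Real.norm_of_nonneg (Real.exp_pos _).le]
    refine (h t (by rwa [abs_of_nonneg h2])).trans_eq ?_
    rw [abs_of_nonneg h2]; ring_nf

lemma exists_norm_Gamma_add_le (a : ℂ) (A B : ℝ) {δ : ℝ} (hδ : 0 < δ) (hδ' : δ ≤ Real.pi / 2) :
    ∃ C : ℝ, 0 < C ∧ ∀ s : ℂ, A ≤ s.re → s.re ≤ B → 1 + ‖a‖ ≤ |s.im| →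
      ‖Gamma (a + s)‖ ≤ C * Real.exp (-((Real.pi / 2 - δ) * |s.im|)) := by
  obtain ⟨C, hC, h⟩ := exists_norm_Gamma_le (a.re + A) (a.re + B) hδ
  refine ⟨C * Real.exp ((Real.pi / 2 - δ) * ‖a‖), by positivity, fun s hA hB him => ?_⟩
  have h1 : |s.im| - ‖a‖ ≤ |(a + s).im| := by
    have h2 := abs_sub_abs_le_abs_sub s.im (-a.im)
    have h3 := abs_im_le_norm a
    rw [abs_neg, sub_neg_eq_add] at h2
    rw [add_im, add_comm]
    linarith
  refine (h (a + s) (by rw [add_re]; linarith) (by rw [add_re]; linarith) (by linarith)).trans ?_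
  rw [mul_assoc, ← Real.exp_add]
  gcongr
  nlinarith

variable {n : ℕ}

/-- Exponential decay of the Mellin–Barnes integrand in vertical strips. -/
theorem exists_norm_mbIntegrand_le (α : Fin n → ℂ) (j : Fin n) {z : ℂ} (hz : z ∈ cutPlane)
    (A B : ℝ) : ∃ C c R : ℝ, 0 < c ∧ ∀ s : ℂ, A ≤ s.re → s.re ≤ B → R ≤ |s.im| →
      ‖mbIntegrand α (fun _ => 1) j z s‖ ≤ C * Real.exp (-(c * |s.im|)) := by
  have hpi := Real.pi_pos
  have hn0 : (0 : ℝ) < n := by exact_mod_cast (Nat.zero_le _).trans_lt j.2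
  have hθ := cutLog_im_mem hz
  set θ := (cutLog z).im
  set x := (cutLog z).re
  set κ := |(2 * (j : ℕ) - n : ℝ) * Real.pi + θ|
  -- Here `0 < θ < 2π` and `0 ≤ j ≤ n - 1` place `(2j - n)π + θ` strictly between `-nπ` and `nπ`.
  -- The exponentials thus grow more slowly than the `2n` Gamma factors together decay.
  have hκ : κ < n * Real.pi := by
    have h1 : ((j : ℕ) : ℝ) + 1 ≤ n := by exact_mod_cast j.2
    have h0 : (0 : ℝ) ≤ ((j : ℕ) : ℝ) := Nat.cast_nonneg _
    obtain ⟨h2, h3⟩ := hθ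
    rw [abs_lt]
    constructor <;> nlinarith
  set c := (n * Real.pi - κ) / 2 with hc
  have hc0 : 0 < c := by simp only [c]; linarith
  -- Each of the `2n` Gamma factors loses `δ` in its rate. The total loss is at most `c`, half of
  -- the available gap `nπ - κ`.
  set δ := min (Real.pi / 2) (c / (2 * n)) with hδ
  have hδ0 : 0 < δ := lt_min (by positivity) (by positivity)
  have hδ1 : δ ≤ Real.pi / 2 := min_le_left _ _
  have hδ2 : 2 * n * δ ≤ c := by
    have : δ ≤ c / (2 * n) := min_le_right _ _
    rw [le_div_iff₀ (by positivity)] at this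
    linarith
  choose C hC0 hC using fun k => exists_norm_Gamma_add_le (α k) A B hδ0 hδ1
  obtain ⟨C', hC'0, hC'⟩ := exists_norm_Gamma_le (-B) (-A) hδ0
  refine ⟨(∏ k, (C k * C')) * Real.exp (|x| * max |A| |B|), c, 1 + ∑ k, ‖α k‖, hc0,
    fun s hA hB him => ?_⟩
  set t := |s.im| with ht
  have ht0 : 0 ≤ t := abs_nonneg _
  have hG : ‖∏ k, Gamma (α k + s) * Gamma (1 - 1 - s)‖ ≤
      (∏ k, (C k * C')) * Real.exp (-(n * (Real.pi - 2 * δ) * t)) := by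
    rw [norm_prod]
    have : (∏ k, (C k * C')) * Real.exp (-(n * (Real.pi - 2 * δ) * t)) =
        ∏ k, (C k * C' * Real.exp (-((Real.pi - 2 * δ) * t))) := by
      symm
      rw [Finset.prod_mul_distrib, Finset.prod_const, Finset.card_univ, Fintype.card_fin,
        ← Real.exp_nat_mul]
      congr 2
      ring
    rw [this]
    refine Finset.prod_le_prod (fun _ _ => norm_nonneg _) fun k _ => ?_
    have hk : ‖α k‖ ≤ ∑ k, ‖α k‖ :=
      Finset.single_le_sum (f := fun k => ‖α k‖) (fun _ _ => norm_nonneg _) (Finset.mem_univ k)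
    have h1 := hC k s hA hB (by linarith)
    rw [← ht] at h1
    have hsum : 0 ≤ ∑ k, ‖α k‖ := by positivity
    have h2 := hC' (1 - 1 - s) (by simp; linarith) (by simp; linarith)
      (by rw [sub_self, zero_sub, neg_im, abs_neg]; linarith)
    rw [show |(1 - 1 - s).im| = t by rw [sub_self, zero_sub, neg_im, abs_neg]] at h2
    rw [norm_mul]
    refine (mul_le_mul h1 h2 (norm_nonneg _) (by have := hC0 k; positivity)).trans_eq ?_
    rw [mul_mul_mul_comm, ← Real.exp_add]
    ring_nf
  have hE : ‖exp ((2 * ((j : ℕ) : ℂ) - (n : ℂ)) * Real.pi * I * s) * exp (s * cutLog z)‖ ≤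
      Real.exp (|x| * max |A| |B|) * Real.exp (κ * t) := by
    rw [← exp_add, norm_exp, ← Real.exp_add]
    refine Real.exp_le_exp.2 ?_
    have h1 : ((2 * ((j : ℕ) : ℂ) - (n : ℂ)) * Real.pi * I * s + s * cutLog z).re =
        x * s.re - ((2 * (j : ℕ) - n : ℝ) * Real.pi + θ) * s.im := by
      simp [x, θ]; ring
    rw [h1]
    have h2 : x * s.re ≤ |x| * max |A| |B| := by
      refine (le_abs_self _).trans ?_
      rw [abs_mul]
      gcongr
      exact abs_le_max_abs_abs hA hB
    have h3 : -(((2 * (j : ℕ) - n : ℝ) * Real.pi + θ) * s.im) ≤ κ * t := by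
      rw [ht, ← abs_mul]
      exact neg_le_abs _
    linarith
  rw [mbIntegrand, mul_assoc, norm_mul]
  refine (mul_le_mul hG hE (norm_nonneg _) (by
    have : 0 ≤ ∏ k, (C k * C') := Finset.prod_nonneg fun k _ => (mul_pos (hC0 k) hC'0).le
    positivity)).trans ?_
  rw [mul_mul_mul_comm, ← Real.exp_add]
  have : 0 ≤ ∏ k, (C k * C') := Finset.prod_nonneg fun k _ => (mul_pos (hC0 k) hC'0).le
  gcongr
  have : 2 * n * δ * t ≤ c * t := mul_le_mul_of_nonneg_right hδ2 ht0
  have h2c : 2 * c = n * Real.pi - κ := by simp only [c]; ring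
  nlinarith

lemma tendsto_mbIntegrand_stripEnds (α : Fin n → ℂ) (j : Fin n) {z : ℂ} (hz : z ∈ cutPlane)
    (b : ℝ) : Tendsto (mbIntegrand α (fun _ => 1) j z) (stripEnds b) (𝓝 0) := by
  obtain ⟨C, c, R, hc, h⟩ := exists_norm_mbIntegrand_le α j hz 0 b
  have him : Tendsto (fun s : ℂ => |s.im|) (stripEnds b) atTop :=
    tendsto_comap.mono_left inf_le_left
  have hexp : Tendsto (fun s : ℂ => C * Real.exp (-(c * |s.im|))) (stripEnds b) (𝓝 (C * 0)) :=
    (Real.tendsto_exp_neg_atTop_nhds_zero.comp (him.const_mul_atTop hc)).const_mul C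
  rw [mul_zero] at hexp
  refine squeeze_zero_norm' ?_ hexp
  have hmem : ∀ᶠ s in stripEnds b, 0 ≤ s.re ∧ s.re ≤ b := mem_inf_of_right (mem_principal_self _)
  filter_upwards [hmem, him.eventually (eventually_ge_atTop R)] with s hs1 hs2
  exact h s hs1.1 hs1.2 hs2

end Decay

/-! ### Poles of the integrand and its recursion under `s ↦ s + 1`. -/

section Poles

lemma analyticAt_Gamma {s : ℂ} (hs : ∀ m : ℕ, s ≠ -m) : AnalyticAt ℂ Gamma s := by
  have h := ((differentiable_one_div_Gamma.analyticAt s).inv (inv_ne_zero (Gamma_ne_zero hs)))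
  exact h.congr (Eventually.of_forall fun w => by simp)

/-- Poles of `Γ` are at most simple. The relation `Γ(s) = Γ(s + 1)/s` transports the claim leftwards
from the right half-plane; a new pole appears only at `0`, elsewhere the division by `s` is
harmless. -/
lemma exists_Gamma_eq_div (p : ℂ) :
    ∃ u : ℂ → ℂ, AnalyticAt ℂ u p ∧ ∀ᶠ s in 𝓝[≠] p, Gamma s = u s / (s - p) := by
  have main : ∀ (M : ℕ) (p : ℂ), -(M : ℝ) < p.re →
      ∃ u : ℂ → ℂ, AnalyticAt ℂ u p ∧ ∀ᶠ s in 𝓝[≠] p, Gamma s = u s / (s - p) := by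
    have hpos : ∀ p : ℂ, 0 < p.re → AnalyticAt ℂ Gamma p := fun p hp =>
      analyticAt_Gamma fun m h => by
        have := congrArg re h
        simp at this
        have h2 : (0 : ℝ) ≤ m := m.cast_nonneg
        linarith
    intro M
    induction M with
    | zero =>
      intro p hp
      refine ⟨fun s => (s - p) * Gamma s, by
        have := hpos p (by simpa using hp)
        fun_prop, ?_⟩
      filter_upwards [self_mem_nhdsWithin] with s hs
      rw [mul_div_cancel_left₀ _ (sub_ne_zero.2 hs)]
    | succ M ih =>
      intro p hp
      by_cases hp0 : p = 0
      · subst hp0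
        refine ⟨fun s => Gamma (s + 1), ?_, ?_⟩
        · exact (hpos _ (by simp)).comp (f := fun s : ℂ => s + 1) (by fun_prop)
        · filter_upwards [self_mem_nhdsWithin] with s hs
          have hs' : s ≠ 0 := hs
          rw [sub_zero, Gamma_add_one s hs', mul_div_cancel_left₀ _ hs']
      · obtain ⟨u, hu, hue⟩ := ih (p + 1) (by
          push_cast at hp
          rw [add_re, one_re]; linarith)
        refine ⟨fun s => u (s + 1) / s, ?_, ?_⟩
        · exact (hu.comp (f := fun s : ℂ => s + 1) (by fun_prop)).div analyticAt_id hp0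
        · have ht : Tendsto (fun s : ℂ => s + 1) (𝓝[≠] p) (𝓝[≠] (p + 1)) := by
            refine tendsto_nhdsWithin_iff.2 ⟨?_, ?_⟩
            · exact (Continuous.tendsto (by fun_prop) p).mono_left nhdsWithin_le_nhds
            · filter_upwards [self_mem_nhdsWithin] with s hs
              simpa using hs
          filter_upwards [ht.eventually hue, mem_nhdsWithin_of_mem_nhds
            (isOpen_ne.mem_nhds hp0)] with s h1 h2
          have h2' : s ≠ 0 := h2
          rw [Gamma_add_one s h2', add_sub_add_right_eq_sub] at h1
          rw [div_right_comm, ← h1, mul_div_cancel_left₀ _ h2']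
  obtain ⟨M, hM⟩ := exists_nat_gt (-p.re)
  exact main M p (by linarith)

variable {n : ℕ} {α : Fin n → ℂ}

lemma differentiableAt_mbIntegrand {j : Fin n} {z s : ℂ} (h1 : ∀ (k : Fin n) (m : ℕ), α k + s ≠ -m)
    (h2 : ∀ m : ℕ, s ≠ m) : DifferentiableAt ℂ (mbIntegrand α (fun _ => 1) j z) s := by
  unfold mbIntegrand
  refine DifferentiableAt.fun_mul (DifferentiableAt.fun_mul (DifferentiableAt.fun_finsetProd
    fun k _ => DifferentiableAt.fun_mul ?_ ?_) (by fun_prop)) (by fun_prop)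
  · exact DifferentiableAt.comp (g := Gamma) s (differentiableAt_Gamma _ (h1 k)) (by fun_prop)
  · refine DifferentiableAt.comp (g := Gamma) s (differentiableAt_Gamma _ fun m h => h2 m ?_)
      (by fun_prop)
    linear_combination -h

/-- Poles of the integrand off the nonnegative integers have order at most `n`. -/
lemma exists_mbIntegrand_eq_div (j : Fin n) (z : ℂ) {p : ℂ} (hp : ∀ m : ℕ, p ≠ m) :
    ∃ g : ℂ → ℂ, AnalyticAt ℂ g p ∧
      ∀ᶠ s in 𝓝[≠] p, mbIntegrand α (fun _ => 1) j z s = g s / (s - p) ^ n := by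
  choose u hu hue using fun k => exists_Gamma_eq_div (α k + p)
  have hG : AnalyticAt ℂ (fun s => Gamma (1 - 1 - s)) p :=
    AnalyticAt.comp (g := Gamma) (analyticAt_Gamma fun m h => hp m (by linear_combination -h))
      (by fun_prop)
  have hu' : ∀ k, AnalyticAt ℂ (fun s => u k (α k + s)) p := fun k =>
    (hu k).comp (f := fun s => α k + s) (by fun_prop)
  refine ⟨fun s => (∏ k, u k (α k + s) * Gamma (1 - 1 - s)) *
      exp ((2 * ((j : ℕ) : ℂ) - (n : ℂ)) * Real.pi * I * s) * exp (s * cutLog z), ?_, ?_⟩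
  · refine ((Finset.analyticAt_fun_prod _ fun k _ => (hu' k).fun_mul hG).fun_mul ?_).fun_mul ?_
    · fun_prop
    · fun_prop
  · have hev : ∀ᶠ s in 𝓝[≠] p, ∀ k, Gamma (α k + s) = u k (α k + s) / (s - p) := by
      refine eventually_all.2 fun k => ?_
      have ht : Tendsto (fun s : ℂ => α k + s) (𝓝[≠] p) (𝓝[≠] (α k + p)) := by
        refine tendsto_nhdsWithin_iff.2 ⟨?_, ?_⟩
        · exact (Continuous.tendsto (by fun_prop) p).mono_left nhdsWithin_le_nhds
        · filter_upwards [self_mem_nhdsWithin] with s hs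
          simpa using hs
      filter_upwards [ht.eventually (hue k)] with s hs
      rw [hs, add_sub_add_left_eq_sub]
    filter_upwards [hev] with s hs
    rw [mbIntegrand, Finset.prod_congr rfl fun k _ => by rw [hs k, div_mul_eq_mul_div],
      Finset.prod_div_distrib, Finset.prod_const, Finset.card_univ, Fintype.card_fin]
    ring

/-- The `n` factors `Γ(-s)` yield a sign `(-1)^n`, which cancels against `e^{(2j-n)πi} = (-1)^n`.
The remaining quotient is the ratio of consecutive Frobenius coefficients. -/
lemma mbIntegrand_add_one {j : Fin n} {z s : ℂ} (hz : z ∈ cutPlane) (h1 : ∀ k, α k + s ≠ 0)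
    (h2 : s + 1 ≠ 0) : mbIntegrand α (fun _ => 1) j z (s + 1) =
      mbIntegrand α (fun _ => 1) j z s * z * ∏ k, (α k + s) / (1 + s) := by
  have hfac : ∀ k, Gamma (α k + (s + 1)) * Gamma (1 - 1 - (s + 1)) =
      Gamma (α k + s) * Gamma (1 - 1 - s) * (-1 * ((α k + s) / (1 + s))) := fun k => by
    have e1 := Gamma_add_one (α k + s) (h1 k)
    have e2 := Gamma_add_one (1 - 1 - (s + 1)) (fun h => h2 (by linear_combination -h))
    rw [show (1 : ℂ) - 1 - (s + 1) + 1 = 1 - 1 - s by ring] at e2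
    rw [← add_assoc, e1, e2]
    have h2' : 1 + s ≠ 0 := by rwa [add_comm]
    field_simp
    ring
  have hexp : exp ((2 * ((j : ℕ) : ℂ) - (n : ℂ)) * Real.pi * I * (s + 1)) =
      exp ((2 * ((j : ℕ) : ℂ) - (n : ℂ)) * Real.pi * I * s) * (-1) ^ n := by
    have e : (2 * ((j : ℕ) : ℂ) - (n : ℂ)) * Real.pi * I * (s + 1) =
        (2 * ((j : ℕ) : ℂ) - (n : ℂ)) * Real.pi * I * s + ((j : ℕ) : ℂ) * (2 * Real.pi * I)
          - (n : ℂ) * (Real.pi * I) := by ring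
    rw [e, exp_sub, exp_add, exp_nat_mul_two_pi_mul_I, mul_one, exp_nat_mul, exp_pi_mul_I]
    rcases neg_one_pow_eq_or ℂ n with h | h <;> rw [h] <;> simp [div_neg]
  have hL : exp ((s + 1) * cutLog z) = exp (s * cutLog z) * z := by
    rw [add_mul, one_mul, exp_add, exp_cutLog hz]
  have hsq : ((-1 : ℂ) ^ n) * (-1) ^ n = 1 := by rw [← mul_pow]; simp
  have hprod : ∏ k, Gamma (α k + (s + 1)) * Gamma (1 - 1 - (s + 1)) =
      (∏ k, Gamma (α k + s) * Gamma (1 - 1 - s)) * ((-1) ^ n * ∏ k, (α k + s) / (1 + s)) := by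
    rw [Finset.prod_congr rfl fun k _ => hfac k, Finset.prod_mul_distrib]
    congr 1
    rw [Finset.prod_mul_distrib, Finset.prod_const, Finset.card_univ, Fintype.card_fin]
  rw [mbIntegrand, mbIntegrand, hprod, hexp, hL]
  linear_combination (∏ k, Gamma (α k + s) * Gamma (1 - 1 - s)) *
    exp ((2 * ((j : ℕ) : ℂ) - (n : ℂ)) * Real.pi * I * s) * exp (s * cutLog z) * z *
    (∏ k, (α k + s) / (1 + s)) * hsq

lemma mbIntegrand_add_nat {j : Fin n} {z s : ℂ} (hz : z ∈ cutPlane) (m : ℕ)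
    (h1 : ∀ i < m, ∀ k, α k + (s + i) ≠ 0) (h2 : ∀ i < m, s + i + 1 ≠ 0) :
    mbIntegrand α (fun _ => 1) j z (s + m) =
      mbIntegrand α (fun _ => 1) j z s * z ^ m * hyperCoeff α m s := by
  induction m with
  | zero => simp [hyperCoeff]
  | succ m ih =>
    rw [Nat.cast_succ, ← add_assoc, mbIntegrand_add_one hz (h1 m (Nat.lt_succ_self m))
      (h2 m (Nat.lt_succ_self m)), ih (fun i hi => h1 i (by omega)) (fun i hi => h2 i (by omega)),
      hyperCoeff_succ]
    have : ∀ k, (α k + (s + m)) / (1 + (s + m)) = (m + α k + s) / (m + 1 + s) := fun k => by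
      congr 1 <;> ring
    simp only [this]
    ring

/-- The function `φ(s) exp ((2 j - n) π i s)`. -/
noncomputable def phiTwist (α : Fin n → ℂ) (j : ℕ) (s : ℂ) : ℂ :=
  exp (s * ((2 * (j : ℂ) - (n : ℂ)) * Real.pi * I)) * phi α s

lemma prod_Gamma_ne_zero (hα : ∀ (k : Fin n) (m : ℤ), α k ≠ m) : ∏ k, Gamma (α k) ≠ 0 :=
  Finset.prod_ne_zero_iff.2 fun k _ => Gamma_ne_zero fun m h => hα k (-m) (by rw [h]; simp)

lemma analyticAt_phi (hα : ∀ (k : Fin n) (m : ℤ), α k ≠ m) : AnalyticAt ℂ (phi α) 0 := by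
  unfold phi
  refine AnalyticAt.fun_mul (AnalyticAt.fun_div (Finset.analyticAt_fun_prod _ fun k _ => ?_)
    analyticAt_const (prod_Gamma_ne_zero hα)) (AnalyticAt.fun_pow ?_ n)
  · refine AnalyticAt.comp (g := Gamma) (analyticAt_Gamma fun m h => hα k (-m) ?_) (by fun_prop)
    rw [add_zero] at h; rw [h]; simp
  · refine AnalyticAt.comp (g := Gamma) (analyticAt_Gamma fun m h => ?_) (by fun_prop)
    have := congrArg re h
    simp at this
    have h2 : (0 : ℝ) ≤ m := m.cast_nonneg
    linarith

lemma analyticAt_phiTwist (hα : ∀ (k : Fin n) (m : ℤ), α k ≠ m) (j : ℕ) :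
    AnalyticAt ℂ (phiTwist α j) 0 :=
  AnalyticAt.fun_mul (by fun_prop) (analyticAt_phi hα)

/-- `Γ(-s) = -Γ(1 - s)/s` exhibits the pole of order at most `n` at `0` and accounts for the factor
`Γ(1 - s)^n` in `φ`. -/
lemma mbIntegrand_eq_phiTwist (hα : ∀ (k : Fin n) (m : ℤ), α k ≠ m) (j : Fin n) (z : ℂ) {s : ℂ}
    (hs : s ≠ 0) : mbIntegrand α (fun _ => 1) j z s =
      (-1) ^ n * (∏ k, Gamma (α k)) * (phiTwist α j s * exp (s * cutLog z)) / s ^ n := by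
  have hG : Gamma (1 - 1 - s) = -1 * (Gamma (1 - s) / s) := by
    have := Gamma_add_one (-s) (neg_ne_zero.2 hs)
    rw [sub_self, zero_sub, show (1 : ℂ) - s = -s + 1 by ring, this]
    field_simp
  have hC := prod_Gamma_ne_zero hα
  rw [mbIntegrand, hG, phiTwist, phi, Finset.prod_mul_distrib, Finset.prod_const, Finset.card_univ,
    Fintype.card_fin, mul_pow, div_pow,
    mul_comm s ((2 * ((j : ℕ) : ℂ) - (n : ℂ)) * Real.pi * I)]
  field_simp

/-- The behaviour of the integrand at the nonnegative integers. -/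
lemma mbIntegrand_eventuallyEq (hα : ∀ (k : Fin n) (m : ℤ), α k ≠ m) (j : Fin n) {z : ℂ}
    (hz : z ∈ cutPlane) (m : ℕ) : ∀ᶠ s in 𝓝[≠] (m : ℂ), mbIntegrand α (fun _ => 1) j z s =
      (-1) ^ n * (∏ k, Gamma (α k)) * z ^ m *
        (phiTwist α j (s - m) * (hyperCoeff α m (s - m) * exp ((s - m) * cutLog z))) /
          (s - m) ^ n := by
  have h1 : ∀ᶠ s : ℂ in 𝓝 (m : ℂ), ∀ k : Fin n, ∀ i ∈ Finset.range m, α k + ((s - m) + i) ≠ 0 := by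
    refine eventually_all.2 fun k => (Finset.eventually_all _).2 fun i _ => ?_
    refine ContinuousAt.eventually_ne (by fun_prop) fun h => hα k (-i) ?_
    push_cast
    linear_combination h
  have h2 : ∀ᶠ s : ℂ in 𝓝 (m : ℂ), ‖s - m‖ < 1 := by
    filter_upwards [Metric.ball_mem_nhds (m : ℂ) one_pos] with s hs using mem_ball_iff_norm.1 hs
  filter_upwards [self_mem_nhdsWithin, mem_nhdsWithin_of_mem_nhds h1,
    mem_nhdsWithin_of_mem_nhds h2] with s hs0 hs1 hs2
  have key := mbIntegrand_add_nat (α := α) (j := j) (s := s - m) hz m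
    (fun i hi k => hs1 k i (Finset.mem_range.2 hi))
    (fun i _ h => nat_add_one_add_ne_zero hs2 i (by linear_combination h))
  rw [sub_add_cancel] at key
  rw [key, mbIntegrand_eq_phiTwist hα j z (sub_ne_zero.2 hs0)]
  ring

end Poles

variable {n : ℕ} {α : Fin n → ℂ}

/-! ### Convergence of the integrals and the finite residue formula. -/

section Contours

lemma continuous_mbIntegrand_comp {η : ℝ → ℂ} (hη : Continuous η)
    (h1 : ∀ (k : Fin n) (m : ℕ), -α k - m ∉ range η) (h2 : ∀ m : ℕ, (m : ℂ) ∉ range η)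
    (j : Fin n) (z : ℂ) : Continuous fun t => mbIntegrand α (fun _ => 1) j z (η t) :=
  continuous_iff_continuousAt.2 fun t =>
    ContinuousAt.comp (g := mbIntegrand α (fun _ => 1) j z) (f := η)
      (differentiableAt_mbIntegrand (s := η t)
        (fun k m h => h1 k m ⟨t, by linear_combination h⟩)
        (fun m h => h2 m ⟨t, h⟩)).continuousAt hη.continuousAt

lemma IsContour.notMem_range_left {γ : ℝ → ℂ} (h : IsContour α (fun _ => 1) γ) (k : Fin n)
    (m : ℕ) : -α k - m ∉ range γ := (h.left k m).notMem_range

lemma IsContour.isRightOf_nat {γ : ℝ → ℂ} (h : IsContour α (fun _ => 1) γ) (hn : 0 < n) (m : ℕ) :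
    IsRightOf γ m := by
  simpa using h.right ⟨0, hn⟩ m

/-- The Mellin–Barnes integrals converge absolutely. -/
theorem IsContour.integrable {γ : ℝ → ℂ} (h : IsContour α (fun _ => 1) γ) (j : Fin n) {z : ℂ}
    (hz : z ∈ cutPlane) :
    Integrable fun t : ℝ => mbIntegrand α (fun _ => 1) j z (γ t) * deriv γ t := by
  have hn : 0 < n := (Nat.zero_le _).trans_lt j.2
  obtain ⟨C', hC'⟩ := h.isTame.ae_norm_deriv_le
  refine Integrable.mul_bdd ?_ (measurable_deriv γ).aestronglyMeasurable hC'
  obtain ⟨C, c, R, hc, hb⟩ := exists_norm_mbIntegrand_le α j hz 0 0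
  obtain ⟨R₀, hR⟩ := h.axis
  refine integrable_of_exp_decay (C := C) (c := c) (R := max R R₀)
    (continuous_mbIntegrand_comp h.continuous h.notMem_range_left
      (fun m => (h.isRightOf_nat hn m).notMem_range) j z) hc fun t ht => ?_
  have e := hR t ((le_max_right _ _).trans ht)
  have him : |(γ t).im| = |t| := by rw [e]; simp
  have := hb (γ t) (by rw [e]; simp) (by rw [e]; simp)
    (by rw [him]; exact (le_max_left _ _).trans ht)
  rwa [him] at this

/-- The abscissa of the vertical line between `N` and `N + 1`. -/
noncomputable def midLine (N : ℕ) (t : ℝ) : ℂ := ((N + 1 / 2 : ℝ) : ℂ) + t * I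

lemma midLine_re (N : ℕ) (t : ℝ) : (midLine N t).re = N + 1 / 2 := by
  simp [midLine]

lemma midLine_im (N : ℕ) (t : ℝ) : (midLine N t).im = t := by
  simp [midLine]

lemma nat_notMem_range_midLine (N m : ℕ) : (m : ℂ) ∉ range (midLine N) := by
  rintro ⟨t, ht⟩
  have := congrArg re ht
  rw [midLine_re, natCast_re] at this
  have h2 : (2 * N + 1 : ℝ) = 2 * m := by linarith
  have h3 : 2 * N + 1 = 2 * m := by exact_mod_cast h2
  omega

lemma left_notMem_range_midLine {N : ℕ} (hN : ∀ k, ‖α k‖ ≤ N) (k : Fin n) (m : ℕ) :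
    -α k - m ∉ range (midLine N) := by
  rintro ⟨t, ht⟩
  have := congrArg re ht
  rw [midLine_re, sub_re, neg_re, natCast_re] at this
  have h1 := (abs_le.1 ((abs_re_le_norm (α k)).trans (hN k))).1
  have h2 : (0 : ℝ) ≤ m := m.cast_nonneg
  linarith

lemma integrable_midLine {N : ℕ} (hN : ∀ k, ‖α k‖ ≤ N) (j : Fin n) {z : ℂ} (hz : z ∈ cutPlane) :
    Integrable fun t => mbIntegrand α (fun _ => 1) j z (midLine N t) := by
  obtain ⟨C, c, R, hc, hb⟩ := exists_norm_mbIntegrand_le α j hz (N + 1 / 2) (N + 1 / 2)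
  refine integrable_of_exp_decay (C := C) (c := c) (R := R)
    (continuous_mbIntegrand_comp (by unfold midLine; fun_prop) (left_notMem_range_midLine hN)
      (nat_notMem_range_midLine N) j z) hc fun t ht => ?_
  have := hb (midLine N t) (midLine_re N t).ge (midLine_re N t).le (by rwa [midLine_im])
  rwa [midLine_im] at this

/-- The residue of the integrand at `m`, up to normalization. -/
noncomputable def mbResidue (α : Fin n → ℂ) (j : ℕ) (z : ℂ) (m : ℕ) : ℂ :=
  taylorCoeff (fun s => phiTwist α j s * (hyperCoeff α m s * exp (s * cutLog z))) 0 (n - 1)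

lemma taylorCoeff_comp_sub (f : ℂ → ℂ) (p : ℂ) (i : ℕ) :
    taylorCoeff (fun s => f (s - p)) p i = taylorCoeff f 0 i := by
  rw [taylorCoeff, taylorCoeff, iteratedDeriv_comp_sub_const]
  simp only [sub_self]

lemma taylorCoeff_const_mul (c : ℂ) (f : ℂ → ℂ) (p : ℂ) (i : ℕ) :
    taylorCoeff (fun s => c * f s) p i = c * taylorCoeff f p i := by
  rw [taylorCoeff, taylorCoeff, iteratedDeriv_const_mul_field, mul_div_assoc]

/-- The Mellin–Barnes integral as a finite sum of residues and an integral over a vertical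
line. -/
theorem IsContour.integral_add_integral_midLine (hα : ∀ (k : Fin n) (m : ℤ), α k ≠ m) {γ : ℝ → ℂ}
    (h : IsContour α (fun _ => 1) γ) (j : Fin n) {z : ℂ} (hz : z ∈ cutPlane) :
    ∀ᶠ N : ℕ in atTop,
      (∫ t : ℝ, mbIntegrand α (fun _ => 1) j z (γ t) * deriv γ t) +
        (∫ t : ℝ, mbIntegrand α (fun _ => 1) j z (midLine N t)) * I =
      2 * Real.pi * I * ((-1) ^ n * (∏ k, Gamma (α k)) *
        ∑ m ∈ Finset.range (N + 1), mbResidue α j z m * z ^ m) := by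
  classical
  have hn : 0 < n := (Nat.zero_le _).trans_lt j.2
  obtain ⟨M, hM0, hM⟩ := IsAxial.exists_abs_re_le h.axis h.continuous
  filter_upwards [tendsto_natCast_atTop_atTop.eventually (eventually_ge_atTop M),
    tendsto_natCast_atTop_atTop.eventually (eventually_ge_atTop (∑ k, ‖α k‖))] with N hNM hNα
  have hNk : ∀ k, ‖α k‖ ≤ N := fun k =>
    (Finset.single_le_sum (f := fun k => ‖α k‖) (fun _ _ => norm_nonneg _)
      (Finset.mem_univ k)).trans hNα
  set F := mbIntegrand α (fun _ => 1) j z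
  -- A pole `-α_k - m` with real part above `-(M + 1)` has `m < M + 1 + N`, since `|Re α_k| ≤ N`. So
  -- `Sl` contains all left poles in the strip.
  obtain ⟨K, hK⟩ := exists_nat_gt (M + 1 + N)
  set Sl : Finset ℂ := (Finset.univ ×ˢ Finset.range K).image fun q : Fin n × ℕ => -α q.1 - q.2
  set Sr : Finset ℂ := (Finset.range (N + 1)).image fun m : ℕ => (m : ℂ)
  have hlnat : ∀ (k : Fin n) (m m' : ℕ), -α k - m ≠ m' := fun k m m' he =>
    hα k (-(m + m')) (by push_cast; linear_combination -he)
  have hSl : ∀ p ∈ Sl, ∃ (k : Fin n) (m : ℕ), p = -α k - m := fun p hp => by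
    obtain ⟨q, -, rfl⟩ := Finset.mem_image.1 hp
    exact ⟨q.1, q.2, rfl⟩
  have hSr : ∀ p ∈ Sr, ∃ m ∈ Finset.range (N + 1), (m : ℂ) = p := fun p hp =>
    Finset.mem_image.1 hp
  have hdisj : ∀ p ∈ Sl, p ∉ Sr := fun p hp hp' => by
    obtain ⟨k, m, rfl⟩ := hSl p hp
    obtain ⟨m', -, he⟩ := hSr _ hp'
    exact hlnat k m m' he.symm
  have hgl : ∀ p ∈ Sl, ∃ g : ℂ → ℂ, AnalyticAt ℂ g p ∧
      ∀ᶠ s in 𝓝[≠] p, F s = g s / (s - p) ^ n := fun p hp => by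
    obtain ⟨k, m, rfl⟩ := hSl p hp
    exact exists_mbIntegrand_eq_div j z (hlnat k m)
  choose! gl hgl using hgl
  -- The floor recovers `m` from the pole `p = m`.
  set gr : ℂ → ℂ → ℂ := fun p s => (-1) ^ n * (∏ k, Gamma (α k)) * z ^ ⌊p.re⌋₊ *
    (phiTwist α j (s - p) * (hyperCoeff α ⌊p.re⌋₊ (s - p) * exp ((s - p) * cutLog z)))
  have hgr : ∀ p ∈ Sr, AnalyticAt ℂ (gr p) p ∧ ∀ᶠ s in 𝓝[≠] p, F s = gr p s / (s - p) ^ n :=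
    fun p hp => by
      obtain ⟨m, -, rfl⟩ := hSr p hp
      refine ⟨?_, ?_⟩
      · have hsub : AnalyticAt ℂ (fun s : ℂ => s - m) m := by fun_prop
        have h1 : AnalyticAt ℂ (fun s => phiTwist α j (s - m)) m :=
          AnalyticAt.comp (g := phiTwist α j) (f := fun s : ℂ => s - m)
            (by simpa using analyticAt_phiTwist hα j) hsub
        have h2 : AnalyticAt ℂ (fun s => hyperCoeff α ⌊(m : ℂ).re⌋₊ (s - m)) m :=
          AnalyticAt.comp (g := hyperCoeff α _) (f := fun s : ℂ => s - m)
            (by simpa using analyticAt_hyperCoeff α _) hsub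
        exact analyticAt_const.fun_mul (h1.fun_mul (h2.fun_mul (by fun_prop)))
      · simp only [gr, natCast_re, Nat.floor_natCast]
        exact mbIntegrand_eventuallyEq hα j hz m
  set g : ℂ → ℂ → ℂ := fun p => if p ∈ Sr then gr p else gl p
  set w : ℂ → ℂ := fun p => if p ∈ Sr then Real.pi * I else -(Real.pi * I)
  have key := tendsto_integral_add_integral_line h.isTame h.axis (A := -(M + 1)) (B := N + 1)
    (c := N + 1 / 2) (f := F) (S := Sl ∪ Sr) (g := g) (w := w)
    (fun t => by
      have := abs_le.1 (hM t)
      constructor <;> linarith) (by positivity) (by linarith) hn ?_ ?_ ?_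
    (tendsto_mbIntegrand_stripEnds α j hz _)
  · have hlim : Tendsto (fun R : ℝ => (∫ t in (-R)..R, F (γ t) * deriv γ t) +
        ∫ t in (-R)..R, F (((N + 1 / 2 : ℝ) : ℂ) + t * I) * I) atTop
        (𝓝 ((∫ t : ℝ, F (γ t) * deriv γ t) + (∫ t : ℝ, F (midLine N t)) * I)) := by
      rw [← integral_mul_const]
      exact (intervalIntegral_tendsto_integral (h.integrable j hz) tendsto_neg_atTop_atBot
        tendsto_id).add (intervalIntegral_tendsto_integral
          ((integrable_midLine hNk j hz).mul_const I) tendsto_neg_atTop_atBot tendsto_id)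
    -- Left poles have `w p + πi = 0` and drop out; each right pole up to `N` has weight `2πi`.
    rw [tendsto_nhds_unique hlim key,
      ← Finset.sum_subset (Finset.subset_union_right : Sr ⊆ Sl ∪ Sr) fun p _ hp => by
        simp only [w, if_neg hp]; ring,
      Finset.sum_image fun a _ b _ hab => Nat.cast_injective hab, Finset.mul_sum, Finset.mul_sum]
    refine Finset.sum_congr rfl fun m hm => ?_
    have hmS : (m : ℂ) ∈ Sr := Finset.mem_image_of_mem _ hm
    simp only [g, w, if_pos hmS, gr, natCast_re, Nat.floor_natCast]
    rw [taylorCoeff_const_mul, taylorCoeff_comp_sub (fun s => phiTwist α j s *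
      (hyperCoeff α m s * exp (s * cutLog z))), mbResidue]
    ring
  · intro s hs1 hs2 hsS
    rw [Finset.mem_union, not_or] at hsS
    refine differentiableAt_mbIntegrand (fun k m he => ?_) fun m he => ?_
    · have hse : s = -α k - m := by linear_combination he
      refine hsS.1 (Finset.mem_image.2 ⟨(k, m), ?_, hse.symm⟩)
      simp only [Finset.mem_product, Finset.mem_univ, true_and, Finset.mem_range]
      have h1 := (abs_le.1 ((abs_re_le_norm (α k)).trans (hNk k))).1
      rw [hse, sub_re, neg_re, natCast_re] at hs1
      have : (m : ℝ) < K := by linarith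
      exact_mod_cast this
    · refine hsS.2 (Finset.mem_image.2 ⟨m, ?_, he.symm⟩)
      rw [he, natCast_re] at hs2
      rw [Finset.mem_range]
      exact_mod_cast hs2
  · intro p hp
    by_cases hpr : p ∈ Sr
    · simp only [g, if_pos hpr]
      exact hgr p hpr
    · simp only [g, if_neg hpr]
      exact hgl p ((Finset.mem_union.1 hp).resolve_right hpr)
  · intro p hp
    by_cases hpr : p ∈ Sr
    · simp only [w, if_pos hpr]
      obtain ⟨m, hm, rfl⟩ := hSr p hpr
      have hr := h.isRightOf_nat hn m
      refine ⟨hr.notMem_range, ?_, hasPV_inv_of_isRightOf h.isTame h.axis hr⟩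
      have : (m : ℝ) ≤ N := by exact_mod_cast Nat.lt_succ_iff.1 (Finset.mem_range.1 hm)
      rw [natCast_re]
      linarith
    · simp only [w, if_neg hpr]
      obtain ⟨k, m, rfl⟩ := hSl p ((Finset.mem_union.1 hp).resolve_right hpr)
      refine ⟨h.notMem_range_left k m, ?_, hasPV_inv_of_isLeftOf h.isTame h.axis (h.left k m)⟩
      have h1 := (abs_le.1 ((abs_re_le_norm (α k)).trans (hNk k))).1
      have h2 : (0 : ℝ) ≤ m := m.cast_nonneg
      rw [sub_re, neg_re, natCast_re]
      linarith

end Contours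

/-! ### Summing the residues and identifying the coefficient matrix. -/

section Limit

/-- The integrals over the vertical lines tend to zero. -/
lemma tendsto_integral_midLine (α : Fin n → ℂ) (j : Fin n) {z : ℂ} (hz : z ∈ cutDisc 1) :
    Tendsto (fun N => ∫ t : ℝ, mbIntegrand α (fun _ => 1) j z (midLine N t)) atTop (𝓝 0) := by
  obtain ⟨K, hK0, hK⟩ := exists_norm_prod_div_le α
  have hz1 := norm_lt_of_mem_cutDisc hz
  -- The recursion bounds `J (N + 1) / J N` by a quantity tending to `|z| < 1`, so `J` is summable
  -- by the ratio test.
  set J : ℕ → ℝ := fun N => ∫ t : ℝ, ‖mbIntegrand α (fun _ => 1) j z (midLine N t)‖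
  have hJ0 : ∀ N, 0 ≤ J N := fun N => integral_nonneg fun t => norm_nonneg _
  have hstep : ∀ᶠ N : ℕ in atTop, J (N + 1) ≤ (1 + K / ((N : ℝ) + 3 / 2)) ^ n * ‖z‖ * J N := by
    filter_upwards [tendsto_natCast_atTop_atTop.eventually (eventually_ge_atTop (∑ k, ‖α k‖))]
      with N hN
    have hNk : ∀ k, ‖α k‖ ≤ N := fun k =>
      (Finset.single_le_sum (f := fun k => ‖α k‖) (fun _ _ => norm_nonneg _)
        (Finset.mem_univ k)).trans hN
    have hNk' : ∀ k, ‖α k‖ ≤ ((N + 1 : ℕ) : ℝ) := fun k => (hNk k).trans (by simp)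
    rw [← integral_const_mul]
    refine integral_mono (integrable_midLine hNk' j hz.2).norm
      ((integrable_midLine hNk j hz.2).norm.const_mul _) fun t => ?_
    have e : midLine (N + 1) t = midLine N t + 1 := by
      simp only [midLine]; push_cast; ring
    have hre : (1 + midLine N t).re = (N : ℝ) + 3 / 2 := by
      rw [add_re, midLine_re, one_re]; ring
    dsimp only
    rw [e, mbIntegrand_add_one hz.2
      (fun k he => left_notMem_range_midLine hNk k 0 ⟨t, by push_cast; linear_combination he⟩)
      (fun he => by rw [add_comm] at he; rw [he, zero_re] at hre; linarith [N.cast_nonneg (α := ℝ)]),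
      norm_mul, norm_mul]
    have := hK (midLine N t) ((N : ℝ) + 3 / 2) (by positivity) hre.ge
    calc _ ≤ ‖mbIntegrand α (fun _ => 1) j z (midLine N t)‖ * ‖z‖ *
          (1 + K / ((N : ℝ) + 3 / 2)) ^ n := by gcongr
      _ = _ := by ring
  have hJ : Tendsto J atTop (𝓝 0) := by
    obtain ⟨r, hzr, hr1⟩ := exists_between hz1
    refine (summable_of_ratio_norm_eventually_le (f := J) hr1 ?_).tendsto_atTop_zero
    filter_upwards [hstep, (tendsto_one_add_div_pow K (3 / 2) n ‖z‖).eventually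
      (eventually_le_nhds hzr)] with N h1 h2
    rw [Real.norm_of_nonneg (hJ0 _), Real.norm_of_nonneg (hJ0 _)]
    exact h1.trans (mul_le_mul_of_nonneg_right h2 (hJ0 N))
  exact squeeze_zero_norm (fun N => norm_integral_le_integral_norm _) hJ

/-- The coefficient of `s^k` in `a_m(s) e^{s log z} z^m`, summed over `m`: the Cauchy product with
the exponential series produces the powers of the logarithm. -/
lemma hasSum_logSum {a : ℕ → PowerSeries ℂ} (ha : IsAdmissible a) (k : ℕ) {z : ℂ} (hz : ‖z‖ < 1) :
    HasSum (fun m => PowerSeries.coeff k (a m * taylorSeries fun s => exp (s * cutLog z)) * z ^ m)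
      (logSum a k z) := by
  have h : HasSum (fun m => ∑ l ∈ Finset.range (k + 1), PowerSeries.coeff (k - l) (a m) * z ^ m *
      (cutLog z ^ l / (l.factorial : ℂ))) (logSum a k z) :=
    hasSum_sum fun l _ => (ha.summable (k - l) hz).hasSum.mul_right _
  refine h.congr_fun fun m => ?_
  rw [mul_comm (a m), PowerSeries.coeff_mul, Finset.Nat.sum_antidiagonal_eq_sum_range_succ_mk,
    Finset.sum_mul]
  refine Finset.sum_congr rfl fun l _ => ?_
  simp only [coeff_taylorSeries, taylorCoeff_exp_mul]
  ring

/-- In the coefficient of `s^{n-1}` the factor `phiTwist` is independent of `m`. Splitting it off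
leaves the coefficients of `s^{n-1-l}`, whose sums over `m` are the Frobenius functions. -/
lemma hasSum_mbResidue (hα : ∀ (k : Fin n) (m : ℤ), α k ≠ m) (j : Fin n) {z : ℂ} (hz : ‖z‖ < 1) :
    HasSum (fun m => mbResidue α j z m * z ^ m)
      (∑ l : Fin n, taylorCoeff (phiTwist α j) 0 l * logSum (hyperSeries α) (n - 1 - l) z) := by
  have hn : 0 < n := (Nat.zero_le _).trans_lt j.2
  have h : HasSum (fun m => ∑ l : Fin n, taylorCoeff (phiTwist α j) 0 l *
      (PowerSeries.coeff (n - 1 - l) (hyperSeries α m * taylorSeries fun s => exp (s * cutLog z)) *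
        z ^ m))
      (∑ l : Fin n, taylorCoeff (phiTwist α j) 0 l * logSum (hyperSeries α) (n - 1 - l) z) :=
    hasSum_sum fun l _ => (hasSum_logSum (isAdmissible_hyperSeries α) _ hz).mul_left _
  refine h.congr_fun fun m => ?_
  have hE : AnalyticAt ℂ (fun s => exp (s * cutLog z)) 0 := by fun_prop
  rw [mbResidue, ← coeff_taylorSeries, taylorSeries_mul (analyticAt_phiTwist hα j)
    ((analyticAt_hyperCoeff α m).fun_mul hE), taylorSeries_mul (analyticAt_hyperCoeff α m) hE,
    PowerSeries.coeff_mul, Finset.Nat.sum_antidiagonal_eq_sum_range_succ_mk, Finset.sum_mul,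
    Nat.succ_eq_add_one, Nat.sub_add_cancel hn,
    Fin.sum_univ_eq_sum_range (fun l => taylorCoeff (phiTwist α j) 0 l *
      (PowerSeries.coeff (n - 1 - l) (hyperSeries α m * taylorSeries fun s => exp (s * cutLog z)) *
        z ^ m)) n]
  refine Finset.sum_congr rfl fun l _ => ?_
  simp only [coeff_taylorSeries]
  rw [mul_assoc]
  rfl

/-- Row `j` of `Q` holds the Taylor coefficients of `e^{(j - n/2)u}` and `Φ` multiplies by those of
`φ`, both in the variable `u = 2πi s`. The matrix product is the Cauchy product for `phiTwist`. -/
lemma matrixQ_mul_matrixPhi (hα : ∀ (k : Fin n) (m : ℤ), α k ≠ m) (j l : Fin n) :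
    (matrixQ n * matrixPhi α) j l =
      taylorCoeff (phiTwist α j) 0 l / (2 * Real.pi * I) ^ (l : ℕ) := by
  have hE : AnalyticAt ℂ (fun s => exp (s * ((2 * ((j : ℕ) : ℂ) - (n : ℂ)) * Real.pi * I))) 0 := by
    fun_prop
  have h1 : taylorCoeff (phiTwist α j) 0 l = ∑ k ∈ Finset.range ((l : ℕ) + 1),
      ((2 * ((j : ℕ) : ℂ) - (n : ℂ)) * Real.pi * I) ^ k / (k.factorial : ℂ) *
        taylorCoeff (phi α) 0 (l - k) := by
    have := congrArg (PowerSeries.coeff (l : ℕ)) (taylorSeries_mul hE (analyticAt_phi hα))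
    rw [PowerSeries.coeff_mul, Finset.Nat.sum_antidiagonal_eq_sum_range_succ_mk,
      coeff_taylorSeries] at this
    simp only [coeff_taylorSeries, taylorCoeff_exp_mul] at this
    exact this
  rw [Matrix.mul_apply, h1, Finset.sum_div]
  refine (Fin.sum_univ_eq_sum_range (fun k => ((((j : ℕ) : ℂ) - (n : ℂ) / 2) ^ k / (k.factorial : ℂ)) *
      if k ≤ (l : ℕ) then iteratedDeriv ((l : ℕ) - k) (phi α) 0 /
        (((l : ℕ) - k).factorial * (2 * Real.pi * I) ^ ((l : ℕ) - k)) else 0) n).trans ?_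
  rw [← Finset.sum_subset (Finset.range_subset_range.2 (Nat.succ_le_of_lt l.2)) fun k _ hk => by
      rw [if_neg (by simpa using hk), mul_zero]]
  refine Finset.sum_congr rfl fun k hk => ?_
  have hkl : k ≤ (l : ℕ) := Nat.lt_succ_iff.1 (Finset.mem_range.1 hk)
  have h2 : (2 * Real.pi * I : ℂ) ^ (l : ℕ) =
      (2 * Real.pi * I) ^ k * (2 * Real.pi * I) ^ ((l : ℕ) - k) := by
    rw [← pow_add, Nat.add_sub_cancel' hkl]
  have h3 : (2 * ((j : ℕ) : ℂ) - (n : ℂ)) * Real.pi * I =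
      (((j : ℕ) : ℂ) - (n : ℂ) / 2) * (2 * Real.pi * I) := by ring
  have h4 := two_pi_I_pow_ne_zero k
  have h5 := two_pi_I_pow_ne_zero ((l : ℕ) - k)
  rw [if_pos hkl, h2, h3, mul_pow _ (2 * Real.pi * I : ℂ) k, taylorCoeff]
  generalize (2 * Real.pi * I : ℂ) ^ k = x at *
  generalize (2 * Real.pi * I : ℂ) ^ ((l : ℕ) - k) = y at *
  field_simp

/-- The Mellin–Barnes integrals in terms of the Frobenius basis. -/
theorem IsContour.normMellinBarnes_eq (hα : ∀ (k : Fin n) (m : ℤ), α k ≠ m) {γ : ℝ → ℂ}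
    (h : IsContour α (fun _ => 1) γ) (j : Fin n) {z : ℂ} (hz : z ∈ cutDisc 1) :
    normMellinBarnes α (fun _ => 1) γ j z =
      ∑ l, (matrixQ n * matrixPhi α) j l * frobeniusFamily (frobeniusCoeff α) l z := by
  have hn : 0 < n := (Nat.zero_le _).trans_lt j.2
  have hC := prod_Gamma_ne_zero hα
  have h1 := (tendsto_integral_midLine α j hz).mul_const I
  have h2 := h1.const_add (∫ t : ℝ, mbIntegrand α (fun _ => 1) j z (γ t) * deriv γ t)
  have h3 := ((((hasSum_mbResidue hα j (norm_lt_of_mem_cutDisc hz)).tendsto_sum_nat.comp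
    (tendsto_add_atTop_nat 1)).const_mul ((-1) ^ n * ∏ k, Gamma (α k))).const_mul
      (2 * Real.pi * I : ℂ))
  have h4 := tendsto_nhds_unique (h2.congr' (h.integral_add_integral_midLine hα j hz.2)) h3
  rw [zero_mul, add_zero] at h4
  have hsq : ((-1 : ℂ) ^ n) * (-1) ^ n = 1 := by rw [← mul_pow]; simp
  have hpow : (2 * Real.pi * I : ℂ) ^ n = (2 * Real.pi * I) ^ (n - 1) * (2 * Real.pi * I) := by
    rw [← pow_succ, Nat.sub_add_cancel hn]
  have h5 : normMellinBarnes α (fun _ => 1) γ j z =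
      (∑ l : Fin n, taylorCoeff (phiTwist α j) 0 l * logSum (hyperSeries α) (n - 1 - l) z) /
        (2 * Real.pi * I) ^ (n - 1) := by
    have h6 := two_pi_I_pow_ne_zero (n - 1)
    have h7 := two_pi_I_ne_zero
    rw [normMellinBarnes, mellinBarnes, h4, hpow]
    generalize (∑ l : Fin n, taylorCoeff (phiTwist α j) 0 l *
      logSum (hyperSeries α) (n - 1 - l) z) = x
    rw [div_mul_eq_mul_div, div_div, div_eq_div_iff (mul_ne_zero (mul_ne_zero h6 h7) hC) h6]
    linear_combination (2 * Real.pi * I) ^ (n - 1) * (2 * Real.pi * I) * (∏ k, Gamma (α k)) *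
      x * hsq
  rw [h5, Finset.sum_div]
  refine Finset.sum_congr rfl fun l _ => ?_
  have h8 : (2 * Real.pi * I : ℂ) ^ (n - 1) =
      (2 * Real.pi * I) ^ (l : ℕ) * (2 * Real.pi * I) ^ (n - 1 - (l : ℕ)) := by
    rw [← pow_add]; congr 1; omega
  rw [matrixQ_mul_matrixPhi hα, frobeniusFamily, frobeniusFun_frobeniusCoeff, h8]
  rw [div_mul_div_comm]

end Limit

/-! ### Invertibility of `Q` and `Φ`, and the theorem. -/

section Main

/-- A Vandermonde matrix with distinct nodes `k - n/2`, times the diagonal of inverse factorials. -/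
lemma isUnit_matrixQ (n : ℕ) : IsUnit (matrixQ n) := by
  have h : matrixQ n = Matrix.vandermonde (fun k : Fin n => ((k : ℕ) : ℂ) - (n : ℂ) / 2) *
      Matrix.diagonal fun l : Fin n => (((l : ℕ).factorial : ℕ) : ℂ)⁻¹ := by
    ext k l
    rw [Matrix.mul_diagonal, Matrix.vandermonde_apply, matrixQ, Matrix.of_apply, div_eq_mul_inv]
  rw [Matrix.isUnit_iff_isUnit_det, h, Matrix.det_mul, Matrix.det_diagonal, isUnit_iff_ne_zero]
  refine mul_ne_zero (Matrix.det_vandermonde_ne_zero_iff.2 fun a b hab => ?_)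
    (Finset.prod_ne_zero_iff.2 fun l _ => inv_ne_zero (by exact_mod_cast (l : ℕ).factorial_ne_zero))
  have : ((a : ℕ) : ℂ) = ((b : ℕ) : ℂ) := by simpa using hab
  exact Fin.ext (by exact_mod_cast this)

/-- Triangular with diagonal entries `φ(0) = 1`. -/
lemma isUnit_matrixPhi (hα : ∀ (k : Fin n) (m : ℤ), α k ≠ m) : IsUnit (matrixPhi α) := by
  have htri : (matrixPhi α).IsUpperTriangular := fun k l hkl => by
    rw [matrixPhi, Matrix.of_apply, if_neg (not_le.2 (show l < k from hkl))]
  rw [Matrix.isUnit_iff_isUnit_det, Matrix.det_of_isUpperTriangular htri, isUnit_iff_ne_zero]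
  refine Finset.prod_ne_zero_iff.2 fun k _ => ?_
  have hC := prod_Gamma_ne_zero hα
  rw [matrixPhi, Matrix.of_apply, if_pos le_rfl, Nat.sub_self]
  simp [phi, hC]

end Main

end HypergeometricFrobenius

theorem mainTheorem5 (n : ℕ) (hn : 0 < n) (α : Fin n → ℂ)
    (hα : ∀ (k : Fin n) (m : ℤ), α k ≠ (m : ℂ)) :
    (∃ h : ℕ → ℂ → ℂ, HypergeometricFrobenius.IsFrobenius α 1 h) ∧
    ∀ r : ℝ, 0 < r → r ≤ 1 → ∀ h : ℕ → ℂ → ℂ, HypergeometricFrobenius.IsFrobenius α r h →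
      (∀ h' : ℕ → ℂ → ℂ, HypergeometricFrobenius.IsFrobenius α r h' →
        ∀ l < n, Set.EqOn (h' l) (h l) (Metric.ball 0 r)) ∧
      HypergeometricFrobenius.IsSolutionBasis α (fun _ => 1) (HypergeometricFrobenius.cutDisc r)
        (HypergeometricFrobenius.frobeniusFamily h) ∧
      ∀ γ : ℝ → ℂ, HypergeometricFrobenius.IsContour α (fun _ => 1) γ →
        (∀ (k : Fin n), ∀ z ∈ HypergeometricFrobenius.cutPlane, MeasureTheory.Integrable
          (fun t : ℝ => HypergeometricFrobenius.mbIntegrand α (fun _ => 1) k z (γ t) *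
            deriv γ t)) ∧
        HypergeometricFrobenius.IsSolutionBasis α (fun _ => 1) (HypergeometricFrobenius.cutDisc r)
          (HypergeometricFrobenius.normMellinBarnes α (fun _ => 1) γ) ∧
        ∀ T : Matrix (Fin n) (Fin n) ℂ,
          (∀ (k : Fin n), ∀ z ∈ HypergeometricFrobenius.cutDisc r,
            HypergeometricFrobenius.normMellinBarnes α (fun _ => 1) γ k z =
              ∑ l : Fin n, T k l * HypergeometricFrobenius.frobeniusFamily h l z) ↔
          T = HypergeometricFrobenius.matrixQ n * HypergeometricFrobenius.matrixPhi α := by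
  open HypergeometricFrobenius in
  refine ⟨⟨_, isFrobenius_frobeniusCoeff α⟩, fun r hr0 hr h hh => ⟨fun h' hh' l hl =>
    hh.eqOn hr0 hr hh' hl, hh.isSolutionBasis hr0 hr hn, fun γ hγ => ?_⟩⟩
  -- By uniqueness any Frobenius basis on the smaller disc is the restriction of the explicit one,
  -- for which the Mellin–Barnes expansion is known.
  have hfam : ∀ l : Fin n, ∀ z ∈ cutDisc r,
      frobeniusFamily (frobeniusCoeff α) l z = frobeniusFamily h l z := fun l z hz => by
    have he : ∀ k < n, frobeniusCoeff α k z = h k z := fun k hk =>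
      hh.eqOn hr0 hr ((isFrobenius_frobeniusCoeff α).mono hr) hk hz.1
    rw [frobeniusFamily, frobeniusFamily, frobeniusFun, frobeniusFun, he 0 hn]
    congr 2
    refine Finset.sum_congr rfl fun i hi => ?_
    rw [he _ (by omega)]
  have hval : ∀ (k : Fin n), ∀ z ∈ cutDisc r, normMellinBarnes α (fun _ => 1) γ k z =
      ∑ l, (matrixQ n * matrixPhi α) k l * frobeniusFamily h l z := fun k z hz => by
    rw [hγ.normMellinBarnes_eq hα k (cutDisc_mono hr hz)]
    exact Finset.sum_congr rfl fun l _ => by rw [hfam l z hz]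
  have hbasis := hh.isSolutionBasis hr0 hr hn
  refine ⟨fun k z hz => hγ.integrable k hz, ?_, fun T => ⟨fun hT => ?_, ?_⟩⟩
  · refine isSolutionBasis_of_linearIndependent hr0 hr hn (fun k => ?_) fun c hc => ?_
    · exact (IsSolution.sum (isOpen_cutDisc r) Finset.univ (fun l _ => hbasis.1 l) _).congr
        (isOpen_cutDisc r) fun z hz => (hval k z hz).symm
    -- A relation among the integrals is a relation among the Frobenius functions with coefficient
    -- vector `c · QΦ`; invertibility of `QΦ` then gives `c = 0`.
    · have hz : Matrix.vecMul c (matrixQ n * matrixPhi α) = 0 := by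
        refine hh.linearIndependent hr0 _ fun z hz => ?_
        refine Eq.trans ?_ (hc z hz)
        simp only [hval _ z hz, Matrix.vecMul, dotProduct, Finset.sum_mul, Finset.mul_sum,
          mul_assoc]
        exact Finset.sum_comm
      exact Matrix.vecMul_injective_of_isUnit ((isUnit_matrixQ n).mul (isUnit_matrixPhi hα))
        (hz.trans (Matrix.zero_vecMul _).symm)
  · ext k l
    have := hh.linearIndependent hr0 (fun l => T k l - (matrixQ n * matrixPhi α) k l)
      fun z hz => by
        simp only [sub_mul, Finset.sum_sub_distrib]
        rw [← hT k z hz, ← hval k z hz, sub_self]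
    exact sub_eq_zero.1 (congrFun this l)
  · rintro rfl
    exact hval
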